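/- **Convergence of generators.** Let $(\mathcal M,g)$ be a smooth compact Riemannian manifold without boundary of dimension $d\ge 2$, with Riemannian volume $\mathrm dx$, gradient $\nabla$, divergence $\nabla\cdot$ and Laplace–Beltrami operator $\Delta=\nabla\cdot\nabla$; write $(\cdot,\cdot)$ for the $L^2$ inner product of functions or vector fields and for the pairing of a distribution with a smooth function. For each $N\in\mathbb N$ let $Q^{(N)}\in C^\infty(\mathcal M\times\mathcal M,T\mathcal M\boxtimes T\mathcal M)$ be the kernel of a symmetric positive semidefinite operator on $L^2(\mathcal M,T\mathcal M)$, $(Q^{(N)}X)(x)=\int_{\mathcal M}Q^{(N)}(x,y)X(y)\,\mathrm dy$, which is divergence-free, $\nabla_x\cdot Q^{(N)}(x,y)=0$. Put $A^{(N)}(x)=Q^{(N)}(x,x)$, an endomorphism of $T_x\mathcal M$ (via $g$), and $L^{(N)}\phi=\nabla\cdot(A^{(N)}\nabla\phi)$. Assume the proper scaling condition $$A^{(N)}\longrightarrow \mathbf I\ \text{ in } C^\infty(\mathcal M,T^*\mathcal M\otimes T\mathcal M),\qquad Q^{(N)}\longrightarrow 0\ \text{ in } L^2(\mathcal M\times\mathcal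 M,T\mathcal M\boxtimes T\mathcal M)\qquad (N\to\infty).$$ For a cylindrical function $F(u)=f\big((u,\phi_1),\dots,(u,\phi_n)\big)$ with $f\in C_b^2(\mathbb R^n)$ (that is, $f$ is $C^2$ and $f$ and its derivatives of order at most $2$ are bounded) and $\phi_1,\dots,\phi_n\in C^\infty(\mathcal M)$, put $F_k(u)=\partial_kf\big((u,\phi_1),\dots,(u,\phi_n)\big)$ and $F_{kl}(u)=\partial_k\partial_lf\big((u,\phi_1),\dots,(u,\phi_n)\big)$ for distributions $u$ on $\mathcal M$. Let $\mathcal L^{(N)}$ be the generator of the stochastic transport equation $\mathrm du=\circ\,\mathrm dW\cdot\nabla u$ driven by the noise with covariance $Q^{(N)}$, i.e. the operator given by $$\mathcal L^{(N)}F(u)=\sum_{k=1}^nF_k(u)\,\big(u,\tfrac12L^{(N)}\phi_k\big)+\frac12\sum_{k,l=1}^nF_{kl}(u)\,\big(u\nabla\phi_k,\,Q^{(N)}(u\nabla\phi_l)\big),$$ where $\big(u\nabla\phi,Q(u\nabla\psi)\big)=\big(u,\ x\mapsto\big(u,\ y\mapsto\nabla\phi(x)\cdot Q(x,y)\nabla\psi(y)\big)\big)$,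 and let $$\mathcal L^{(\infty)}F(u)=\sum_{k=1}^nF_k(u)\,\big(u,\tfrac12\Delta\phi_k\big)+\frac12\sum_{k,l=1}^nF_{kl}(u)\,(\nabla\phi_k,\nabla\phi_l).$$ Let $\mu$ be the law of white noise on $\mathcal M$: under $\mu$ the variables $(u,\phi)$, $\phi\in C^\infty(\mathcal M)$, form a centered Gaussian process with $\mathbb E[(u,\phi)^2]=\|\phi\|_{L^2(\mathcal M)}^2$. Then for every such $F$ and every $p\in[1,\infty)$ the functions $\mathcal L^{(N)}F$ and $\mathcal L^{(\infty)}F$ belong to $L^p(\mu)$, and $$\mathcal L^{(N)}F\longrightarrow\mathcal L^{(\infty)}F\quad\text{in } L^p(\mu)\text{ as }N\to\infty .$$ -/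

import Mathlib

open MeasureTheory ProbabilityTheory Filter Topology
open scoped Manifold ContDiff ENNReal

namespace TransportNoise

noncomputable section

/-! ### Smooth functions, Riemannian metrics and coordinates on a manifold modelled on `ℝ^d` -/

/-- The space `ℝ^d` with its Euclidean structure. -/
abbrev Eu (d : ℕ) : Type := EuclideanSpace ℝ (Fin d)

/-- The space `C^∞(M)` of smooth real functions on `M`. -/
abbrev TestFun (d : ℕ) (M : Type*) [TopologicalSpace M] [ChartedSpace (Eu d) M] : Type _ :=
  C^∞⟮𝓡 d, M; 𝓘(ℝ, ℝ), ℝ⟯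

/-- Smooth Riemannian metrics on `M`. -/
abbrev Metric (d : ℕ) (M : Type*) [TopologicalSpace M] [ChartedSpace (Eu d) M]
    [IsManifold (𝓡 d) ∞ M] : Type _ :=
  Bundle.ContMDiffRiemannianMetric (𝓡 d) ∞ (Eu d) (fun x : M => TangentSpace (𝓡 d) x)

/-- The vectors of the standard basis of `ℝ^d`. -/
def stdVec {d : ℕ} (i : Fin d) : Eu d := EuclideanSpace.single i 1

section Geometry

variable {d : ℕ} {M : Type*} [TopologicalSpace M] [ChartedSpace (Eu d) M]

/-- The `i`-th component, in the chart `e`, of a tangent vector `v` at `p`: `dx^i(v)`. -/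
def coord (e : OpenPartialHomeomorph M (Eu d)) (p : M) (v : TangentSpace (𝓡 d) p) (i : Fin d) : ℝ :=
  (show Eu d from mfderiv (𝓡 d) 𝓘(ℝ, Eu d) e p v) i

/-- The coordinate vector `∂/∂x^i` of the chart `e` at the point with coordinates `y`. -/
def frame (e : OpenPartialHomeomorph M (Eu d)) (y : Eu d) (i : Fin d) :
    TangentSpace (𝓡 d) (e.symm y) :=
  mfderiv 𝓘(ℝ, Eu d) (𝓡 d) e.symm y (stdVec i)

/-- The differential `dφ` of a function, as a linear form on `T_p M`. -/
def diff (φ : M → ℝ) (p : M) : TangentSpace (𝓡 d) p →L[ℝ] ℝ :=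
  mfderiv (𝓡 d) 𝓘(ℝ, ℝ) φ p

/-- Convergence of functions on an open set `U ⊆ ℝ^d`, with all derivatives, uniformly on the
compact subsets of `U`. -/
def TendstoSmoothOn (F : ℕ → Eu d → ℝ) (G : Eu d → ℝ) (U : Set (Eu d)) : Prop :=
  ∀ K : Set (Eu d), IsCompact K → K ⊆ U → ∀ k : ℕ,
    TendstoUniformlyOn (fun n => iteratedFDeriv ℝ k (F n)) (iteratedFDeriv ℝ k G) atTop K

/-- Convergence in `C^∞(M)`. -/
def TendstoTestFun (φ : ℕ → TestFun d M) (ψ : TestFun d M) : Prop :=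
  ∀ e ∈ atlas (Eu d) M,
    TendstoSmoothOn (fun n y => φ n (e.symm y)) (fun y => ψ (e.symm y)) e.target

/-- Convergence in `C^∞(M, T^*M ⊗ TM)`: all components `A^i_j` of the endomorphism fields
converge, with all derivatives, locally uniformly in every chart. -/
def TendstoEndField (A : ℕ → ∀ x : M, TangentSpace (𝓡 d) x →L[ℝ] TangentSpace (𝓡 d) x)
    (B : ∀ x : M, TangentSpace (𝓡 d) x →L[ℝ] TangentSpace (𝓡 d) x) : Prop :=
  ∀ e ∈ atlas (Eu d) M, ∀ i j : Fin d,
    TendstoSmoothOn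
      (fun n y => coord e (e.symm y) (A n (e.symm y) (frame e y j)) i)
      (fun y => coord e (e.symm y) (B (e.symm y) (frame e y j)) i) e.target

variable [IsManifold (𝓡 d) ∞ M]

/-- Riesz representation in `T_x M` for the inner product `g_x`. -/
theorem exists_sharp (g : Metric d M) (x : M) (l : TangentSpace (𝓡 d) x →L[ℝ] ℝ) :
    ∃ v : TangentSpace (𝓡 d) x, ∀ w, g.inner x v w = l w := by
  have : FiniteDimensional ℝ (TangentSpace (𝓡 d) x) :=
    inferInstanceAs (FiniteDimensional ℝ (Eu d))
  let B : TangentSpace (𝓡 d) x →ₗ[ℝ] Module.Dual ℝ (TangentSpace (𝓡 d) x) :=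
    { toFun := fun v => (g.inner x v).toLinearMap
      map_add' := fun v w => by ext z; simp
      map_smul' := fun c v => by ext z; simp }
  have hinj : Function.Injective B := by
    rw [injective_iff_map_eq_zero]
    intro v hv
    by_contra hne
    have h0 : g.inner x v v = 0 := LinearMap.congr_fun hv v
    exact (g.pos x v hne).ne' h0
  have hsurj : Function.Surjective B :=
    (LinearMap.injective_iff_surjective_of_finrank_eq_finrank
      (Subspace.dual_finrank_eq (K := ℝ) (V := TangentSpace (𝓡 d) x)).symm).1 hinj
  obtain ⟨v, hv⟩ := hsurj l.toLinearMap
  exact ⟨v, fun w => LinearMap.congr_fun hv w⟩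

/-- The Riemannian gradient: `g(∇φ, w) = dφ(w)`. -/
def grad (g : Metric d M) (φ : M → ℝ) (x : M) : TangentSpace (𝓡 d) x :=
  (exists_sharp g x (diff φ x)).choose

theorem inner_grad (g : Metric d M) (φ : M → ℝ) (x : M) (w : TangentSpace (𝓡 d) x) :
    g.inner x (grad g φ x) w = diff φ x w :=
  (exists_sharp g x (diff φ x)).choose_spec w

/-- The matrix `g_{ij}` of the metric in the chart `e`. -/
def metricMatrix (g : Metric d M) (e : OpenPartialHomeomorph M (Eu d)) (y : Eu d) :
    Matrix (Fin d) (Fin d) ℝ :=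
  Matrix.of fun i j => g.inner (e.symm y) (frame e y i) (frame e y j)

/-- The Riemannian density `√|g|` in the chart `e`. -/
def density (g : Metric d M) (e : OpenPartialHomeomorph M (Eu d)) (y : Eu d) : ℝ :=
  Real.sqrt (metricMatrix g e y).det

/-- The divergence `|g|^{-1/2} ∂_i (|g|^{1/2} X^i)` of a vector field, at the point `p`, computed
in the preferred chart at `p`. -/
def divergence (g : Metric d M) (X : ∀ x : M, TangentSpace (𝓡 d) x) (p : M) : ℝ :=
  let e := chartAt (Eu d) p
  (density g e (e p))⁻¹ *
    ∑ i : Fin d, fderiv ℝ (fun y => density g e y * coord e (e.symm y) (X (e.symm y)) i) (e p)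
      (stdVec i)

/-- The operator `φ ↦ ∇ · (A ∇φ)` for a field `A` of endomorphisms of the tangent spaces. -/
def divGrad (g : Metric d M) (A : ∀ x : M, TangentSpace (𝓡 d) x →L[ℝ] TangentSpace (𝓡 d) x)
    (φ : M → ℝ) (p : M) : ℝ :=
  divergence g (fun x => A x (grad g φ x)) p

/-- The Laplace–Beltrami operator `Δ = ∇ · ∇`. -/
def laplacian (g : Metric d M) (φ : M → ℝ) (p : M) : ℝ :=
  divergence g (grad g φ) p

section Volume

variable [MeasurableSpace M]

/-- The measure `√|g| dx^1 ⋯ dx^d` on the domain of the chart `e`, extended by `0`. -/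
def chartVolume (g : Metric d M) (e : OpenPartialHomeomorph M (Eu d)) : Measure M :=
  ((volume.restrict e.target).withDensity (fun y => ENNReal.ofReal (density g e y))).map e.symm

/-- The Riemannian volume measure: the least measure that dominates `√|g| dx^1 ⋯ dx^d` on the
domain of every chart of the atlas (these measures agree on overlaps, so that on the domain of each
chart it is equal to `√|g| dx^1 ⋯ dx^d`). -/
def vol (g : Metric d M) : Measure M :=
  ⨆ e : atlas (Eu d) M, chartVolume g e.1

end Volume

/-! ### Covariance kernels -/

/-- An integral kernel of an operator on vector fields: `Q x y` is the element of
`T_x M ⊗ T_y M`, seen by means of the metric as a linear map `T_y M → T_x M`, so that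
`(Q X)(x) = ∫ Q(x, y) X(y) dy`. -/
abbrev Kernel (d : ℕ) (M : Type*) [TopologicalSpace M] [ChartedSpace (Eu d) M] : Type _ :=
  ∀ x y : M, TangentSpace (𝓡 d) y →L[ℝ] TangentSpace (𝓡 d) x

/-- Smoothness of a kernel on `M × M`: in any two charts its components `Q^i_j(x, y)` are smooth. -/
def SmoothKernel (Q : Kernel d M) : Prop :=
  ∀ e ∈ atlas (Eu d) M, ∀ e' ∈ atlas (Eu d) M, ∀ i j : Fin d,
    ContDiffOn ℝ ∞
      (fun z : Eu d × Eu d =>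
        coord e (e.symm z.1) (Q (e.symm z.1) (e'.symm z.2) (frame e' z.2 j)) i)
      (e.target ×ˢ e'.target)

/-- Smoothness of a vector field. -/
def SmoothField (X : ∀ x : M, TangentSpace (𝓡 d) x) : Prop :=
  ContMDiff (𝓡 d) (𝓡 d).tangent ∞ (fun x => (⟨x, X x⟩ : TangentBundle (𝓡 d) M))

/-- Smooth, positive semidefinite (in particular symmetric), divergence-free covariance kernels. -/
structure IsCovarianceKernel [MeasurableSpace M] (g : Metric d M) (Q : Kernel d M) : Prop where
  smooth : SmoothKernel Q
  symm : ∀ (x y : M) (v : TangentSpace (𝓡 d) x) (w : TangentSpace (𝓡 d) y),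
    g.inner x v (Q x y w) = g.inner y (Q y x v) w
  nonneg : ∀ X : (∀ x : M, TangentSpace (𝓡 d) x), SmoothField X →
    0 ≤ ∫ x, ∫ y, g.inner x (X x) (Q x y (X y)) ∂(vol g) ∂(vol g)
  divFree : ∀ (y : M) (w : TangentSpace (𝓡 d) y) (x : M), divergence g (fun z => Q z y w) x = 0

/-- The squared norm of a linear map `S : T_y M → T_x M` in `T_x M ⊗ T_y M`, i.e. its squared
Hilbert–Schmidt norm for `g_y` and `g_x`; with respect to a basis `b` of `T_y M` it is
`∑ g_y^{jl} g_x(S b_j, S b_l)`, where `g_y^{jl}` is the inverse of the Gram matrix of `b`. -/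
def hsNormSq (g : Metric d M) (x y : M)
    (S : TangentSpace (𝓡 d) y →L[ℝ] TangentSpace (𝓡 d) x) : ℝ :=
  let b : Fin d → TangentSpace (𝓡 d) y := fun j => (stdVec j : Eu d)
  let G : Matrix (Fin d) (Fin d) ℝ := Matrix.of fun j l => g.inner y (b j) (b l)
  ∑ j, ∑ l, G⁻¹ j l * g.inner x (S (b j)) (S (b l))

/-- A proper scaling: the kernels are covariance kernels, `A^{(N)}(x) = Q^{(N)}(x, x)` tends to the
identity in `C^∞`, and `Q^{(N)} → 0` in `L²(M × M, TM ⊠ TM)`. -/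
structure ProperScaling [MeasurableSpace M] (g : Metric d M) (Q : ℕ → Kernel d M) : Prop where
  covariance : ∀ N, IsCovarianceKernel g (Q N)
  diagonal : TendstoEndField (fun N x => Q N x x)
    (fun x => ContinuousLinearMap.id ℝ (TangentSpace (𝓡 d) x))
  hilbertSchmidt : Tendsto
    (fun N => ∫⁻ x, ∫⁻ y, ENNReal.ofReal (hsNormSq g x y (Q N x y)) ∂(vol g) ∂(vol g))
    atTop (𝓝 0)

end Geometry

/-! ### Distributions and white noise -/

/-- Distributions on a compact manifold: the continuous linear forms on `C^∞(M)` (this is a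
metrizable space, so continuity is sequential continuity). -/
structure Distrib (d : ℕ) (M : Type*) [TopologicalSpace M] [ChartedSpace (Eu d) M] where
  toLin : TestFun d M →ₗ[ℝ] ℝ
  continuous' : ∀ (φ : ℕ → TestFun d M) (ψ : TestFun d M), TendstoTestFun φ ψ →
    Tendsto (fun n => toLin (φ n)) atTop (𝓝 (toLin ψ))

section WhiteNoise

variable {d : ℕ} {M : Type*} [TopologicalSpace M] [ChartedSpace (Eu d) M]

/-- The σ-algebra generated by the maps `u ↦ (u, φ)`. -/
instance : MeasurableSpace (Distrib d M) :=
  ⨆ φ : TestFun d M, MeasurableSpace.comap (fun u : Distrib d M => u.toLin φ) inferInstance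

open Classical in
/-- The pairing `(u, f)` of a distribution with a function that is known to be smooth (the value `0`
for other functions is never used). -/
def pair (u : Distrib d M) (f : M → ℝ) : ℝ :=
  if h : ContMDiff (𝓡 d) 𝓘(ℝ, ℝ) ∞ f then u.toLin ⟨f, h⟩ else 0

variable [IsManifold (𝓡 d) ∞ M] [MeasurableSpace M]

/-- `μ` is the law of white noise: under `μ` the `(u, φ)`, `φ ∈ C^∞(M)`, form a centered Gaussian
process with `E[(u, φ)²] = ‖φ‖²` in `L²(M)`. -/
structure IsWhiteNoiseLaw (g : Metric d M) (μ : Measure (Distrib d M)) : Prop where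
  gaussian : IsGaussianProcess (fun (φ : TestFun d M) (u : Distrib d M) => u.toLin φ) μ
  centered : ∀ φ : TestFun d M, ∫ u, u.toLin φ ∂μ = 0
  variance : ∀ φ : TestFun d M, ∫ u, (u.toLin φ) ^ 2 ∂μ = ∫ x, (φ x) ^ 2 ∂(vol g)

/-! ### Cylindrical functions and generators -/

/-- A cylindrical function `F(u) = f((u, φ_1), …, (u, φ_n))` of class `FC_b^2`: `f` is `C²`, bounded
together with its derivatives of order at most two, and the `φ_j` are smooth. -/
structure CylFun (d : ℕ) (M : Type*) [TopologicalSpace M] [ChartedSpace (Eu d) M] where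
  n : ℕ
  f : (Fin n → ℝ) → ℝ
  φ : Fin n → TestFun d M
  contDiff : ContDiff ℝ 2 f
  bounded : ∀ m : ℕ, m ≤ 2 → ∃ C : ℝ, ∀ z, ‖iteratedFDeriv ℝ m f z‖ ≤ C

/-- `((u, φ_1), …, (u, φ_n))`. -/
def CylFun.eval (F : CylFun d M) (u : Distrib d M) : Fin F.n → ℝ := fun j => u.toLin (F.φ j)

/-- `F_k(u) = ∂_k f((u, φ_1), …, (u, φ_n))`. -/
def CylFun.d1 (F : CylFun d M) (k : Fin F.n) (u : Distrib d M) : ℝ :=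
  fderiv ℝ F.f (F.eval u) (Pi.single k 1)

/-- `F_{kl}(u) = ∂_k ∂_l f((u, φ_1), …, (u, φ_n))`. -/
def CylFun.d2 (F : CylFun d M) (k l : Fin F.n) (u : Distrib d M) : ℝ :=
  fderiv ℝ (fun z => fderiv ℝ F.f z (Pi.single l 1)) (F.eval u) (Pi.single k 1)

/-- `(u ∇φ, Q (u ∇ψ))`: here `Q (u ∇ψ)` is the smooth field `x ↦ (u, y ↦ Q(x, y) ∇ψ(y))`, so that
this is `(u, x ↦ (u, y ↦ ∇φ(x) · Q(x, y) ∇ψ(y)))`. -/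
def quadPair (g : Metric d M) (Q : Kernel d M) (u : Distrib d M) (φ ψ : M → ℝ) : ℝ :=
  pair u (fun x => pair u (fun y => g.inner x (grad g φ x) (Q x y (grad g ψ y))))

/-- The generator of the stochastic transport equation `du = ∘dW · ∇u` driven by the noise with
covariance kernel `Q`, applied to a cylindrical function. -/
def generator (g : Metric d M) (Q : Kernel d M) (F : CylFun d M) (u : Distrib d M) : ℝ :=
  ∑ k, F.d1 k u * pair u (fun x => (1 / 2 : ℝ) * divGrad g (fun z => Q z z) (F.φ k) x) +
    (1 / 2 : ℝ) * ∑ k, ∑ l, F.d2 k l u * quadPair g Q u (F.φ k) (F.φ l)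

/-- The limit generator. -/
def limitGenerator (g : Metric d M) (F : CylFun d M) (u : Distrib d M) : ℝ :=
  ∑ k, F.d1 k u * pair u (fun x => (1 / 2 : ℝ) * laplacian g (F.φ k) x) +
    (1 / 2 : ℝ) * ∑ k, ∑ l, F.d2 k l u *
      ∫ x, g.inner x (grad g (F.φ k) x) (grad g (F.φ l) x) ∂(vol g)

end WhiteNoise

end

end TransportNoise

namespace TransportNoise

/-! ### Exponential moments of Gaussian quadratic forms -/

section GaussianQuadratic

open Matrix MatrixOrder

/-! The difference of the two generators is a finite sum of bounded functions (derivatives of `f`)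
times two kinds of random variables, so it suffices that each of these tends to zero in every `L^p`,
`p < ∞`.

Linear terms: `(u, ½ (L^N - Δ) φ)` is centered Gaussian, with variance the squared `L²`-norm of the
test function. In charts `(L^N - Δ) φ` is linear in `A^N - I` and its first derivatives, so it tends
to zero uniformly (`tendsto_divGrad_sub`), and the volume is finite (`isFiniteMeasure_vol`).

Quadratic terms: with `k_N(x, y) = ∇φ(x) · Q^N(x, y) ∇ψ(y)`, the variable `(u, x ↦ (u, k_N(x, ·)))`
lies in the chaos of order at most two. It is centered at `∫ k_N(x, x) dx`, which tends to `∫ ∇φ ·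
∇ψ` because `A^N → I`. Its fluctuations have the size of `‖k_N‖` in `L²`, which is at most a
constant times `‖Q^N‖` (`inner_apply_sq_le`) and so tends to zero. All exponents `p` are treated at
once by an exponential moment at the scale of `‖k_N‖`.

This moment is first computed for finite Gaussian quadratic forms
(`lintegral_exp_abs_quadratic_le`), where centre and scale are `tr (A C)` and `tr (A C Aᵀ C)`. The
pairing with a smooth kernel is defined for each single distribution `u`, so it has to be
approximated pathwise. The identity of `C^∞(M)` is an iterated strong limit of operators `f ↦ ∑
f(x_i) a_i` (`seqClosure_id`: partition of unity, mollification, Riemann sums). Applied to `x ↦ (u,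
k(x, ·))`, which is smooth by `SmoothTwo.contMDiff_pair`, such operators give finite quadratic
forms. Continuity of `u` makes them converge for every `u`, and Fatou's lemma carries the moment
bound to the limit (`isQuadraticFunctional_pair`). -/

theorem one_le_one_sub_mul_exp {b : ℝ} (hb : |b| ≤ 1 / 2) :
    1 ≤ (1 - b) * Real.exp (b + b ^ 2) := by
  obtain ⟨h1, h2⟩ := abs_le.1 hb
  have hpos : 0 < 1 - b := by linarith
  rcases le_total b 0 with h | h
  -- The first-order bound suffices here: `(1 - b)(1 + b + b²) = 1 - b³`.
  · have := Real.add_one_le_exp (b + b ^ 2)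
    have h3 : b ^ 3 ≤ 0 := by nlinarith [sq_nonneg b]
    nlinarith
  -- For `b ≥ 0` the second-order term is needed; the excess over `1` is then exactly half the
  -- quantity in `h5`.
  · have := Real.quadratic_le_exp_of_nonneg (x := b + b ^ 2) (by positivity)
    have h4 : (1 - b) * (1 + (b + b ^ 2) + (b + b ^ 2) ^ 2 / 2) ≤ (1 - b) * Real.exp (b + b ^ 2) :=
      mul_le_mul_of_nonneg_left this hpos.le
    have h5 : 0 ≤ b ^ 2 * (1 - b - b ^ 2 - b ^ 3) := by
      refine mul_nonneg (sq_nonneg _) ?_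
      nlinarith [mul_nonneg h h, mul_nonneg (mul_nonneg h h) h, mul_nonneg h (sub_nonneg.2 h2), mul_nonneg (mul_nonneg h h) (sub_nonneg.2 h2)]
    nlinarith

theorem integrable_exp_mul_sq_gaussianReal {a : ℝ} (ha : a < 1 / 2) :
    Integrable (fun x : ℝ => Real.exp (a * (x ^ 2 - 1))) (gaussianReal 0 1) := by
  rw [gaussianReal_of_var_ne_zero _ one_ne_zero,
    integrable_withDensity_iff_integrable_smul' (measurable_gaussianPDF 0 1)
      (ae_of_all _ fun x => by simp [gaussianPDF])]
  have : (fun x : ℝ => (gaussianPDF 0 1 x).toReal • Real.exp (a * (x ^ 2 - 1))) =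
      fun x => ((√(2 * Real.pi))⁻¹ * Real.exp (-a)) * Real.exp (-(1 / 2 - a) * x ^ 2) := by
    ext x
    rw [toReal_gaussianPDF, gaussianPDFReal_def]
    simp only [NNReal.coe_one, mul_one, sub_zero, smul_eq_mul]
    rw [mul_assoc, mul_assoc, ← Real.exp_add, ← Real.exp_add]
    ring_nf
  rw [this]
  exact (integrable_exp_neg_mul_sq (by linarith)).const_mul _

theorem integral_exp_mul_sq_gaussianReal {a : ℝ} (ha : a < 1 / 2) :
    ∫ x : ℝ, Real.exp (a * (x ^ 2 - 1)) ∂(gaussianReal 0 1) =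
      Real.exp (-a) * (√(1 - 2 * a))⁻¹ := by
  rw [integral_gaussianReal_eq_integral_smul one_ne_zero]
  have : (fun x : ℝ => gaussianPDFReal 0 1 x • Real.exp (a * (x ^ 2 - 1))) =
      fun x => ((√(2 * Real.pi))⁻¹ * Real.exp (-a)) * Real.exp (-(1 / 2 - a) * x ^ 2) := by
    ext x
    rw [gaussianPDFReal_def]
    simp only [NNReal.coe_one, mul_one, sub_zero, smul_eq_mul]
    rw [mul_assoc, mul_assoc, ← Real.exp_add, ← Real.exp_add]
    ring_nf
  rw [this, integral_const_mul, integral_gaussian]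
  have h : Real.pi / (1 / 2 - a) = 2 * Real.pi * (1 - 2 * a)⁻¹ := by
    have : 1 - 2 * a ≠ 0 := by linarith
    have : 1 / 2 - a ≠ 0 := by intro h; apply this; linarith
    field_simp
  rw [h, Real.sqrt_mul (by positivity) (1 - 2 * a)⁻¹, Real.sqrt_inv]
  have : √(2 * Real.pi) ≠ 0 := by positivity
  field_simp

/-- The centring `x² - 1` removes the first order in `a`, leaving a bound quadratic in `a`; over the
eigenvalues of a form these exponents add up to its squared Hilbert–Schmidt norm. It is the square
root of `one_le_one_sub_mul_exp` at `b = 2a`. -/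
theorem integral_exp_mul_sq_gaussianReal_le {a : ℝ} (ha : |a| ≤ 1 / 4) :
    ∫ x : ℝ, Real.exp (a * (x ^ 2 - 1)) ∂(gaussianReal 0 1) ≤ Real.exp (2 * a ^ 2) := by
  have ha' := (abs_le.1 ha).2
  rw [integral_exp_mul_sq_gaussianReal (by linarith), ← div_eq_mul_inv,
    div_le_iff₀ (Real.sqrt_pos.2 (by linarith))]
  have h := one_le_one_sub_mul_exp (b := 2 * a) (by rw [abs_mul]; norm_num; linarith)
  have h2 : Real.exp (-a - 2 * a ^ 2) ≤ √(1 - 2 * a) := by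
    apply Real.le_sqrt_of_sq_le
    rw [← Real.exp_nat_mul]
    have : Real.exp (2 * a + (2 * a) ^ 2) * Real.exp ((2 : ℕ) * (-a - 2 * a ^ 2)) = 1 := by
      rw [← Real.exp_add]; push_cast; ring_nf; simp
    nlinarith [Real.exp_pos ((2 : ℕ) * (-a - 2 * a ^ 2))]
  calc Real.exp (-a) = Real.exp (2 * a ^ 2) * Real.exp (-a - 2 * a ^ 2) := by
        rw [← Real.exp_add]; ring_nf
    _ ≤ _ := by gcongr

variable {ι : Type*} [Fintype ι]

theorem lintegral_exp_sum_mul_sq_le {l : ι → ℝ} (hl : ∀ i, |l i| ≤ 1 / 4) :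
    ∫⁻ y : ι → ℝ, ENNReal.ofReal (Real.exp (∑ i, l i * (y i ^ 2 - 1)))
      ∂(Measure.pi fun _ => gaussianReal 0 1) ≤ ENNReal.ofReal (Real.exp (2 * ∑ i, l i ^ 2)) := by
  have hint : ∀ i, Integrable (fun x : ℝ => Real.exp (l i * (x ^ 2 - 1))) (gaussianReal 0 1) :=
    fun i => integrable_exp_mul_sq_gaussianReal (by linarith [(abs_le.1 (hl i)).2])
  have h1 := Integrable.fintype_prod hint
  simp only [Real.exp_sum] 
  rw [← ofReal_integral_eq_lintegral_ofReal h1 (ae_of_all _ fun y => by positivity),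
    integral_fintype_prod_eq_prod (fun i x => Real.exp (l i * (x ^ 2 - 1))), Finset.mul_sum,
    Real.exp_sum]
  refine ENNReal.ofReal_le_ofReal (Finset.prod_le_prod (fun i _ => by positivity) fun i _ => ?_)
  exact integral_exp_mul_sq_gaussianReal_le (hl i)

variable [DecidableEq ι]

theorem trace_sq_eq_sum_eigenvalues {S : Matrix ι ι ℝ} (hS : S.IsHermitian) :
    (S * S).trace = ∑ k, hS.eigenvalues k ^ 2 := by
  conv_lhs => rw [hS.spectral_theorem, ← map_mul, Unitary.conjStarAlgAut_apply, trace_mul_comm,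
    ← mul_assoc]
  simp [Matrix.diagonal_mul_diagonal, sq]

/-- By rotation invariance the coordinates in an eigenbasis of `S` are again independent standard
Gaussians, so the integral factorizes. The bound on `tr S²` forces every eigenvalue into `[-1/4,
1/4]`. -/
theorem lintegral_exp_quadratic_stdGaussian_le {S : Matrix ι ι ℝ} (hS : S.IsHermitian)
    (h : (S * S).trace ≤ 1 / 16) :
    ∫⁻ x : EuclideanSpace ℝ ι, ENNReal.ofReal (Real.exp (x.ofLp ⬝ᵥ S *ᵥ x.ofLp - S.trace))
      ∂(stdGaussian (EuclideanSpace ℝ ι)) ≤ ENNReal.ofReal (Real.exp (2 * (S * S).trace)) := by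
  rw [stdGaussian_eq_map_pi_orthonormalBasis hS.eigenvectorBasis,
    lintegral_map (by fun_prop) (by fun_prop)]
  have hq : ∀ y : ι → ℝ, (∑ i, y i • hS.eigenvectorBasis i).ofLp ⬝ᵥ
      S *ᵥ (∑ i, y i • hS.eigenvectorBasis i).ofLp - S.trace =
        ∑ i, hS.eigenvalues i * (y i ^ 2 - 1) := by
    intro y
    have e1 : S *ᵥ (∑ i, y i • hS.eigenvectorBasis i).ofLp =
        (∑ i, (y i * hS.eigenvalues i) • hS.eigenvectorBasis i).ofLp := by
      simp only [WithLp.ofLp_sum, WithLp.ofLp_smul, Matrix.mulVec_sum, Matrix.mulVec_smul,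
        hS.mulVec_eigenvectorBasis, smul_smul]
    have e2 : ∀ v w : EuclideanSpace ℝ ι, v.ofLp ⬝ᵥ w.ofLp = inner ℝ v w := by
      intro v w
      simp [PiLp.inner_apply, dotProduct, mul_comm]
    rw [e1, e2, hS.eigenvectorBasis.orthonormal.inner_sum, hS.trace_eq_sum_eigenvalues,
      ← Finset.sum_sub_distrib]
    refine Finset.sum_congr rfl fun i _ => ?_
    simp
    ring
  simp_rw [hq, trace_sq_eq_sum_eigenvalues hS]
  refine lintegral_exp_sum_mul_sq_le fun i => ?_
  rw [trace_sq_eq_sum_eigenvalues hS] at h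
  have := (Finset.single_le_sum (f := fun k => hS.eigenvalues k ^ 2) (fun k _ => sq_nonneg _)
    (Finset.mem_univ i)).trans h
  apply abs_le_of_sq_le_sq _ (by norm_num)
  linarith

/-- Writing the vector as `√C z` with `z` standard turns the form into `z · (√C A √C) z`, of which
only the symmetric part `S` counts. The exponent `1/8` is twice the bound `1/16`. -/
theorem lintegral_exp_quadratic_multivariateGaussian_le {C : Matrix ι ι ℝ} (hC : C.PosSemidef)
    (A : Matrix ι ι ℝ) (h : (A * C * Aᵀ * C).trace ≤ 1 / 16) :
    ∫⁻ x : EuclideanSpace ℝ ι,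
        ENNReal.ofReal (Real.exp (x.ofLp ⬝ᵥ A *ᵥ x.ofLp - (A * C).trace))
      ∂(multivariateGaussian 0 C) ≤ ENNReal.ofReal (Real.exp (1 / 8)) := by
  set R := CFC.sqrt C with hR
  have hRR : R * R = C := CFC.sqrt_mul_sqrt_self _ hC.nonneg
  have hRh : Rᵀ = R := by
    have := (CFC.sqrt_nonneg C).isSelfAdjoint
    exact this
  set T := R * A * R with hT
  set S := (1 / 2 : ℝ) • (T + Tᵀ) with hSdef
  have hTt : Tᵀ = R * Aᵀ * R := by simp [hT, Matrix.transpose_mul, hRh, mul_assoc]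
  have hS : S.IsHermitian := by
    change Sᵀ = S
    simp [hSdef, add_comm]
  have hTT : (T * Tᵀ).trace = (A * C * Aᵀ * C).trace := by
    rw [hTt, hT, ← hRR, show R * A * R * (R * Aᵀ * R) = R * (A * R * (R * Aᵀ * R)) by
      simp only [mul_assoc], Matrix.trace_mul_comm]
    simp only [mul_assoc]
  -- Symmetrization does not increase the Hilbert–Schmidt norm, as `‖T - Tᵀ‖² ≥ 0` shows.
  have hSS : (S * S).trace ≤ (T * Tᵀ).trace := by
    have h0 : 0 ≤ ((T - Tᵀ) * (T - Tᵀ)ᵀ).trace := by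
      simpa using (Matrix.posSemidef_self_mul_conjTranspose (T - Tᵀ)).trace_nonneg
    have h1 : (Tᵀ * T).trace = (T * Tᵀ).trace := Matrix.trace_mul_comm _ _
    have h2 : (Tᵀ * Tᵀ).trace = (T * T).trace := by
      rw [← Matrix.transpose_mul, Matrix.trace_transpose]
    simp only [Matrix.transpose_sub, Matrix.transpose_transpose, Matrix.sub_mul, Matrix.mul_sub,
      Matrix.trace_sub] at h0
    simp only [hSdef, Matrix.smul_mul, Matrix.mul_smul, Matrix.trace_smul, Matrix.add_mul,
      Matrix.mul_add, Matrix.trace_add, smul_eq_mul]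
    linarith
  have htr : S.trace = (A * C).trace := by
    have h1 : T.trace = (A * C).trace := by
      rw [hT, mul_assoc, Matrix.trace_mul_comm, mul_assoc, hRR]
    simp only [hSdef, Matrix.trace_smul, Matrix.trace_add, Matrix.trace_transpose, h1, smul_eq_mul]
    ring
  have hquad : ∀ x : EuclideanSpace ℝ ι, (Matrix.toEuclideanCLM (𝕜 := ℝ) R x).ofLp ⬝ᵥ
      A *ᵥ (Matrix.toEuclideanCLM (𝕜 := ℝ) R x).ofLp = x.ofLp ⬝ᵥ S *ᵥ x.ofLp := by
    intro x
    have e0 : (Matrix.toEuclideanCLM (𝕜 := ℝ) R x).ofLp = R *ᵥ x.ofLp := rfl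
    have e1 : (R *ᵥ x.ofLp) ⬝ᵥ A *ᵥ (R *ᵥ x.ofLp) = x.ofLp ⬝ᵥ T *ᵥ x.ofLp := by
      rw [dotProduct_comm, Matrix.dotProduct_mulVec, ← Matrix.mulVec_transpose, hRh,
        dotProduct_comm, Matrix.mulVec_mulVec, Matrix.mulVec_mulVec]
    have e2 : x.ofLp ⬝ᵥ Tᵀ *ᵥ x.ofLp = x.ofLp ⬝ᵥ T *ᵥ x.ofLp := by
      rw [Matrix.mulVec_transpose, dotProduct_comm, ← Matrix.dotProduct_mulVec]
    rw [e0, e1, hSdef, Matrix.smul_mulVec, dotProduct_smul, Matrix.add_mulVec, dotProduct_add, e2,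
      smul_eq_mul]
    ring
  rw [multivariateGaussian, lintegral_map (by fun_prop) (by fun_prop)]
  simp only [zero_add, ← hR, hquad, ← htr]
  refine (lintegral_exp_quadratic_stdGaussian_le hS (by linarith)).trans ?_
  exact ENNReal.ofReal_le_ofReal (Real.exp_le_exp.2 (by linarith))

/-- Cramér–Wold: the characteristic function at `t` is that of the scalar variable `t · ξ` at `1`.
-/
theorem map_eq_multivariateGaussian {Ω : Type*} [MeasurableSpace Ω] {μ : Measure Ω}
    [IsProbabilityMeasure μ] {ξ : ι → Ω → ℝ} (hξ : ∀ i, Measurable (ξ i)) {C : Matrix ι ι ℝ}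
    (hC : C.PosSemidef)
    (h : ∀ t : ι → ℝ, μ.map (fun o => ∑ i, t i * ξ i o) = gaussianReal 0 (t ⬝ᵥ C *ᵥ t).toNNReal) :
    μ.map (fun o => WithLp.toLp 2 fun i => ξ i o) = multivariateGaussian 0 C := by
  have hm : Measurable (fun o => WithLp.toLp 2 fun i => ξ i o) := by fun_prop
  have := Measure.isProbabilityMeasure_map (μ := μ) hm.aemeasurable
  apply Measure.ext_of_charFun
  ext t
  rw [charFun_multivariateGaussian hC, charFun_apply, integral_map hm.aemeasurable (by fun_prop)]
  have h1 := congrArg (fun ν => charFun ν 1) (h t.ofLp)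
  simp only [charFun_gaussianReal] at h1
  rw [charFun_apply_real, integral_map (by fun_prop) (by fun_prop)] at h1
  have hnn : 0 ≤ t.ofLp ⬝ᵥ C *ᵥ t.ofLp := by simpa using hC.dotProduct_mulVec_nonneg t.ofLp
  convert h1 using 2
  · ext o
    congr 2
    simp [PiLp.inner_apply]
  · simp [Real.coe_toNNReal _ hnn]

theorem lintegral_exp_abs_quadratic_le {Ω : Type*} [MeasurableSpace Ω] {μ : Measure Ω}
    [IsProbabilityMeasure μ] {ξ : ι → Ω → ℝ} (hξ : ∀ i, Measurable (ξ i)) {C : Matrix ι ι ℝ}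
    (hC : C.PosSemidef)
    (h : ∀ t : ι → ℝ, μ.map (fun o => ∑ i, t i * ξ i o) = gaussianReal 0 (t ⬝ᵥ C *ᵥ t).toNNReal)
    (A : Matrix ι ι ℝ) {s : ℝ} (hs : 0 < s) (hA : (A * C * Aᵀ * C).trace ≤ s ^ 2) :
    ∫⁻ o, ENNReal.ofReal (Real.exp (|∑ i, ∑ j, A i j * (ξ i o * ξ j o) - (A * C).trace| / (4 * s)))
      ∂μ ≤ ENNReal.ofReal (2 * Real.exp (1 / 8)) := by
  have hm : Measurable (fun o => WithLp.toLp 2 fun i => ξ i o) := by fun_prop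
  -- Scaling `A` by `r = ± 1 / (4 s)` brings the squared norm, at most `s²`, down to `1/16`. The two
  -- signs together control the absolute value through `e^|x| ≤ e^x + e^(-x)`.
  have key : ∀ r : ℝ, r ^ 2 = (1 / (4 * s)) ^ 2 →
      ∫⁻ o, ENNReal.ofReal (Real.exp (r * (∑ i, ∑ j, A i j * (ξ i o * ξ j o) - (A * C).trace))) ∂μ
        ≤ ENNReal.ofReal (Real.exp (1 / 8)) := by
    intro r hr
    have h1 := lintegral_exp_quadratic_multivariateGaussian_le hC (r • A) (by
      simp only [Matrix.smul_mul, Matrix.transpose_smul, Matrix.mul_smul, Matrix.trace_smul,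
        smul_eq_mul, ← mul_assoc]
      rw [← sq, hr, div_pow, one_pow, mul_pow, one_div_mul_eq_div, div_le_iff₀ (by positivity)]
      linarith)
    rw [← map_eq_multivariateGaussian hξ hC h, lintegral_map (by fun_prop) hm] at h1
    refine le_of_eq_of_le ?_ h1
    refine lintegral_congr fun o => ?_
    congr 2
    simp only [Matrix.smul_mulVec, dotProduct_smul, Matrix.smul_mul, Matrix.trace_smul, smul_eq_mul,
      ← mul_sub]
    congr 2
    simp only [dotProduct, Matrix.mulVec, Finset.mul_sum]
    exact Finset.sum_congr rfl fun i _ => Finset.sum_congr rfl fun j _ => by ring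
  have hsum : (2 * Real.exp (1 / 8)) = Real.exp (1 / 8) + Real.exp (1 / 8) := by ring
  rw [hsum, ENNReal.ofReal_add (by positivity) (by positivity)]
  refine le_trans ?_ (add_le_add (key (1 / (4 * s)) rfl) (key (-(1 / (4 * s))) (by ring)))
  rw [← lintegral_add_left (by fun_prop)]
  refine lintegral_mono fun o => ?_
  rw [← ENNReal.ofReal_add (by positivity) (by positivity)]
  refine ENNReal.ofReal_le_ofReal ?_
  set x := ∑ i, ∑ j, A i j * (ξ i o * ξ j o) - (A * C).trace
  rcases abs_cases x with ⟨hx, -⟩ | ⟨hx, -⟩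
  · rw [hx, div_eq_inv_mul, one_div]
    exact le_add_of_nonneg_right (Real.exp_pos _).le
  · rw [hx, neg_div, div_eq_inv_mul, one_div, ← neg_mul]
    exact le_add_of_nonneg_left (Real.exp_pos _).le

end GaussianQuadratic

/-! ### From exponential moments to `L^p` norms -/

theorem rpow_le_const_mul_exp {p : ℝ} (hp : 0 < p) :
    ∃ C : ℝ, 0 < C ∧ ∀ x : ℝ, 0 ≤ x → x ^ p ≤ C * Real.exp x := by
  obtain ⟨n, hn⟩ := exists_nat_ge p
  -- The factorial comes from `x^n / n! ≤ e^x`, used for `x ≥ 1`; the summand `1` leaves room for `x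
  -- ≤ 1`.
  refine ⟨(n.factorial : ℝ) + 1, by positivity, fun x hx => ?_⟩
  have h1 := Real.pow_div_factorial_le_exp x hx n
  have h2 : x ^ n ≤ n.factorial * Real.exp x := by
    rw [div_le_iff₀ (by positivity)] at h1; linarith
  have h3 : 1 ≤ Real.exp x := Real.one_le_exp hx
  rcases le_total x 1 with h | h
  · have : x ^ p ≤ 1 := Real.rpow_le_one hx h hp.le
    nlinarith [Real.exp_pos x, (Nat.cast_nonneg n.factorial : (0 : ℝ) ≤ _)]
  · have : x ^ p ≤ x ^ (n : ℝ) := Real.rpow_le_rpow_of_exponent_le h hn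
    rw [Real.rpow_natCast] at this
    nlinarith

/-- Exponential integrability at scale `s` bounds every `L^p` norm by a multiple of `s`. -/
theorem eLpNorm_le_of_lintegral_exp {p : ℝ≥0∞} (hp : 1 ≤ p) (hp' : p ≠ ⊤) (B : ℝ≥0∞) (hB : B ≠ ⊤) :
    ∃ D : ℝ≥0∞, D ≠ ⊤ ∧ ∀ {Ω : Type*} [MeasurableSpace Ω] (μ : Measure Ω) (X : Ω → ℝ) (s : ℝ),
      0 < s → ∫⁻ o, ENNReal.ofReal (Real.exp (|X o| / s)) ∂μ ≤ B →
        eLpNorm X p μ ≤ D * ENNReal.ofReal s := by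
  have hp0 : p ≠ 0 := (zero_lt_one.trans_le hp).ne'
  have hpr : 0 < p.toReal := ENNReal.toReal_pos hp0 hp'
  obtain ⟨C, hC, hCx⟩ := rpow_le_const_mul_exp hpr
  refine ⟨(ENNReal.ofReal C * B) ^ (1 / p.toReal), ?_, ?_⟩
  · exact ENNReal.rpow_ne_top_of_nonneg (by positivity) (ENNReal.mul_ne_top (by simp) hB)
  intro Ω _ μ X s hs h
  rw [eLpNorm_eq_lintegral_rpow_enorm_toReal hp0 hp']
  have hbound : ∫⁻ o, ‖X o‖ₑ ^ p.toReal ∂μ ≤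
      ENNReal.ofReal s ^ p.toReal * (ENNReal.ofReal C * B) := by
    calc ∫⁻ o, ‖X o‖ₑ ^ p.toReal ∂μ
        ≤ ∫⁻ o, ENNReal.ofReal s ^ p.toReal *
            (ENNReal.ofReal C * ENNReal.ofReal (Real.exp (|X o| / s))) ∂μ := by
          refine lintegral_mono fun o => ?_
          rw [Real.enorm_eq_ofReal_abs, ENNReal.ofReal_rpow_of_nonneg (abs_nonneg _) hpr.le,
            ENNReal.ofReal_rpow_of_pos hs, ← ENNReal.ofReal_mul hC.le,
            ← ENNReal.ofReal_mul (by positivity)]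
          refine ENNReal.ofReal_le_ofReal ?_
          have h1 := hCx (|X o| / s) (by positivity)
          rw [Real.div_rpow (abs_nonneg _) hs.le, div_le_iff₀ (by positivity)] at h1
          linarith
      _ = ENNReal.ofReal s ^ p.toReal * (ENNReal.ofReal C *
            ∫⁻ o, ENNReal.ofReal (Real.exp (|X o| / s)) ∂μ) := by
          rw [lintegral_const_mul' _ _ (by finiteness), lintegral_const_mul' _ _ (by simp)]
      _ ≤ _ := by gcongr
  refine (ENNReal.rpow_le_rpow hbound (by positivity)).trans_eq ?_
  rw [ENNReal.mul_rpow_of_nonneg _ _ (by positivity), ← ENNReal.rpow_mul, mul_one_div_cancel hpr.ne',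
    ENNReal.rpow_one, mul_comm]


/-! ### Partial iterated derivatives -/

section PartialDeriv

set_option linter.unusedSectionVars false

variable {P E F : Type*} [NormedAddCommGroup P] [NormedSpace ℝ P] [NormedAddCommGroup E]
  [NormedSpace ℝ E] [NormedAddCommGroup F] [NormedSpace ℝ F]

/-- The `k`-th derivative of `f (p, y)` with respect to `y`. -/
noncomputable def partialIter (f : P × E → F) (k : ℕ) (z : P × E) : E [×k]→L[ℝ] F :=
  iteratedFDeriv ℝ k (fun y => f (z.1, y)) z.2

theorem partialIter_succ (f : P × E → F) (k : ℕ) (z : P × E) :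
    partialIter f (k + 1) z =
      (continuousMultilinearCurryLeftEquiv ℝ (fun _ : Fin (k + 1) => E) F).symm
        (fderiv ℝ (fun y => partialIter f k (z.1, y)) z.2) := rfl

theorem contDiffOn_partialIter {f : P × E → F} {W : Set (P × E)} (hW : IsOpen W)
    (hf : ContDiffOn ℝ ∞ f W) (k : ℕ) : ContDiffOn ℝ ∞ (partialIter f k) W := by
  induction k with
  | zero =>
    have : partialIter f 0 = fun z => (continuousMultilinearCurryFin0 ℝ E F).symm (f z) := by
      ext z; simp [partialIter]
    rw [this]
    exact (continuousMultilinearCurryFin0 ℝ E F).symm.contDiff.comp_contDiffOn hf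
  | succ k ih =>
    intro z hz
    have h1 : ContDiffAt ℝ ∞ (partialIter f k) z := ih.contDiffAt (hW.mem_nhds hz)
    have h2 : ContDiffAt ℝ ∞ (Function.uncurry fun (z : P × E) (y : E) => partialIter f k (z.1, y))
        (z, z.2) := by
      have : (Function.uncurry fun (z : P × E) (y : E) => partialIter f k (z.1, y)) =
        partialIter f k ∘ fun q : (P × E) × E => (q.1.1, q.2) := rfl
      rw [this]
      exact ContDiffAt.comp _ h1 (by fun_prop)
    have h3 := ContDiffAt.fderiv (m := ∞) h2 contDiffAt_snd (by simp)
    exact ((continuousMultilinearCurryLeftEquiv ℝ (fun _ : Fin (k + 1) => E) F).symm.contDiff.contDiffAt.comp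
      z h3).contDiffWithinAt

theorem two_le_smooth : minSmoothness ℝ 2 ≤ (∞ : ℕ∞ω) := by
  rw [minSmoothness_of_isRCLikeNormedField]
  exact ENat.LEInfty.out

/-- Schwarz's theorem, applied once for each derivative in `y`. It lets Taylor remainders in the
parameter be estimated together with all their `y`-derivatives. -/
theorem partialIter_fderiv {f : P × E → F} {W : Set (P × E)} (hW : IsOpen W)
    (hf : ContDiffOn ℝ ∞ f W) (v : P) (k : ℕ) :
    ∀ z ∈ W, partialIter (fun z => fderiv ℝ f z (v, 0)) k z =
      fderiv ℝ (partialIter f k) z (v, 0) := by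
  induction k with
  | zero =>
    intro z hz
    have : partialIter f 0 = fun z => (continuousMultilinearCurryFin0 ℝ E F).symm (f z) := by
      ext z; simp [partialIter]
    rw [this]
    have h := ((continuousMultilinearCurryFin0 ℝ E F).symm.toContinuousLinearEquiv
      |>.hasFDerivAt (x := f z)).comp z
      ((hf.contDiffAt (hW.mem_nhds hz)).differentiableAt (by simp)).hasFDerivAt
    have h' := h.fderiv
    change fderiv ℝ (fun z => (continuousMultilinearCurryFin0 ℝ E F).symm (f z)) z = _ at h'
    rw [h']
    ext
    simp [partialIter]
  | succ k ih =>
    intro z hz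
    set Φ := partialIter f k with hΦ
    have hΦs : ContDiffOn ℝ ∞ Φ W := contDiffOn_partialIter hW hf k
    have hΦz : ContDiffAt ℝ ∞ Φ z := hΦs.contDiffAt (hW.mem_nhds hz)
    have hdΦ : DifferentiableAt ℝ (fderiv ℝ Φ) z :=
      (hΦz.fderiv_right (m := ∞) (by simp)).differentiableAt (by simp)
    have hmk : ∀ y : E, HasFDerivAt (fun y : E => (z.1, y)) (ContinuousLinearMap.inr ℝ P E) y :=
      fun y => hasFDerivAt_prodMk_right z.1 y
    set c := (continuousMultilinearCurryLeftEquiv ℝ (fun _ : Fin (k + 1) => E) F).symm with hc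
    have hslice : ∀ z' ∈ W, fderiv ℝ (fun y => Φ (z'.1, y)) z'.2 =
        (fderiv ℝ Φ z').comp (ContinuousLinearMap.inr ℝ P E) := by
      intro z' hz'
      exact (HasFDerivAt.comp z'.2 (g := Φ) (f := fun y : E => (z'.1, y)) (((hΦs.contDiffAt (hW.mem_nhds hz')).differentiableAt
        (by simp)).hasFDerivAt) (hasFDerivAt_prodMk_right z'.1 z'.2)).fderiv
    -- left-hand side
    have hL : fderiv ℝ (fun y => partialIter (fun z => fderiv ℝ f z (v, 0)) k (z.1, y)) z.2 =
        ((fderiv ℝ (fderiv ℝ Φ) z).comp (ContinuousLinearMap.inr ℝ P E)).flip (v, 0) := by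
      have hev : (fun y => partialIter (fun z => fderiv ℝ f z (v, 0)) k (z.1, y)) =ᶠ[𝓝 z.2]
          fun y => fderiv ℝ Φ (z.1, y) (v, 0) := by
        have : ∀ᶠ y in 𝓝 z.2, (z.1, y) ∈ W :=
          (Continuous.prodMk_right z.1).continuousAt.eventually (hW.mem_nhds hz)
        exact this.mono fun y hy => ih (z.1, y) hy
      rw [hev.fderiv_eq]
      have h1 := HasFDerivAt.comp z.2 (g := fderiv ℝ Φ) (f := fun y : E => (z.1, y))
        hdΦ.hasFDerivAt (hmk z.2)
      have h2 := (h1.clm_apply (hasFDerivAt_const (v, (0 : E)) z.2)).fderiv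
      refine h2.trans ?_
      ext w
      simp
    have hR : fderiv ℝ (partialIter f (k + 1)) z (v, 0) =
        c ((fderiv ℝ (fderiv ℝ Φ) z (v, 0)).comp (ContinuousLinearMap.inr ℝ P E)) := by
      have hev : partialIter f (k + 1) =ᶠ[𝓝 z]
          fun z' => c ((fderiv ℝ Φ z').comp (ContinuousLinearMap.inr ℝ P E)) := by
        filter_upwards [hW.mem_nhds hz] with z' hz'
        rw [partialIter_succ, ← hslice z' hz']
      rw [hev.fderiv_eq]
      have h1 := (c.toContinuousLinearEquiv.hasFDerivAt
        (x := (fderiv ℝ Φ z).comp (ContinuousLinearMap.inr ℝ P E))).comp z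
        (hdΦ.hasFDerivAt.clm_comp (hasFDerivAt_const (ContinuousLinearMap.inr ℝ P E) z))
      have h2 := h1.fderiv
      change fderiv ℝ (fun z' => c ((fderiv ℝ Φ z').comp (ContinuousLinearMap.inr ℝ P E))) z = _
        at h2
      rw [h2]
      simp
    rw [partialIter_succ, hL, hR]
    congr 1
    ext w : 1
    have hsym : IsSymmSndFDerivAt ℝ Φ z := hΦz.isSymmSndFDerivAt two_le_smooth
    simpa using (hsym (v, 0) (0, w)).symm

/-- Joint continuity gives local uniformity near each point of `K`, and compactness makes it
uniform. -/
theorem tendstoUniformlyOn_of_continuousOn_prod {P E F : Type*} [TopologicalSpace P]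
    [TopologicalSpace E] [UniformSpace F] {f : P × E → F} {U : Set P} {T K : Set E}
    (hU : IsOpen U) (hT : IsOpen T) (hf : ContinuousOn f (U ×ˢ T)) (hK : IsCompact K)
    (hKT : K ⊆ T) {p : P} (hp : p ∈ U) :
    TendstoUniformlyOn (fun q y => f (q, y)) (fun y => f (p, y)) (𝓝 p) K := by
  rw [← tendstoLocallyUniformlyOn_iff_tendstoUniformlyOn_of_compact hK,
    tendstoLocallyUniformlyOn_iff_forall_tendsto]
  intro y hy
  have hc : ContinuousAt f (p, y) := hf.continuousAt ((hU.prod hT).mem_nhds ⟨hp, hKT hy⟩)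
  have hle : 𝓝 p ×ˢ 𝓝[K] y ≤ 𝓝 (p, y) := by
    rw [nhds_prod_eq]; exact prod_mono le_rfl nhdsWithin_le_nhds
  have h1 : Tendsto (fun q : P × E => f (q.1, q.2)) (𝓝 p ×ˢ 𝓝[K] y) (𝓝 (f (p, y))) :=
    hc.tendsto.mono_left hle
  have h2 : Tendsto (fun q : P × E => f (p, q.2)) (𝓝 p ×ˢ 𝓝[K] y) (𝓝 (f (p, y))) := by
    refine Tendsto.comp (g := f) hc.tendsto ?_
    have : Continuous fun q : P × E => (p, q.2) := by fun_prop
    exact (this.tendsto (p, y)).mono_left hle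
  exact (Filter.Tendsto.prodMk_nhds h2 h1).mono_right (nhds_le_uniformity _)

theorem eventually_norm_sub_lt_of_continuousOn_prod {P E F : Type*} [TopologicalSpace P]
    [TopologicalSpace E] [SeminormedAddCommGroup F] {f : P × E → F} {U : Set P} {T K : Set E}
    (hU : IsOpen U) (hT : IsOpen T) (hf : ContinuousOn f (U ×ˢ T)) (hK : IsCompact K)
    (hKT : K ⊆ T) {p : P} (hp : p ∈ U) {ε : ℝ} (hε : 0 < ε) :
    ∀ᶠ q in 𝓝 p, ∀ y ∈ K, ‖f (q, y) - f (p, y)‖ < ε := by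
  filter_upwards [Metric.tendstoUniformlyOn_iff.1
    (tendstoUniformlyOn_of_continuousOn_prod hU hT hf hK hKT hp) ε hε] with q hq y hy
  rw [← dist_eq_norm, dist_comm]
  exact hq y hy

end PartialDeriv


/-! ### Smooth families of functions and their images under distributions -/

section SmoothFamily

set_option linter.unusedSectionVars false

variable {d : ℕ} {M : Type*} [TopologicalSpace M] [ChartedSpace (Eu d) M]

/-- `C^∞(M)`-convergence of unbundled functions. -/
def TendstoSmooth (f : ℕ → M → ℝ) (g : M → ℝ) : Prop :=
  ∀ e ∈ atlas (Eu d) M, TendstoSmoothOn (fun n y => f n (e.symm y)) (fun y => g (e.symm y)) e.target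

theorem TendstoSmooth.congr' {f f' : ℕ → M → ℝ} {g : M → ℝ} (h : TendstoSmooth (d := d) f g)
    (hf : ∀ᶠ n in atTop, f n = f' n) : TendstoSmooth (d := d) f' g := by
  intro e he K hK hKt k
  refine (h e he K hK hKt k).congr ?_
  filter_upwards [hf] with n hn y _
  simp only [hn]

theorem TendstoSmooth.tendsto_apply {f : ℕ → M → ℝ} {g : M → ℝ} (h : TendstoSmooth (d := d) f g)
    (x : M) : Tendsto (fun n => f n x) atTop (𝓝 (g x)) := by
  have h1 := h (chartAt (Eu d) x) (chart_mem_atlas _ x) {chartAt (Eu d) x x} isCompact_singleton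
    (by simp) 0
  have h2 := h1.tendsto_at (Set.mem_singleton _)
  have h3 := ((ContinuousMultilinearMap.apply ℝ (fun _ : Fin 0 => Eu d) ℝ
    (fun i => i.elim0)).continuous.tendsto _).comp h2
  simpa [Function.comp_def] using h3

theorem contMDiff_iff_contDiffOn_charts [IsManifold (𝓡 d) ∞ M] {f : M → ℝ} :
    ContMDiff (𝓡 d) 𝓘(ℝ, ℝ) ∞ f ↔
      ∀ e ∈ atlas (Eu d) M, ContDiffOn ℝ ∞ (fun y => f (e.symm y)) e.target := by
  constructor
  · intro hf e he
    rw [← contMDiffOn_iff_contDiffOn]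
    exact hf.comp_contMDiffOn (contMDiffOn_symm_of_mem_maximalAtlas
      (IsManifold.subset_maximalAtlas he))
  · intro h x
    have hx := mem_chart_source (Eu d) x
    have he := chart_mem_atlas (Eu d) x
    have h1 : ContMDiffOn (𝓡 d) 𝓘(ℝ, ℝ) ∞
        ((fun y => f ((chartAt (Eu d) x).symm y)) ∘ chartAt (Eu d) x) (chartAt (Eu d) x).source :=
      (contMDiffOn_iff_contDiffOn.2 (h _ he)).comp
        (contMDiffOn_of_mem_maximalAtlas (IsManifold.subset_maximalAtlas he))
        (fun y hy => (chartAt (Eu d) x).map_source hy)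
    have h2 : ContMDiffOn (𝓡 d) 𝓘(ℝ, ℝ) ∞ f (chartAt (Eu d) x).source := by
      refine h1.congr fun y hy => ?_
      simp [(chartAt (Eu d) x).left_inv hy]
    exact h2.contMDiffAt ((chartAt (Eu d) x).open_source.mem_nhds hx)

variable {P : Type*} [NormedAddCommGroup P] [NormedSpace ℝ P]

/-- Functions on `M` that depend smoothly on a parameter in `U`. -/
def SmoothFamily (U : Set P) (H : P → M → ℝ) : Prop :=
  ∀ e ∈ atlas (Eu d) M,
    ContDiffOn ℝ ∞ (fun z : P × Eu d => H z.1 (e.symm z.2)) (U ×ˢ e.target)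

theorem SmoothFamily.contMDiff [IsManifold (𝓡 d) ∞ M] {U : Set P} {H : P → M → ℝ}
    (hH : SmoothFamily (d := d) U H) {p : P} (hp : p ∈ U) : ContMDiff (𝓡 d) 𝓘(ℝ, ℝ) ∞ (H p) := by
  rw [contMDiff_iff_contDiffOn_charts]
  intro e he
  exact (hH e he).comp (f := fun y : Eu d => (p, y)) (by fun_prop) fun y hy => ⟨hp, hy⟩

theorem SmoothFamily.tendstoSmooth {U : Set P} {H : P → M → ℝ} (hU : IsOpen U)
    (hH : SmoothFamily (d := d) U H) {p : P} (hp : p ∈ U) {q : ℕ → P}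
    (hq : Tendsto q atTop (𝓝 p)) : TendstoSmooth (d := d) (fun n => H (q n)) (H p) := by
  intro e he K hK hKt k
  have h1 := tendstoUniformlyOn_of_continuousOn_prod hU e.open_target
    (contDiffOn_partialIter (hU.prod e.open_target) (hH e he) k).continuousOn hK hKt hp
  exact fun v hv => hq.eventually (h1 v hv)

/-- The derivative of a family in the direction `v`. -/
noncomputable def paramDeriv (H : P → M → ℝ) (v : P) (p : P) (x : M) : ℝ :=
  fderiv ℝ (fun q => H q x) p v

theorem SmoothFamily.paramDeriv_chart {U : Set P} {H : P → M → ℝ} (hU : IsOpen U)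
    (hH : SmoothFamily (d := d) U H) {e : OpenPartialHomeomorph M (Eu d)}
    (he : e ∈ atlas (Eu d) M) (v : P) {z : P × Eu d} (hz : z ∈ U ×ˢ e.target) :
    paramDeriv H v z.1 (e.symm z.2) =
      fderiv ℝ (fun z : P × Eu d => H z.1 (e.symm z.2)) z (v, 0) := by
  have h1 := ((hH e he).contDiffAt ((hU.prod e.open_target).mem_nhds hz)).differentiableAt
    (by simp)
  have h2 := HasFDerivAt.comp z.1 (g := fun z : P × Eu d => H z.1 (e.symm z.2))
    (f := fun q : P => (q, z.2)) h1.hasFDerivAt (hasFDerivAt_prodMk_left z.1 z.2)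
  unfold paramDeriv
  have h3 : fderiv ℝ (fun q => H q (e.symm z.2)) z.1 = _ := h2.fderiv
  rw [h3]
  simp

theorem SmoothFamily.paramDeriv {U : Set P} {H : P → M → ℝ} (hU : IsOpen U)
    (hH : SmoothFamily (d := d) U H) (v : P) : SmoothFamily (d := d) U (paramDeriv H v) := by
  intro e he
  have hW := hU.prod e.open_target
  have h1 : ContDiffOn ℝ ∞
      (fun z => fderiv ℝ (fun z : P × Eu d => H z.1 (e.symm z.2)) z (v, 0)) (U ×ˢ e.target) :=
    ((hH e he).fderiv_of_isOpen hW (m := ∞) (by simp)).clm_apply contDiffOn_const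
  exact h1.congr fun z hz => hH.paramDeriv_chart hU he v hz

/-! ### Pairing with smooth functions -/

/-- A smooth function as a test function. -/
def toTestFun (f : M → ℝ) (hf : ContMDiff (𝓡 d) 𝓘(ℝ, ℝ) ∞ f) : TestFun d M := ⟨f, hf⟩

@[simp]
theorem coe_toTestFun (f : M → ℝ) (hf : ContMDiff (𝓡 d) 𝓘(ℝ, ℝ) ∞ f) :
    ⇑(toTestFun f hf) = f := rfl

theorem pair_of_contMDiff (u : Distrib d M) {f : M → ℝ} (hf : ContMDiff (𝓡 d) 𝓘(ℝ, ℝ) ∞ f) :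
    pair u f = u.toLin (toTestFun f hf) := by
  rw [pair, dif_pos hf]
  rfl

theorem pair_coe (u : Distrib d M) (φ : TestFun d M) : pair u φ = u.toLin φ :=
  pair_of_contMDiff u φ.contMDiff

theorem pair_add (u : Distrib d M) {f g : M → ℝ} (hf : ContMDiff (𝓡 d) 𝓘(ℝ, ℝ) ∞ f)
    (hg : ContMDiff (𝓡 d) 𝓘(ℝ, ℝ) ∞ g) :
    pair u (fun x => f x + g x) = pair u f + pair u g := by
  rw [pair_of_contMDiff u hf, pair_of_contMDiff u hg, ← map_add, ← pair_coe]
  rfl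

theorem pair_const_mul (u : Distrib d M) (c : ℝ) {f : M → ℝ}
    (hf : ContMDiff (𝓡 d) 𝓘(ℝ, ℝ) ∞ f) : pair u (fun x => c * f x) = c * pair u f := by
  rw [pair_of_contMDiff u hf, ← smul_eq_mul, ← map_smul, ← pair_coe]
  rfl

theorem pair_sub (u : Distrib d M) {f g : M → ℝ} (hf : ContMDiff (𝓡 d) 𝓘(ℝ, ℝ) ∞ f)
    (hg : ContMDiff (𝓡 d) 𝓘(ℝ, ℝ) ∞ g) :
    pair u (fun x => f x - g x) = pair u f - pair u g := by
  rw [pair_of_contMDiff u hf, pair_of_contMDiff u hg, ← map_sub, ← pair_coe]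
  rfl

theorem pair_sum (u : Distrib d M) {ι : Type*} (s : Finset ι) (c : ι → ℝ) {f : ι → M → ℝ}
    (hf : ∀ i ∈ s, ContMDiff (𝓡 d) 𝓘(ℝ, ℝ) ∞ (f i)) :
    pair u (fun x => ∑ i ∈ s, c i * f i x) = ∑ i ∈ s, c i * pair u (f i) := by
  classical
  induction s using Finset.induction_on with
  | empty => simpa using pair_const_mul u 0 (f := fun _ => 0) contMDiff_const
  | insert i s hi ih =>
    simp only [Finset.sum_insert hi]
    have h1 : ContMDiff (𝓡 d) 𝓘(ℝ, ℝ) ∞ (fun x => ∑ j ∈ s, c j * f j x) :=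
      contMDiff_finsetSum fun j hj => contMDiff_const.mul (hf j (by simp [hj]))
    have h2 : ContMDiff (𝓡 d) 𝓘(ℝ, ℝ) ∞ (fun x => c i * f i x) :=
      contMDiff_const.mul (hf i (by simp))
    rw [pair_add u h2 h1, pair_const_mul u _ (hf i (by simp)), ih fun j hj => hf j (by simp [hj])]

theorem tendsto_pair (u : Distrib d M) {f : ℕ → M → ℝ} {g : M → ℝ}
    (hf : ∀ᶠ n in atTop, ContMDiff (𝓡 d) 𝓘(ℝ, ℝ) ∞ (f n)) (hg : ContMDiff (𝓡 d) 𝓘(ℝ, ℝ) ∞ g)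
    (h : TendstoSmooth (d := d) f g) : Tendsto (fun n => pair u (f n)) atTop (𝓝 (pair u g)) := by
  classical
  rw [pair_of_contMDiff u hg]
  -- Continuity of `u` concerns sequences of test functions; the finitely many terms that may fail
  -- to be smooth are replaced by `g`.
  let F : ℕ → TestFun d M := fun n =>
    if hn : ContMDiff (𝓡 d) 𝓘(ℝ, ℝ) ∞ (f n) then toTestFun (f n) hn else toTestFun g hg
  have hF : ∀ᶠ n in atTop, f n = ⇑(F n) := by
    filter_upwards [hf] with n hn
    simp [F, dif_pos hn]
  refine (u.continuous' F (toTestFun g hg) (h.congr' hF)).congr' ?_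
  filter_upwards [hF] with n hn
  rw [hn, pair_coe]

theorem iteratedFDeriv_combination {E F : Type*} [NormedAddCommGroup E] [NormedSpace ℝ E]
    [NormedAddCommGroup F] [NormedSpace ℝ F] {k : ℕ} {a b g : E → F} {y : E} (c : ℝ)
    (ha : ContDiffAt ℝ k a y) (hb : ContDiffAt ℝ k b y) (hg : ContDiffAt ℝ k g y) :
    iteratedFDeriv ℝ k (fun y => c • (a y - b y - g y)) y =
      c • (iteratedFDeriv ℝ k a y - iteratedFDeriv ℝ k b y - iteratedFDeriv ℝ k g y) := by
  have h := iteratedFDeriv_const_smul_apply' (a := c) ((ha.sub hb).sub hg)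
  refine h.trans ?_
  have h1 : iteratedFDeriv ℝ k (fun y => a y - b y - g y) y = _ :=
    iteratedFDeriv_sub_apply (ha.sub hb) hg
  have h2 : iteratedFDeriv ℝ k (fun y => a y - b y) y = _ := iteratedFDeriv_sub_apply ha hb
  rw [h1, ← h2]

/-- Difference quotients of a smooth family converge in `C^∞(M)`. -/
theorem SmoothFamily.tendstoSmooth_remainder {U : Set P} {H : P → M → ℝ} (hU : IsOpen U)
    (hH : SmoothFamily (d := d) U H) {p : P} (hp : p ∈ U) {q : ℕ → P}
    (hq : Tendsto q atTop (𝓝 p)) :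
    TendstoSmooth (d := d) (fun n x => ‖q n - p‖⁻¹ •
      (H (q n) x - H p x - TransportNoise.paramDeriv H (q n - p) p x)) (fun _ => 0) := by
  intro e he K hK hKt k
  set f : P × Eu d → ℝ := fun z => H z.1 (e.symm z.2) with hfdef
  have hW := hU.prod e.open_target
  have hf : ContDiffOn ℝ ∞ f (U ×ˢ e.target) := hH e he
  set Φ := partialIter f k with hΦ
  have hΦs : ContDiffOn ℝ ∞ Φ (U ×ˢ e.target) := contDiffOn_partialIter hW hf k
  have hD : ContinuousOn (fderiv ℝ Φ) (U ×ˢ e.target) :=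
    (hΦs.fderiv_of_isOpen hW (m := ∞) (by simp)).continuousOn
  refine Metric.tendstoUniformlyOn_iff.2 ?_
  intro ε hε
  -- On this ball the parameter derivative of the `k`-th `y`-derivative `Φ` varies by less than `ε /
  -- 2`, uniformly in `y ∈ K`. The mean value inequality below then bounds the remainder by `ε / 2 *
  -- ‖q n - p‖`; halving `ε` recovers a strict inequality.
  obtain ⟨δ, hδ, hball⟩ := Metric.eventually_nhds_iff_ball.1
    ((eventually_norm_sub_lt_of_continuousOn_prod (F := P × Eu d →L[ℝ] Eu d [×k]→L[ℝ] ℝ)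
      hU e.open_target hD hK hKt hp (half_pos hε)).and (hU.mem_nhds hp))
  have hsl : ∀ q' ∈ U, ∀ y ∈ e.target, ContDiffAt ℝ ∞ (fun y => f (q', y)) y := fun q' hq' y hy =>
    (hf.contDiffAt (hW.mem_nhds ⟨hq', hy⟩)).comp y (by fun_prop)
  filter_upwards [hq.eventually (Metric.ball_mem_nhds p hδ)] with n hn y hy
  have hyt := hKt hy
  have hqU : q n ∈ U := (hball _ hn).2
  have hkle : (k : ℕ∞ω) ≤ (∞ : ℕ∞ω) := mod_cast le_top
  have hgs : ContDiffAt ℝ k (fun y => TransportNoise.paramDeriv H (q n - p) p (e.symm y)) y :=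
    (((hH.paramDeriv hU (q n - p) e he).contDiffAt (hW.mem_nhds ⟨hp, hyt⟩)).comp y
      (f := fun y : Eu d => (p, y)) (by fun_prop)).of_le hkle
  have hcomm : iteratedFDeriv ℝ k (fun y => TransportNoise.paramDeriv H (q n - p) p (e.symm y)) y =
      fderiv ℝ Φ (p, y) (q n - p, 0) := by
    rw [← partialIter_fderiv hW hf (q n - p) k (p, y) ⟨hp, hyt⟩]
    refine Filter.EventuallyEq.eq_of_nhds (f := iteratedFDeriv ℝ k
      fun y => TransportNoise.paramDeriv H (q n - p) p (e.symm y))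
      (g := iteratedFDeriv ℝ k fun y => fderiv ℝ f (p, y) (q n - p, 0))
      (Filter.EventuallyEq.iteratedFDeriv ℝ ?_ k)
    filter_upwards [e.open_target.mem_nhds hyt] with y' hy'
    exact hH.paramDeriv_chart hU he (q n - p) (z := (p, y')) ⟨hp, hy'⟩
  have hzero : iteratedFDeriv ℝ k (fun _ : Eu d => (0 : ℝ)) y = 0 := by
    rw [iteratedFDeriv_fun_zero]; rfl
  have hcomb := iteratedFDeriv_combination (‖q n - p‖⁻¹) ((hsl _ hqU y hyt).of_le hkle)
    ((hsl _ hp y hyt).of_le hkle) hgs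
  rw [hzero, dist_zero_left]
  refine (congrArg norm hcomb).trans_lt ?_
  rw [hcomm, norm_smul, norm_inv, norm_norm]
  have hmv : ‖Φ (q n, y) - Φ (p, y) - (fderiv ℝ Φ (p, y)).comp (ContinuousLinearMap.inl ℝ P (Eu d))
      (q n - p)‖ ≤ ε / 2 * ‖q n - p‖ := by
    refine (convex_ball p δ).norm_image_sub_le_of_norm_hasFDerivWithin_le'
      (f := fun q => Φ (q, y))
      (f' := fun q => (fderiv ℝ Φ (q, y)).comp (ContinuousLinearMap.inl ℝ P (Eu d))) ?_ ?_
      (Metric.mem_ball_self hδ) hn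
    · intro q' hq'
      have hqy : (q', y) ∈ U ×ˢ e.target := ⟨(hball _ hq').2, hyt⟩
      have h1 := ((hΦs.contDiffAt (hW.mem_nhds hqy)).differentiableAt
        (by simp)).hasFDerivAt
      exact (HasFDerivAt.comp q' (g := Φ) (f := fun q : P => (q, y)) h1
        (hasFDerivAt_prodMk_left q' y)).hasFDerivWithinAt
    · intro q' hq'
      rw [← ContinuousLinearMap.sub_comp]
      refine (ContinuousLinearMap.opNorm_comp_le _ _).trans ?_
      have h1 := ((hball _ hq').1 y hy).le
      calc _ ≤ ε / 2 * 1 := by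
            gcongr
            exact ContinuousLinearMap.norm_inl_le_one ℝ P (Eu d)
        _ = ε / 2 := mul_one _
  have hmv' : ‖iteratedFDeriv ℝ k (fun y => f (q n, y)) y - iteratedFDeriv ℝ k (fun y => f (p, y)) y
      - fderiv ℝ Φ (p, y) (q n - p, 0)‖ ≤ ε / 2 * ‖q n - p‖ := by
    simpa [hΦ, partialIter] using hmv
  rcases eq_or_ne (q n - p) 0 with h0 | h0
  -- When `q n = p` the factor `‖q n - p‖⁻¹` is `0` by convention.
  · rw [h0]; simpa using hε
  · have : 0 < ‖q n - p‖ := norm_pos_iff.2 h0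
    rw [inv_mul_lt_iff₀ this]
    nlinarith

variable [IsManifold (𝓡 d) ∞ M]

/-- The linear map `v ↦ (u, ∂_v H)`. -/
noncomputable def pairParamDeriv [FiniteDimensional ℝ P] (u : Distrib d M) {U : Set P}
    {H : P → M → ℝ} (hU : IsOpen U) (hH : SmoothFamily (d := d) U H) {p : P} (hp : p ∈ U) :
    P →L[ℝ] ℝ :=
  LinearMap.toContinuousLinearMap
    { toFun := fun v => pair u (TransportNoise.paramDeriv H v p)
      map_add' := fun v w => by
        rw [← pair_add u ((hH.paramDeriv hU v).contMDiff hp) ((hH.paramDeriv hU w).contMDiff hp)]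
        exact congrArg (pair u) (funext fun x => map_add _ v w)
      map_smul' := fun c v => by
        rw [RingHom.id_apply, smul_eq_mul, ← pair_const_mul u c ((hH.paramDeriv hU v).contMDiff hp)]
        exact congrArg (pair u) (funext fun x => map_smul _ c v) }

/-- The normalized Taylor remainder tends to zero in `C^∞(M)`, so the continuity of `u` lets the
derivative pass through the pairing. Sequences suffice, since the parameter space is metrizable. -/
theorem SmoothFamily.hasFDerivAt_pair [FiniteDimensional ℝ P] (u : Distrib d M) {U : Set P}
    {H : P → M → ℝ} (hU : IsOpen U) (hH : SmoothFamily (d := d) U H) {p : P} (hp : p ∈ U) :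
    HasFDerivAt (fun q => pair u (H q)) (pairParamDeriv u hU hH hp) p := by
  rw [hasFDerivAt_iff_tendsto]
  refine tendsto_of_seq_tendsto fun q hq => ?_
  have h0 : pair u (fun _ : M => (0 : ℝ)) = 0 := by
    simpa using pair_const_mul u 0 (f := fun _ => 0) contMDiff_const
  have hev : ∀ᶠ n in atTop, q n ∈ U := hq.eventually (hU.mem_nhds hp)
  have hsm : ∀ n, q n ∈ U → ContMDiff (𝓡 d) 𝓘(ℝ, ℝ) ∞
      (fun x => H (q n) x - H p x - TransportNoise.paramDeriv H (q n - p) p x) := fun n hn =>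
    ((hH.contMDiff hn).sub (hH.contMDiff hp)).sub ((hH.paramDeriv hU _).contMDiff hp)
  have h1 := tendsto_pair u (f := fun n x => ‖q n - p‖⁻¹ •
      (H (q n) x - H p x - TransportNoise.paramDeriv H (q n - p) p x)) (g := fun _ => 0)
    (hev.mono fun n hn => contMDiff_const.mul (hsm n hn)) contMDiff_const
    (hH.tendstoSmooth_remainder hU hp hq)
  rw [h0] at h1
  have h2 := h1.norm
  rw [norm_zero] at h2
  refine h2.congr' ?_
  filter_upwards [hev] with n hn
  have h3 := pair_const_mul u (‖q n - p‖⁻¹) (hsm n hn)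
  simp only [smul_eq_mul, Function.comp_apply]
  rw [h3, pair_sub u ((hH.contMDiff hn).sub (hH.contMDiff hp)) ((hH.paramDeriv hU _).contMDiff hp),
    pair_sub u (hH.contMDiff hn) (hH.contMDiff hp), norm_mul, norm_inv, norm_norm]
  rfl

/-- A directional derivative of the pairing is the pairing with another smooth family, so the
induction runs over all families simultaneously. -/
theorem SmoothFamily.contDiffOn_pair [FiniteDimensional ℝ P] (u : Distrib d M) {U : Set P}
    {H : P → M → ℝ} (hU : IsOpen U) (hH : SmoothFamily (d := d) U H) :
    ContDiffOn ℝ ∞ (fun q => pair u (H q)) U := by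
  rw [contDiffOn_infty]
  intro n
  induction n generalizing H with
  | zero =>
    exact contDiffOn_zero.2 fun p hp =>
      (hH.hasFDerivAt_pair u hU hp).continuousAt.continuousWithinAt
  | succ n ih =>
    push_cast
    rw [contDiffOn_succ_iff_fderiv_of_isOpen hU]
    refine ⟨fun p hp => (hH.hasFDerivAt_pair u hU hp).differentiableAt.differentiableWithinAt,
      by simp, ?_⟩
    rw [contDiffOn_clm_apply]
    intro v
    refine (ih (hH.paramDeriv hU v)).congr fun p hp => ?_
    rw [(hH.hasFDerivAt_pair u hU hp).fderiv]
    rfl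

/-! ### Smooth functions of two points -/

/-- Smoothness of a function of two points of `M`. -/
def SmoothTwo (k : M → M → ℝ) : Prop :=
  ∀ e ∈ atlas (Eu d) M, ∀ e' ∈ atlas (Eu d) M,
    ContDiffOn ℝ ∞ (fun z : Eu d × Eu d => k (e.symm z.1) (e'.symm z.2)) (e.target ×ˢ e'.target)

theorem SmoothTwo.smoothFamily {k : M → M → ℝ} (hk : SmoothTwo (d := d) k)
    {e : OpenPartialHomeomorph M (Eu d)} (he : e ∈ atlas (Eu d) M) :
    SmoothFamily (d := d) e.target (fun z => k (e.symm z)) := fun e' he' => hk e he e' he'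

theorem SmoothTwo.contMDiff_right {k : M → M → ℝ} (hk : SmoothTwo (d := d) k) (x : M) :
    ContMDiff (𝓡 d) 𝓘(ℝ, ℝ) ∞ (k x) := by
  have := (hk.smoothFamily (chart_mem_atlas (Eu d) x)).contMDiff (mem_chart_target (Eu d) x)
  simpa using this

theorem SmoothTwo.swap {k : M → M → ℝ} (hk : SmoothTwo (d := d) k) :
    SmoothTwo (d := d) (fun x y => k y x) := fun e he e' he' =>
  (hk e' he' e he).comp (f := Prod.swap) (contDiff_snd.prodMk contDiff_fst).contDiffOn fun _ hz => ⟨hz.2, hz.1⟩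

/-- This makes the double pairing in `quadPair` genuine: the inner pairing is a smooth function of
`x`, so the outer `pair` does not take its default value. -/
theorem SmoothTwo.contMDiff_pair {k : M → M → ℝ} (hk : SmoothTwo (d := d) k) (u : Distrib d M) :
    ContMDiff (𝓡 d) 𝓘(ℝ, ℝ) ∞ (fun x => pair u (k x)) := by
  rw [contMDiff_iff_contDiffOn_charts]
  intro e he
  exact (hk.smoothFamily he).contDiffOn_pair u e.open_target

end SmoothFamily


/-! ### Integrals of smooth functions over a parameter -/

section ParamIntegral

set_option linter.unusedSectionVars false

variable {Z E : Type*} [NormedAddCommGroup Z] [NormedSpace ℝ Z] [FiniteDimensional ℝ Z]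
  [MeasurableSpace Z] [BorelSpace Z] [NormedAddCommGroup E] [NormedSpace ℝ E]
  [FiniteDimensional ℝ E]

theorem partialIter_eq_zero {f : Z × E → ℝ} {z : Z} (hz : ∀ y, f (z, y) = 0) (k : ℕ) (y : E) :
    partialIter f k (z, y) = 0 := by
  simp only [partialIter, hz]
  rw [iteratedFDeriv_fun_zero]
  rfl

theorem exists_bound_of_continuousOn {F : Type*} [SeminormedAddCommGroup F] {g : Z × E → F}
    {T K : Set E} {Kz : Set Z} (hg : ContinuousOn g (Set.univ ×ˢ T)) (hKz : IsCompact Kz)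
    (hg0 : ∀ z ∉ Kz, ∀ y, g (z, y) = 0) (hK : IsCompact K) (hKT : K ⊆ T) :
    ∃ C : ℝ, 0 ≤ C ∧ ∀ z, ∀ y ∈ K, ‖g (z, y)‖ ≤ C := by
  obtain ⟨C, hC⟩ := (hKz.prod hK).exists_bound_of_continuousOn
    (hg.mono (Set.prod_mono (Set.subset_univ _) hKT))
  refine ⟨max C 0, le_max_right _ _, fun z y hy => ?_⟩
  by_cases hz : z ∈ Kz
  · exact (hC (z, y) ⟨hz, hy⟩).trans (le_max_left _ _)
  · rw [hg0 z hz, norm_zero]; exact le_max_right _ _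

theorem aestronglyMeasurable_comp_left {F : Type*} [NormedAddCommGroup F]
    {g : Z × E → F} {T : Set E} (hg : ContinuousOn g (Set.univ ×ˢ T)) {y : E} (hy : y ∈ T)
    {σ : Z → Z} (hσ : Measurable σ) (ν : Measure Z) :
    AEStronglyMeasurable (fun z => g (σ z, y)) ν := by
  have hc : Continuous fun z => g (z, y) := by
    rw [← continuousOn_univ]
    exact hg.comp (by fun_prop) fun z _ => ⟨Set.mem_univ _, hy⟩
  exact hc.comp_aestronglyMeasurable hσ.aestronglyMeasurable

/-- Differentiation under the integral sign, one order at a time; compact support in `z` supplies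
constant dominating functions. The map `σ` is kept so that `σ = id` gives the integral and a simple
function `σ` gives a Riemann sum. -/
theorem iteratedFDeriv_integral {f : Z × E → ℝ} {T : Set E} {Kz : Set Z} (hT : IsOpen T)
    (hf : ContDiffOn ℝ ∞ f (Set.univ ×ˢ T)) (hKz : IsCompact Kz)
    (hf0 : ∀ z ∉ Kz, ∀ y, f (z, y) = 0) (ν : Measure Z) [IsFiniteMeasure ν] {σ : Z → Z}
    (hσ : Measurable σ) (k : ℕ) :
    ∀ y ∈ T, iteratedFDeriv ℝ k (fun y => ∫ z, f (σ z, y) ∂ν) y =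
      ∫ z, partialIter f k (σ z, y) ∂ν := by
  have hW : IsOpen ((Set.univ : Set Z) ×ˢ T) := isOpen_univ.prod hT
  induction k with
  | zero =>
    intro y hy
    have h0 : ∀ z, partialIter f 0 z = (continuousMultilinearCurryFin0 ℝ E ℝ).symm (f z) := by
      intro z; ext; simp [partialIter]
    simp only [h0]
    refine Eq.trans ?_ ((continuousMultilinearCurryFin0 ℝ E ℝ).symm.toContinuousLinearEquiv.integral_comp_comm
      (fun z => f (σ z, y))).symm
    ext
    simp
  | succ k ih =>
    intro y hy
    set Φ := partialIter f k with hΦ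
    have hΦs : ContDiffOn ℝ ∞ Φ (Set.univ ×ˢ T) := contDiffOn_partialIter hW hf k
    set Ψ : Z × E → E →L[ℝ] E [×k]→L[ℝ] ℝ := fun q => fderiv ℝ (fun y => Φ (q.1, y)) q.2 with hΨ
    have hslice : ∀ q ∈ (Set.univ : Set Z) ×ˢ T,
        HasFDerivAt (fun y => Φ (q.1, y)) ((fderiv ℝ Φ q).comp (ContinuousLinearMap.inr ℝ Z E))
          q.2 := by
      intro q hq
      exact (HasFDerivAt.comp q.2 (g := Φ) (f := fun y : E => (q.1, y))
        (((hΦs.contDiffAt (hW.mem_nhds hq)).differentiableAt (by simp)).hasFDerivAt)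
        (hasFDerivAt_prodMk_right q.1 q.2))
    have hΨc : ContinuousOn Ψ (Set.univ ×ˢ T) := by
      have h1 : ContinuousOn (fun q => (fderiv ℝ Φ q).comp (ContinuousLinearMap.inr ℝ Z E))
          (Set.univ ×ˢ T) :=
        (hΦs.fderiv_of_isOpen hW (m := ∞) (by simp)).continuousOn.clm_comp continuousOn_const
      exact h1.congr fun q hq => (hslice q hq).fderiv
    have hΨ0 : ∀ z ∉ Kz, ∀ y, Ψ (z, y) = 0 := by
      intro z hz y
      simp only [hΨ, hΦ, partialIter_eq_zero (hf0 z hz)]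
      simp
    obtain ⟨r, hr, hrT⟩ := Metric.nhds_basis_closedBall.mem_iff.1 (hT.mem_nhds hy)
    obtain ⟨C, hC0, hC⟩ := exists_bound_of_continuousOn
      (F := E →L[ℝ] E [×k]→L[ℝ] ℝ) hΨc hKz hΨ0 (isCompact_closedBall y r) hrT
    obtain ⟨C', hC'0, hC'⟩ := exists_bound_of_continuousOn hΦs.continuousOn hKz
      (fun z hz y => partialIter_eq_zero (hf0 z hz) k y) (isCompact_closedBall y r) hrT
    have hmain : HasFDerivAt (fun y => ∫ z, Φ (σ z, y) ∂ν) (∫ z, Ψ (σ z, y) ∂ν) y := by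
      refine hasFDerivAt_integral_of_dominated_of_fderiv_le (𝕜 := ℝ)
        (F := fun y z => Φ (σ z, y)) (F' := fun y z => Ψ (σ z, y)) (bound := fun _ => C)
        (Metric.closedBall_mem_nhds y hr) ?_ ?_ ?_ ?_ (integrable_const _) ?_
      · filter_upwards [hT.mem_nhds hy] with y' hy'
        exact aestronglyMeasurable_comp_left hΦs.continuousOn hy' hσ ν
      · exact Integrable.of_bound (aestronglyMeasurable_comp_left hΦs.continuousOn hy hσ ν) C'
          (ae_of_all _ fun z => hC' _ _ (Metric.mem_closedBall_self hr.le))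
      · exact aestronglyMeasurable_comp_left (F := E →L[ℝ] E [×k]→L[ℝ] ℝ) hΨc hy hσ ν
      · exact ae_of_all _ fun z y' hy' => hC _ _ hy'
      · refine ae_of_all _ fun z y' hy' => ?_
        exact (hslice (σ z, y') ⟨Set.mem_univ _, hrT hy'⟩).differentiableAt.hasFDerivAt
    have hev : iteratedFDeriv ℝ k (fun y => ∫ z, f (σ z, y) ∂ν) =ᶠ[𝓝 y]
        fun y => ∫ z, Φ (σ z, y) ∂ν := by
      filter_upwards [hT.mem_nhds hy] with y' hy' using ih y' hy'
    rw [iteratedFDeriv_succ_eq_comp_left, Function.comp_apply, hev.fderiv_eq, hmain.fderiv]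
    simp only [partialIter_succ]
    exact (ContinuousLinearEquiv.integral_comp_comm (𝕜 := ℝ) (E := E →L[ℝ] E [×k]→L[ℝ] ℝ)
      (F := E [×(k + 1)]→L[ℝ] ℝ) (continuousMultilinearCurryLeftEquiv ℝ (fun _ : Fin (k + 1) => E)
      ℝ).symm.toContinuousLinearEquiv (fun z => Ψ (σ z, y))).symm

/-- Dominated convergence along the product filter `atTop ×ˢ 𝓝[K] y` lets the index and the point
move together, which is local uniformity at `y`. -/
theorem tendstoUniformlyOn_integral {F : Type*} [NormedAddCommGroup F] [NormedSpace ℝ F]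
    {Φ : Z × E → F} {T K : Set E} {Kz : Set Z} (hT : IsOpen T)
    (hΦ : ContinuousOn Φ (Set.univ ×ˢ T)) (hKz : IsCompact Kz)
    (hΦ0 : ∀ z ∉ Kz, ∀ y, Φ (z, y) = 0) (ν : Measure Z) [IsFiniteMeasure ν] {σ : ℕ → Z → Z}
    (hσ : ∀ m, Measurable (σ m)) (hlim : ∀ z, Tendsto (fun m => σ m z) atTop (𝓝 z))
    (hK : IsCompact K) (hKT : K ⊆ T) :
    TendstoUniformlyOn (fun m y => ∫ z, Φ (σ m z, y) ∂ν) (fun y => ∫ z, Φ (z, y) ∂ν) atTop K := by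
  rw [← tendstoLocallyUniformlyOn_iff_tendstoUniformlyOn_of_compact hK,
    tendstoLocallyUniformlyOn_iff_forall_tendsto]
  intro y hy
  obtain ⟨C, hC0, hC⟩ := exists_bound_of_continuousOn hΦ hKz hΦ0 hK hKT
  have hmem : ∀ᶠ q : ℕ × E in atTop ×ˢ 𝓝[K] y, q.2 ∈ K :=
    tendsto_snd.eventually eventually_mem_nhdsWithin
  have hsnd : Tendsto (fun q : ℕ × E => q.2) (atTop ×ˢ 𝓝[K] y) (𝓝 y) :=
    tendsto_snd.mono_right nhdsWithin_le_nhds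
  have hΦat : ∀ z, Tendsto Φ (𝓝 (z, y)) (𝓝 (Φ (z, y))) := fun z =>
    (hΦ.continuousAt ((isOpen_univ.prod hT).mem_nhds ⟨Set.mem_univ _, hKT hy⟩)).tendsto
  have h1 : Tendsto (fun q : ℕ × E => ∫ z, Φ (z, q.2) ∂ν) (atTop ×ˢ 𝓝[K] y)
      (𝓝 (∫ z, Φ (z, y) ∂ν)) := by
    refine tendsto_integral_filter_of_dominated_convergence (fun _ => C) ?_ ?_
      (integrable_const _) (ae_of_all _ fun z => ?_)
    · exact hmem.mono fun q hq => aestronglyMeasurable_comp_left hΦ (hKT hq) measurable_id ν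
    · exact hmem.mono fun q hq => ae_of_all _ fun z => hC z _ hq
    · exact (hΦat z).comp (Tendsto.prodMk_nhds tendsto_const_nhds hsnd)
  have h2 : Tendsto (fun q : ℕ × E => ∫ z, Φ (σ q.1 z, q.2) ∂ν) (atTop ×ˢ 𝓝[K] y)
      (𝓝 (∫ z, Φ (z, y) ∂ν)) := by
    refine tendsto_integral_filter_of_dominated_convergence (fun _ => C) ?_ ?_
      (integrable_const _) (ae_of_all _ fun z => ?_)
    · exact hmem.mono fun q hq => aestronglyMeasurable_comp_left hΦ (hKT hq) (hσ q.1) ν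
    · exact hmem.mono fun q hq => ae_of_all _ fun z => hC _ _ hq
    · exact (hΦat z).comp (Tendsto.prodMk_nhds ((hlim z).comp tendsto_fst) hsnd)
  exact (Tendsto.prodMk_nhds h1 h2).mono_right (nhds_le_uniformity _)

theorem integral_comp_simpleFunc {α β : Type*} [MeasurableSpace α] (s : SimpleFunc α β)
    (ν : Measure α) [IsFiniteMeasure ν] (G : β → ℝ) :
    ∫ a, G (s a) ∂ν = ∑ c ∈ s.range, ν.real (s ⁻¹' {c}) * G c := by
  classical
  have h : ∀ a, G (s a) = ∑ c ∈ s.range, (s ⁻¹' {c}).indicator (fun _ => G c) a := by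
    intro a
    rw [Finset.sum_eq_single (s a)]
    · simp
    · intro c _ hc
      exact Set.indicator_of_notMem (by simpa using hc.symm) _
    · intro h
      exact absurd (SimpleFunc.mem_range_self s a) h
  simp only [h]
  rw [integral_finsetSum _ fun c _ => (integrable_const _).indicator (s.measurableSet_preimage _)]
  refine Finset.sum_congr rfl fun c _ => ?_
  rw [integral_indicator_const _ (s.measurableSet_preimage _), smul_eq_mul]

end ParamIntegral

/-! ### Convergence of Riemann sums in `C^∞(M)` -/

section Riemann

variable {d : ℕ} {M : Type*} [TopologicalSpace M] [ChartedSpace (Eu d) M]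

theorem SmoothFamily.tendstoSmooth_integral {Z : Type*} [NormedAddCommGroup Z] [NormedSpace ℝ Z]
    [FiniteDimensional ℝ Z] [MeasurableSpace Z] [BorelSpace Z] {H : Z → M → ℝ}
    (hH : SmoothFamily (d := d) Set.univ H) {Kz : Set Z} (hKz : IsCompact Kz)
    (hH0 : ∀ z ∉ Kz, ∀ x, H z x = 0) (ν : Measure Z) [IsFiniteMeasure ν] {σ : ℕ → Z → Z}
    (hσ : ∀ m, Measurable (σ m)) (hlim : ∀ z, Tendsto (fun m => σ m z) atTop (𝓝 z)) :
    TendstoSmooth (d := d) (fun m x => ∫ z, H (σ m z) x ∂ν) (fun x => ∫ z, H z x ∂ν) := by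
  intro e he K hK hKt k
  have hf0 : ∀ z ∉ Kz, ∀ y, (fun q : Z × Eu d => H q.1 (e.symm q.2)) (z, y) = 0 :=
    fun z hz y => hH0 z hz _
  have h := tendstoUniformlyOn_integral e.open_target
    (contDiffOn_partialIter (isOpen_univ.prod e.open_target) (hH e he) k).continuousOn hKz
    (fun z hz y => partialIter_eq_zero (hf0 z hz) k y) ν hσ hlim hK hKt
  refine (h.congr (Eventually.of_forall fun m y hy => ?_)).congr_right fun y hy => ?_
  · exact (iteratedFDeriv_integral e.open_target (hH e he) hKz hf0 ν (hσ m) k y (hKt hy)).symm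
  · exact (iteratedFDeriv_integral e.open_target (hH e he) hKz hf0 ν measurable_id k y
      (hKt hy)).symm

theorem TendstoSmooth.add {f f' : ℕ → M → ℝ} {g g' : M → ℝ} [IsManifold (𝓡 d) ∞ M]
    (hfs : ∀ n, ContMDiff (𝓡 d) 𝓘(ℝ, ℝ) ∞ (f n)) (hfs' : ∀ n, ContMDiff (𝓡 d) 𝓘(ℝ, ℝ) ∞ (f' n))
    (hgs : ContMDiff (𝓡 d) 𝓘(ℝ, ℝ) ∞ g) (hgs' : ContMDiff (𝓡 d) 𝓘(ℝ, ℝ) ∞ g')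
    (h : TendstoSmooth (d := d) f g) (h' : TendstoSmooth (d := d) f' g') :
    TendstoSmooth (d := d) (fun n x => f n x + f' n x) (fun x => g x + g' x) := by
  intro e he K hK hKt k
  have hkle : (k : ℕ∞ω) ≤ (∞ : ℕ∞ω) := mod_cast le_top
  have key : ∀ a b : M → ℝ, ContMDiff (𝓡 d) 𝓘(ℝ, ℝ) ∞ a → ContMDiff (𝓡 d) 𝓘(ℝ, ℝ) ∞ b →
      ∀ y ∈ K, iteratedFDeriv ℝ k (fun y => a (e.symm y)) y +
        iteratedFDeriv ℝ k (fun y => b (e.symm y)) y =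
        iteratedFDeriv ℝ k (fun y => a (e.symm y) + b (e.symm y)) y := by
    intro a b ha hb y hy
    have hs : ∀ c : M → ℝ, ContMDiff (𝓡 d) 𝓘(ℝ, ℝ) ∞ c →
        ContDiffAt ℝ k (fun y => c (e.symm y)) y := fun c hc =>
      (((contMDiff_iff_contDiffOn_charts.1 hc) e he).contDiffAt
        (e.open_target.mem_nhds (hKt hy))).of_le hkle
    exact (iteratedFDeriv_add_apply (hs a ha) (hs b hb)).symm
  have hsum := (h e he K hK hKt k).add (h' e he K hK hKt k)
  refine (hsum.congr (Eventually.of_forall fun n y hy => ?_)).congr_right fun y hy => ?_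
  · exact key _ _ (hfs n) (hfs' n) y hy
  · exact key _ _ hgs hgs' y hy

end Riemann


/-! ### Approximation of the identity by operators of finite rank -/

section Approximation

set_option linter.unusedSectionVars false

variable {d : ℕ} {M : Type*} [TopologicalSpace M] [ChartedSpace (Eu d) M] [IsManifold (𝓡 d) ∞ M]

theorem contDiffOn_transition {e e' : OpenPartialHomeomorph M (Eu d)} (he : e ∈ atlas (Eu d) M)
    (he' : e' ∈ atlas (Eu d) M) :
    ContDiffOn ℝ ∞ (fun y => e (e'.symm y)) (e'.target ∩ e'.symm ⁻¹' e.source) := by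
  rw [← contMDiffOn_iff_contDiffOn]
  exact (contMDiffOn_of_mem_maximalAtlas (IsManifold.subset_maximalAtlas he)).comp
    ((contMDiffOn_symm_of_mem_maximalAtlas (IsManifold.subset_maximalAtlas he')).mono
      Set.inter_subset_left) fun y hy => hy.2

theorem isOpen_transition (e e' : OpenPartialHomeomorph M (Eu d)) :
    IsOpen (e'.target ∩ e'.symm ⁻¹' e.source) :=
  e'.isOpen_inter_preimage_symm e.open_source

/-- Inside the domain of `e` this is a composition of smooth maps. At any other point the product
vanishes in a whole neighbourhood, because the closed support of `χ` lies inside the domain. -/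
theorem smoothFamily_mul_comp_chart {P : Type*} [NormedAddCommGroup P] [NormedSpace ℝ P]
    {e : OpenPartialHomeomorph M (Eu d)} (he : e ∈ atlas (Eu d) M) {χ : M → ℝ}
    (hχ : ContMDiff (𝓡 d) 𝓘(ℝ, ℝ) ∞ χ) (hsupp : tsupport χ ⊆ e.source) {G : P × Eu d → ℝ}
    (hG : ContDiff ℝ ∞ G) :
    SmoothFamily (d := d) Set.univ (fun (p : P) x => χ x * G (p, e x)) := by
  rintro e' he' ⟨p, y⟩ ⟨-, hy⟩
  apply ContDiffAt.contDiffWithinAt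
  by_cases hx : e'.symm y ∈ e.source
  · have h1 : ContDiffAt ℝ ∞ (fun y => χ (e'.symm y)) y :=
      (contMDiff_iff_contDiffOn_charts.1 hχ e' he').contDiffAt (e'.open_target.mem_nhds hy)
    have h2 : ContDiffAt ℝ ∞ (fun y => e (e'.symm y)) y :=
      (contDiffOn_transition he he').contDiffAt ((isOpen_transition e e').mem_nhds ⟨hy, hx⟩)
    have h1' : ContDiffAt ℝ ∞ (fun z : P × Eu d => χ (e'.symm z.2)) (p, y) :=
      ContDiffAt.comp (p, y) (g := fun y => χ (e'.symm y)) h1 contDiffAt_snd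
    have h2' : ContDiffAt ℝ ∞ (fun z : P × Eu d => e (e'.symm z.2)) (p, y) :=
      ContDiffAt.comp (p, y) (g := fun y => e (e'.symm y)) h2 contDiffAt_snd
    exact h1'.mul (hG.contDiffAt.comp (p, y) (contDiffAt_fst.prodMk h2'))
  · have hev : ∀ᶠ z : P × Eu d in 𝓝 (p, y), χ (e'.symm z.2) * G (z.1, e (e'.symm z.2)) = 0 := by
      have h1 : ∀ᶠ x in 𝓝 (e'.symm y), χ x = 0 :=
        (isClosed_tsupport χ).isOpen_compl.eventually_mem (fun h => hx (hsupp h))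
          |>.mono fun x hx => image_eq_zero_of_notMem_tsupport hx
      have h2 : Tendsto (fun z : P × Eu d => e'.symm z.2) (𝓝 (p, y)) (𝓝 (e'.symm y)) :=
        (e'.symm.continuousAt hy).tendsto.comp (continuous_snd.tendsto (p, y))
      filter_upwards [h2.eventually h1] with z hz
      rw [hz, zero_mul]
    exact (contDiffAt_const (c := (0 : ℝ))).congr_of_eventuallyEq hev

/-- The expression of a function in a chart, extended by `0`. -/
noncomputable def chartExt (e : OpenPartialHomeomorph M (Eu d)) (h : M → ℝ) : Eu d → ℝ :=
  e.target.indicator (fun z => h (e.symm z))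

theorem chartExt_apply {e : OpenPartialHomeomorph M (Eu d)} {h : M → ℝ} {x : M}
    (hx : x ∈ e.source) : chartExt e h (e x) = h x := by
  rw [chartExt, Set.indicator_of_mem (e.map_source hx), e.left_inv hx]

theorem chartExt_eq_zero {e : OpenPartialHomeomorph M (Eu d)} {h : M → ℝ} {z : Eu d}
    (hz : z ∉ e '' tsupport h) : chartExt e h z = 0 := by
  by_cases hzt : z ∈ e.target
  · rw [chartExt, Set.indicator_of_mem hzt]
    by_contra hne
    exact hz ⟨e.symm z, subset_tsupport _ hne, e.right_inv hzt⟩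
  · exact Set.indicator_of_notMem hzt _

theorem isCompact_image_tsupport [CompactSpace M] {e : OpenPartialHomeomorph M (Eu d)} {h : M → ℝ}
    (hsupp : tsupport h ⊆ e.source) : IsCompact (e '' tsupport h) :=
  (isClosed_tsupport h).isCompact.image_of_continuousOn (e.continuousOn.mono hsupp)

theorem contDiff_chartExt [CompactSpace M] {e : OpenPartialHomeomorph M (Eu d)}
    (he : e ∈ atlas (Eu d) M) {h : M → ℝ} (hh : ContMDiff (𝓡 d) 𝓘(ℝ, ℝ) ∞ h)
    (hsupp : tsupport h ⊆ e.source) : ContDiff ℝ ∞ (chartExt e h) := by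
  rw [contDiff_iff_contDiffAt]
  intro z
  by_cases hz : z ∈ e.target
  · refine ((contMDiff_iff_contDiffOn_charts.1 hh e he).contDiffAt
      (e.open_target.mem_nhds hz)).congr_of_eventuallyEq ?_
    filter_upwards [e.open_target.mem_nhds hz] with z' hz'
    rw [chartExt, Set.indicator_of_mem hz']
  · have hz' : z ∉ e '' tsupport h := by
      rintro ⟨x, hx, rfl⟩
      exact hz (e.map_source (hsupp hx))
    refine (contDiffAt_const (c := (0 : ℝ))).congr_of_eventuallyEq ?_
    filter_upwards [(isCompact_image_tsupport hsupp).isClosed.isOpen_compl.mem_nhds hz'] with w hw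
    exact chartExt_eq_zero hw

theorem abs_chartExt_le {e : OpenPartialHomeomorph M (Eu d)} {h : M → ℝ} {B : ℝ}
    (hB : ∀ x, |h x| ≤ B) (hB0 : 0 ≤ B) (z : Eu d) : |chartExt e h z| ≤ B := by
  by_cases hz : z ∈ e.target
  · rw [chartExt, Set.indicator_of_mem hz]; exact hB _
  · rw [chartExt, Set.indicator_of_notMem hz, abs_zero]; exact hB0

/-- An operator `f ↦ ∑ f(x_i) a_i` with smooth `a_i`. -/
def IsFiniteRank (T : (M → ℝ) → M → ℝ) : Prop :=
  ∃ (ι : Type) (_ : Fintype ι) (x : ι → M) (a : ι → M → ℝ),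
    (∀ i, ContMDiff (𝓡 d) 𝓘(ℝ, ℝ) ∞ (a i)) ∧ ∀ f y, T f y = ∑ i, f (x i) * a i y

/-- Strong convergence of operators on `C^∞(M)`, with a uniform bound in the supremum norm. -/
structure OpTendsto (T : ℕ → (M → ℝ) → M → ℝ) (S : (M → ℝ) → M → ℝ) : Prop where
  smooth : ∀ n f, ContMDiff (𝓡 d) 𝓘(ℝ, ℝ) ∞ f → ContMDiff (𝓡 d) 𝓘(ℝ, ℝ) ∞ (T n f)
  smooth_lim : ∀ f, ContMDiff (𝓡 d) 𝓘(ℝ, ℝ) ∞ f → ContMDiff (𝓡 d) 𝓘(ℝ, ℝ) ∞ (S f)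
  tendsto : ∀ f, ContMDiff (𝓡 d) 𝓘(ℝ, ℝ) ∞ f → TendstoSmooth (d := d) (fun n => T n f) (S f)
  bounded : ∃ C : ℝ, ∀ n f B, (∀ y, |f y| ≤ B) → ∀ x, |T n f x| ≤ C * B

/-- Limits of operators in the class `𝒞`. -/
def SeqClosure (d : ℕ) {M : Type*} [TopologicalSpace M] [ChartedSpace (Eu d) M]
    (𝒞 : ((M → ℝ) → M → ℝ) → Prop) (S : (M → ℝ) → M → ℝ) : Prop :=
  ∃ T : ℕ → (M → ℝ) → M → ℝ, (∀ n, 𝒞 (T n)) ∧ OpTendsto (d := d) T S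

theorem IsFiniteRank.add {T T' : (M → ℝ) → M → ℝ} (h : IsFiniteRank (d := d) T)
    (h' : IsFiniteRank (d := d) T') : IsFiniteRank (d := d) (fun f x => T f x + T' f x) := by
  obtain ⟨ι, _, x, a, ha, hT⟩ := h
  obtain ⟨ι', _, x', a', ha', hT'⟩ := h'
  refine ⟨ι ⊕ ι', inferInstance, Sum.elim x x', Sum.elim a a', ?_, fun f y => ?_⟩
  · rintro (i | i)
    exacts [ha i, ha' i]
  · simp only [hT, hT', Fintype.sum_sum_type, Sum.elim_inl, Sum.elim_inr]

theorem isFiniteRank_zero : IsFiniteRank (d := d) (fun (_ : M → ℝ) _ => 0) :=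
  ⟨Empty, inferInstance, fun i => i.elim, fun i => i.elim, fun i => i.elim, fun f y => by simp⟩

theorem OpTendsto.add {T T' : ℕ → (M → ℝ) → M → ℝ} {S S' : (M → ℝ) → M → ℝ}
    (h : OpTendsto (d := d) T S) (h' : OpTendsto (d := d) T' S') :
    OpTendsto (d := d) (fun n f x => T n f x + T' n f x) (fun f x => S f x + S' f x) where
  smooth n f hf := (h.smooth n f hf).add (h'.smooth n f hf)
  smooth_lim f hf := (h.smooth_lim f hf).add (h'.smooth_lim f hf)
  tendsto f hf := (h.tendsto f hf).add (fun n => h.smooth n f hf) (fun n => h'.smooth n f hf)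
    (h.smooth_lim f hf) (h'.smooth_lim f hf) (h'.tendsto f hf)
  bounded := by
    obtain ⟨C, hC⟩ := h.bounded
    obtain ⟨C', hC'⟩ := h'.bounded
    refine ⟨C + C', fun n f B hB x => ?_⟩
    rw [add_mul]
    exact (abs_add_le _ _).trans (add_le_add (hC n f B hB x) (hC' n f B hB x))

theorem opTendsto_zero : OpTendsto (d := d) (fun _ (_ : M → ℝ) _ => 0) (fun _ _ => 0) where
  smooth _ _ _ := contMDiff_const
  smooth_lim _ _ := contMDiff_const
  tendsto _ _ := fun e he K hK hKt k => by
    rw [Metric.tendstoUniformlyOn_iff]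
    intro ε hε
    simp [hε]
  bounded := ⟨0, fun n f B hB x => by simp⟩

theorem SeqClosure.add {𝒞 : ((M → ℝ) → M → ℝ) → Prop}
    (h𝒞 : ∀ T T', 𝒞 T → 𝒞 T' → 𝒞 (fun f x => T f x + T' f x)) {S S' : (M → ℝ) → M → ℝ}
    (h : SeqClosure d 𝒞 S) (h' : SeqClosure d 𝒞 S') : SeqClosure d 𝒞 (fun f x => S f x + S' f x) := by
  obtain ⟨T, hT, hTS⟩ := h
  obtain ⟨T', hT', hTS'⟩ := h'
  exact ⟨_, fun n => h𝒞 _ _ (hT n) (hT' n), hTS.add hTS'⟩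

theorem SeqClosure.zero {𝒞 : ((M → ℝ) → M → ℝ) → Prop} (h𝒞 : 𝒞 fun _ _ => 0) :
    SeqClosure d 𝒞 (fun (_ : M → ℝ) _ => 0) := ⟨_, fun _ => h𝒞, opTendsto_zero⟩

/-- Mollification in the chart `e` at scale `ε`, with cutoffs `ρ` and `χ`. -/
noncomputable def mollify (e : OpenPartialHomeomorph M (Eu d)) (ρ χ : M → ℝ)
    (η : ContDiffBump (0 : Eu d)) (ε : ℝ) (f : M → ℝ) (x : M) : ℝ :=
  χ x * ∫ w, η.normed volume w * chartExt e (fun x => ρ x * f x) (e x - ε • w)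

/-- Riemann sums for `mollify`; the points are the values of `σ`. -/
noncomputable def mollifySum (e : OpenPartialHomeomorph M (Eu d)) (ρ χ : M → ℝ)
    (η : ContDiffBump (0 : Eu d)) (ε : ℝ) (σ : Eu d → Eu d) (f : M → ℝ) (x : M) : ℝ :=
  ∫ z in e '' tsupport ρ, chartExt e (fun x => ρ x * f x) (σ z) *
    (χ x * ((ε ^ d)⁻¹ * η.normed volume (ε⁻¹ • (e x - σ z))))

/-- Placing the scale in the argument of `h`, not in the bump, keeps the formula smooth through
scale `0`. Convergence of the mollification as the scale shrinks is then continuity of a smooth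
family at `0`. -/
theorem contDiff_integral_bump_mul (η : ContDiffBump (0 : Eu d)) {h : Eu d → ℝ}
    (hh : ContDiff ℝ ∞ h) :
    ContDiff ℝ ∞ (fun q : ℝ × Eu d => ∫ w, η.normed volume w * h (q.2 - q.1 • w)) := by
  have hη : ContDiff ℝ ∞ (η.normed (volume : Measure (Eu d))) := η.contDiff_normed (n := ⊤)
  -- The integral is a convolution with the constant `1` evaluated at `0`; this reverses the sign of
  -- `w`, which the even bump absorbs.
  have h1 := contDiffOn_convolution_right_with_param_comp (𝕜 := ℝ) (n := ⊤) (μ := volume)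
    (ContinuousLinearMap.mul ℝ ℝ) (s := (Set.univ : Set (ℝ × Eu d))) (v := fun _ => (0 : Eu d))
    contDiffOn_const (f := fun _ : Eu d => (1 : ℝ))
    (g := fun q t => η.normed volume t * h (q.2 + q.1 • t)) isOpen_univ
    (η.hasCompactSupport_normed (μ := volume)).isCompact (fun q t _ ht => by
      rw [image_eq_zero_of_notMem_tsupport ht, zero_mul]) (locallyIntegrable_const _)
    (by
      apply ContDiff.contDiffOn
      have : (↿fun (q : ℝ × Eu d) (t : Eu d) => η.normed volume t * h (q.2 + q.1 • t)) =
        fun z : (ℝ × Eu d) × Eu d => η.normed volume z.2 * h (z.1.2 + z.1.1 • z.2) := rfl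
      rw [this]
      exact (hη.comp contDiff_snd).mul (hh.comp (by fun_prop)))
  rw [contDiffOn_univ] at h1
  convert h1 using 2 with q
  rw [MeasureTheory.convolution_def]
  refine integral_congr_ae (ae_of_all _ fun w => ?_)
  simp [sub_eq_add_neg, η.normed_neg]

/-- The substitution `z = e x - ε w` moves the dependence on `x` from the unknown function to the
kernel, so that a discretization in `z` only evaluates `f` at fixed points. -/
theorem mollify_eq_integral (e : OpenPartialHomeomorph M (Eu d)) (ρ χ : M → ℝ)
    (η : ContDiffBump (0 : Eu d)) {ε : ℝ} (hε : 0 < ε) (f : M → ℝ) (x : M) :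
    mollify e ρ χ η ε f x = mollifySum e ρ χ η ε id f x := by
  set h := chartExt e (fun x => ρ x * f x) with hh
  have h0 : ∀ z ∉ e '' tsupport ρ, h z = 0 := by
    intro z hz
    by_cases hzt : z ∈ e.target
    · rw [hh, chartExt, Set.indicator_of_mem hzt]
      have : e.symm z ∉ tsupport ρ := fun h => hz ⟨_, h, e.right_inv hzt⟩
      rw [image_eq_zero_of_notMem_tsupport this, zero_mul]
    · exact Set.indicator_of_notMem hzt _
  unfold mollify mollifySum
  rw [setIntegral_eq_integral_of_forall_compl_eq_zero (fun z hz => by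
    rw [id, ← hh, h0 z hz, zero_mul])]
  have h1 := integral_sub_left_eq_self
    (fun w => η.normed volume (ε⁻¹ • w) * h (e x - w)) (volume : Measure (Eu d)) (e x)
  have h2 := Measure.integral_comp_smul (volume : Measure (Eu d))
    (fun w => η.normed volume (ε⁻¹ • w) * h (e x - w)) ε
  have h3 : ∀ w : Eu d, η.normed volume (ε⁻¹ • ε • w) = η.normed volume w := fun w => by
    rw [smul_smul, inv_mul_cancel₀ hε.ne', one_smul]
  simp only [h3] at h2
  rw [← hh, h2, ← h1, finrank_euclideanSpace_fin, abs_of_nonneg (by positivity), smul_eq_mul,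
    ← mul_assoc, ← integral_const_mul]
  refine integral_congr_ae (ae_of_all _ fun w => ?_)
  simp only [id, sub_sub_cancel]
  ring

theorem exists_bound_of_contMDiff [CompactSpace M] {f : M → ℝ}
    (hf : ContMDiff (𝓡 d) 𝓘(ℝ, ℝ) ∞ f) : ∃ C : ℝ, 0 ≤ C ∧ ∀ x, |f x| ≤ C := by
  obtain ⟨C, hC⟩ := isCompact_univ.exists_bound_of_continuousOn hf.continuous.continuousOn
  exact ⟨max C 0, le_max_right _ _, fun x => (hC x (Set.mem_univ _)).trans (le_max_left _ _)⟩

theorem tsupport_mul_subset {ρ f : M → ℝ} {s : Set M} (h : tsupport ρ ⊆ s) :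
    tsupport (fun x => ρ x * f x) ⊆ s :=
  (closure_mono (Function.support_mul_subset_left ρ f)).trans h

/-- At a fixed scale the mollification is an integral over a compact set with a smooth kernel, hence
a `C^∞` limit of its Riemann sums. Their uniform bound in the supremum norm may depend on `ε`. -/
theorem seqClosure_mollify [T2Space M] [CompactSpace M] {e : OpenPartialHomeomorph M (Eu d)}
    (he : e ∈ atlas (Eu d) M) {ρ χ : M → ℝ} (hρ : ContMDiff (𝓡 d) 𝓘(ℝ, ℝ) ∞ ρ)
    (hχ : ContMDiff (𝓡 d) 𝓘(ℝ, ℝ) ∞ χ) (hρs : tsupport ρ ⊆ e.source)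
    (hχs : tsupport χ ⊆ e.source) (η : ContDiffBump (0 : Eu d)) {ε : ℝ} (hε : 0 < ε) :
    SeqClosure d (IsFiniteRank (d := d)) (mollify (M := M) e ρ χ η ε) := by
  classical
  have hKz := isCompact_image_tsupport (M := M) (e := e) hρs
  set Kz := e '' tsupport ρ with hKzdef
  have : IsFiniteMeasure ((volume : Measure (Eu d)).restrict Kz) :=
    ⟨by rw [Measure.restrict_apply_univ]; exact hKz.measure_lt_top⟩
  let σ : ℕ → SimpleFunc (Eu d) (Eu d) :=
    SimpleFunc.approxOn id measurable_id Set.univ 0 (Set.mem_univ _)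
  have hσlim : ∀ z, Tendsto (fun m => σ m z) atTop (𝓝 z) := fun z =>
    SimpleFunc.tendsto_approxOn measurable_id (Set.mem_univ _) (by simp)
  have hη : ContDiff ℝ ∞ (η.normed (volume : Measure (Eu d))) := η.contDiff_normed (n := ⊤)
  -- the family `z ↦ χ ε^{-d} η((e - z)/ε)`
  have hA : SmoothFamily (d := d) (Set.univ : Set (Eu d))
      (fun z x => χ x * ((ε ^ d)⁻¹ * η.normed volume (ε⁻¹ • (e x - z)))) :=
    smoothFamily_mul_comp_chart he hχ hχs
      (G := fun q : Eu d × Eu d => (ε ^ d)⁻¹ * η.normed volume (ε⁻¹ • (q.2 - q.1)))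
      (contDiff_const.mul (hη.comp (by fun_prop)))
  have hext : ∀ f, ContMDiff (𝓡 d) 𝓘(ℝ, ℝ) ∞ f →
      ContDiff ℝ ∞ (chartExt e fun x => ρ x * f x) := fun f hf =>
    contDiff_chartExt he (hρ.mul hf) (tsupport_mul_subset hρs)
  have hH : ∀ f, ContMDiff (𝓡 d) 𝓘(ℝ, ℝ) ∞ f → SmoothFamily (d := d) (Set.univ : Set (Eu d))
      (fun z x => chartExt e (fun x => ρ x * f x) z *
        (χ x * ((ε ^ d)⁻¹ * η.normed volume (ε⁻¹ • (e x - z))))) := fun f hf e' he' =>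
    (((hext f hf).comp contDiff_fst).contDiffOn).mul (hA e' he')
  have hfr : ∀ m, IsFiniteRank (d := d) (mollifySum (M := M) e ρ χ η ε (σ m)) := by
    intro m
    -- The nodes are the values of the simple function; the weight of a node is the mass of its
    -- level set times the cutoff `ρ`.
    refine ⟨Fin (σ m).range.card, inferInstance,
      fun i => e.symm ((σ m).range.equivFin.symm i : Eu d),
      fun i x => (((volume : Measure (Eu d)).restrict Kz).real
        (σ m ⁻¹' {((σ m).range.equivFin.symm i : Eu d)}) *
        chartExt e ρ ((σ m).range.equivFin.symm i : Eu d)) *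
        (χ x * ((ε ^ d)⁻¹ *
          η.normed volume (ε⁻¹ • (e x - ((σ m).range.equivFin.symm i : Eu d))))),
      fun i => contMDiff_const.mul (hA.contMDiff (Set.mem_univ _)), fun f y => ?_⟩
    unfold mollifySum
    have := integral_comp_simpleFunc (σ m) ((volume : Measure (Eu d)).restrict Kz)
      (fun z => chartExt e (fun x => ρ x * f x) z *
        (χ y * ((ε ^ d)⁻¹ * η.normed volume (ε⁻¹ • (e y - z)))))
    rw [← hKzdef, this, ← Finset.sum_coe_sort,
      ← ((σ m).range.equivFin.symm).sum_comp]
    refine Finset.sum_congr rfl fun i _ => ?_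
    -- A node outside `e.target`, where `e.symm` has no meaning, does no harm: its weight is zero.
    have hc : ∀ z, chartExt e (fun x => ρ x * f x) z = f (e.symm z) * chartExt e ρ z := by
      intro z
      by_cases hz : z ∈ e.target
      · simp only [chartExt, Set.indicator_of_mem hz]; ring
      · simp only [chartExt, Set.indicator_of_notMem hz]; ring
    rw [hc]
    ring
  have hsm : ∀ f, ContMDiff (𝓡 d) 𝓘(ℝ, ℝ) ∞ f →
      ContMDiff (𝓡 d) 𝓘(ℝ, ℝ) ∞ (mollify e ρ χ η ε f) := by
    intro f hf
    have h1 := smoothFamily_mul_comp_chart he hχ hχs (contDiff_integral_bump_mul η (hext f hf))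
    exact h1.contMDiff (Set.mem_univ ε)
  refine ⟨fun m => mollifySum e ρ χ η ε (σ m), hfr, ?_, fun f hf => hsm f hf, ?_, ?_⟩
  · intro m f hf
    obtain ⟨ι, _, x, a, ha, hT⟩ := hfr m
    have : mollifySum e ρ χ η ε (σ m) f = fun y => ∑ i, f (x i) * a i y := funext (hT f)
    rw [this]
    exact contMDiff_finsetSum fun i _ => contMDiff_const.mul (ha i)
  · intro f hf
    have h1 : mollify e ρ χ η ε f = fun x => mollifySum e ρ χ η ε id f x :=
      funext fun x => mollify_eq_integral e ρ χ η hε f x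
    rw [h1]
    refine (hH f hf).tendstoSmooth_integral (hKz) (fun z hz x => ?_)
      ((volume : Measure (Eu d)).restrict Kz) (fun m => (σ m).measurable) hσlim
    rw [chartExt_eq_zero (fun hz' => hz (Set.image_mono
      (closure_mono (Function.support_mul_subset_left ρ f)) hz')), zero_mul]
  · obtain ⟨Cρ, hCρ0, hCρ⟩ := exists_bound_of_contMDiff hρ
    obtain ⟨Cχ, hCχ0, hCχ⟩ := exists_bound_of_contMDiff hχ
    obtain ⟨Cη, hCη⟩ := (η.hasCompactSupport_normed (μ := volume)).exists_bound_of_continuous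
      η.continuous_normed
    have hCη0 : 0 ≤ Cη := (norm_nonneg _).trans (hCη 0)
    refine ⟨Cρ * (Cχ * ((ε ^ d)⁻¹ * Cη)) * ((volume : Measure (Eu d)).restrict Kz).real Set.univ,
      fun m f B hB x => ?_⟩
    have hB0 : 0 ≤ B := (abs_nonneg _).trans (hB x)
    have h1 : ∀ y, |ρ y * f y| ≤ Cρ * B := fun y => by
      rw [abs_mul]; exact mul_le_mul (hCρ y) (hB y) (abs_nonneg _) hCρ0
    have h2 := norm_integral_le_of_norm_le_const (μ := (volume : Measure (Eu d)).restrict Kz)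
      (f := fun z => chartExt e (fun x => ρ x * f x) (σ m z) *
        (χ x * ((ε ^ d)⁻¹ * η.normed volume (ε⁻¹ • (e x - σ m z)))))
      (C := (Cρ * B) * (Cχ * ((ε ^ d)⁻¹ * Cη))) (ae_of_all _ fun z => by
        rw [norm_mul, norm_mul, norm_mul, norm_inv, norm_pow, Real.norm_of_nonneg hε.le]
        gcongr
        · exact abs_chartExt_le h1 (by positivity) _
        · exact hCχ x
        · exact hCη _)
    refine (Real.norm_eq_abs _ ▸ h2).trans_eq ?_
    ring

/-- Multiplication by `ρ` is the mollification at scale `0`, and each positive scale is a limit of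
finite-rank operators. Leaving the limit iterated avoids a diagonal extraction; the supremum bound
of the outer limit is uniform since the bump has integral `1`. -/
theorem seqClosure_mul [T2Space M] [CompactSpace M] {e : OpenPartialHomeomorph M (Eu d)}
    (he : e ∈ atlas (Eu d) M) {ρ : M → ℝ} (hρ : ContMDiff (𝓡 d) 𝓘(ℝ, ℝ) ∞ ρ)
    (hρs : tsupport ρ ⊆ e.source) :
    SeqClosure d (SeqClosure d (IsFiniteRank (d := d))) (fun (f : M → ℝ) x => ρ x * f x) := by
  obtain ⟨V, hVo, hρV, hVs⟩ := normal_exists_closure_subset (isClosed_tsupport ρ) e.open_source hρs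
  obtain ⟨χ, hχ1, hχ0, -⟩ := exists_contMDiffMap_one_nhds_of_subset_interior (𝓡 d) (n := ⊤)
    (isClosed_tsupport ρ) (t := V) (by rwa [hVo.interior_eq])
  have hχs : tsupport χ ⊆ e.source := by
    refine (closure_mono ?_).trans hVs
    intro x hx
    by_contra h
    exact hx (hχ0 x h)
  have hχ1' : ∀ x ∈ tsupport ρ, χ x = 1 := fun x hx => hχ1.self_of_nhdsSet x hx
  let η : ContDiffBump (0 : Eu d) := ⟨1, 2, one_pos, one_lt_two⟩
  have hε : ∀ i : ℕ, (0 : ℝ) < 1 / ((i : ℝ) + 1) := fun i => by positivity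
  have hext : ∀ f, ContMDiff (𝓡 d) 𝓘(ℝ, ℝ) ∞ f →
      ContDiff ℝ ∞ (chartExt e fun x => ρ x * f x) := fun f hf =>
    contDiff_chartExt he (hρ.mul hf) (tsupport_mul_subset hρs)
  have hfam : ∀ f, ContMDiff (𝓡 d) 𝓘(ℝ, ℝ) ∞ f →
      SmoothFamily (d := d) (Set.univ : Set ℝ) (fun ε => mollify e ρ χ η ε f) := fun f hf =>
    smoothFamily_mul_comp_chart he χ.contMDiff hχs (contDiff_integral_bump_mul η (hext f hf))
  refine ⟨fun i => mollify e ρ χ η (1 / ((i : ℝ) + 1)),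
    fun i => seqClosure_mollify he hρ χ.contMDiff hρs hχs η (hε i),
    fun i f hf => (hfam f hf).contMDiff (Set.mem_univ _), fun f hf => hρ.mul hf, fun f hf => ?_, ?_⟩
  · have h0 : mollify e ρ χ η 0 f = fun x => ρ x * f x := by
      ext x
      simp only [mollify, zero_smul, sub_zero]
      rw [integral_mul_const, η.integral_normed, one_mul]
      by_cases hx : x ∈ tsupport ρ
      · rw [chartExt_apply (hρs hx), hχ1' x hx, one_mul]
      · rw [image_eq_zero_of_notMem_tsupport hx, zero_mul]
        by_cases hxs : x ∈ e.source
        · rw [chartExt_apply hxs, image_eq_zero_of_notMem_tsupport hx]; simp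
        · rw [image_eq_zero_of_notMem_tsupport (fun h => hxs (hχs h)), zero_mul]
    rw [← h0]
    exact (hfam f hf).tendstoSmooth isOpen_univ (Set.mem_univ 0)
      tendsto_one_div_add_atTop_nhds_zero_nat
  · obtain ⟨Cρ, hCρ0, hCρ⟩ := exists_bound_of_contMDiff hρ
    obtain ⟨Cχ, hCχ0, hCχ⟩ := exists_bound_of_contMDiff χ.contMDiff
    refine ⟨Cχ * Cρ, fun i f B hB x => ?_⟩
    have hB0 : 0 ≤ B := (abs_nonneg _).trans (hB x)
    have h1 : ∀ y, |ρ y * f y| ≤ Cρ * B := fun y => by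
      rw [abs_mul]; exact mul_le_mul (hCρ y) (hB y) (abs_nonneg _) hCρ0
    unfold mollify
    rw [abs_mul, mul_assoc]
    refine mul_le_mul (hCχ x) ?_ (abs_nonneg _) hCχ0
    have h2 := norm_integral_le_of_norm_le (μ := (volume : Measure (Eu d)))
      (f := fun w => η.normed volume w *
        chartExt e (fun x => ρ x * f x) (e x - (1 / ((i : ℝ) + 1)) • w))
      (g := fun w => η.normed volume w * (Cρ * B)) (η.integrable_normed.mul_const _)
      (ae_of_all _ fun w => by
        rw [norm_mul, Real.norm_of_nonneg (η.nonneg_normed w)]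
        exact mul_le_mul_of_nonneg_left (abs_chartExt_le h1 (by positivity) _) (η.nonneg_normed w))
    rw [integral_mul_const, η.integral_normed, one_mul] at h2
    exact h2

/-- The identity of `C^∞(M)` is an iterated limit of operators of finite rank. -/
theorem seqClosure_id [T2Space M] [CompactSpace M] :
    SeqClosure d (SeqClosure d (IsFiniteRank (d := d))) (fun (f : M → ℝ) x => f x) := by
  obtain ⟨ρ, hρ⟩ := SmoothPartitionOfUnity.exists_isSubordinate_chartAt_source (𝓡 d) M
  have hfin : {i | (Function.support (ρ i)).Nonempty}.Finite :=
    ρ.locallyFinite.finite_nonempty_of_compact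
  have key : ∀ s : Finset M, SeqClosure d (SeqClosure d (IsFiniteRank (d := d)))
      (fun (f : M → ℝ) x => ∑ i ∈ s, ρ i x * f x) := by
    classical
    intro s
    induction s using Finset.induction_on with
    | empty =>
      simp only [Finset.sum_empty]
      exact SeqClosure.zero (SeqClosure.zero isFiniteRank_zero)
    | insert i s hi ih =>
      simp only [Finset.sum_insert hi]
      exact SeqClosure.add
        (fun T T' h h' => SeqClosure.add (fun T T' h h' => IsFiniteRank.add h h') h h')
        (seqClosure_mul (chart_mem_atlas (Eu d) i) (ρ i).contMDiff (hρ i)) ih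
  have hone : ∀ x, ∑ i ∈ hfin.toFinset, ρ i x = 1 := by
    intro x
    rw [← ρ.sum_eq_one (Set.mem_univ x), finsum_eq_sum_of_support_subset]
    intro i hi
    rw [Set.Finite.coe_toFinset]
    exact ⟨x, hi⟩
  have h := key hfin.toFinset
  simp only [← Finset.sum_mul, hone, one_mul] at h
  exact h

end Approximation


/-! ### White noise: linear and quadratic functionals -/

section WhiteNoiseEstimates

set_option linter.unusedSectionVars false

variable {d : ℕ} {M : Type*} [TopologicalSpace M] [ChartedSpace (Eu d) M]

theorem measurable_toLin (φ : TestFun d M) : Measurable fun u : Distrib d M => u.toLin φ :=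
  Measurable.of_comap_le (le_iSup (fun φ : TestFun d M =>
    MeasurableSpace.comap (fun u : Distrib d M => u.toLin φ) inferInstance) φ)

variable [IsManifold (𝓡 d) ∞ M] [CompactSpace M] [MeasurableSpace M] [BorelSpace M]
  {g : Metric d M} {μ : Measure (Distrib d M)}

theorem IsWhiteNoiseLaw.isProbabilityMeasure (hμ : IsWhiteNoiseLaw g μ) :
    IsProbabilityMeasure μ := hμ.gaussian.isProbabilityMeasure

theorem IsWhiteNoiseLaw.map_eq (hμ : IsWhiteNoiseLaw g μ) (φ : TestFun d M) :
    μ.map (fun u => u.toLin φ) = gaussianReal 0 (∫ x, (φ x) ^ 2 ∂(vol g)).toNNReal := by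
  have h := (hμ.gaussian.hasGaussianLaw_eval φ).map_eq_gaussianReal
  rw [hμ.centered φ, variance_of_integral_eq_zero (measurable_toLin φ).aemeasurable
    (hμ.centered φ)] at h
  rw [h, ← hμ.variance φ]

theorem integrable_of_continuous (ν : Measure M) [IsFiniteMeasure ν] {f : M → ℝ}
    (hf : Continuous f) : Integrable f ν :=
  hf.integrable_of_hasCompactSupport (HasCompactSupport.of_compactSpace f)

/-- The Gaussian moment generating function at `± 1 / s` is `exp (v / (2 s²))`, which is at most `e`
when the variance `v` is at most `s²`. -/
theorem IsWhiteNoiseLaw.lintegral_exp_le (hμ : IsWhiteNoiseLaw g μ) (φ : TestFun d M) {s : ℝ}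
    (hs : 0 < s) (h : ∫ x, (φ x) ^ 2 ∂(vol g) ≤ s ^ 2) :
    ∫⁻ u, ENNReal.ofReal (Real.exp (|u.toLin φ| / s)) ∂μ ≤ ENNReal.ofReal (2 * Real.exp 1) := by
  have hm := measurable_toLin φ
  set v := (∫ x, (φ x) ^ 2 ∂(vol g)).toNNReal with hv
  have hv' : (v : ℝ) ≤ s ^ 2 := by
    rw [hv, Real.coe_toNNReal _ (integral_nonneg fun x => sq_nonneg _)]; exact h
  have key : ∀ t : ℝ, t ^ 2 = (1 / s) ^ 2 →
      ∫⁻ u, ENNReal.ofReal (Real.exp (t * u.toLin φ)) ∂μ ≤ ENNReal.ofReal (Real.exp 1) := by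
    intro t ht
    have h1 : ∫⁻ u, ENNReal.ofReal (Real.exp (t * u.toLin φ)) ∂μ =
        ∫⁻ x, ENNReal.ofReal (Real.exp (t * x)) ∂(gaussianReal 0 v) := by
      rw [hv, ← hμ.map_eq φ, lintegral_map (by fun_prop) hm]
    rw [h1, ← ofReal_integral_eq_lintegral_ofReal (integrable_exp_mul_gaussianReal t)
      (ae_of_all _ fun x => (Real.exp_pos _).le)]
    refine ENNReal.ofReal_le_ofReal ?_
    have h2 := congrFun (mgf_id_gaussianReal (μ := 0) (v := v)) t
    simp only [mgf, id] at h2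
    rw [h2, Real.exp_le_exp, ht, zero_mul, zero_add, div_pow, one_pow]
    rw [mul_one_div, div_div, div_le_one (by positivity)]
    nlinarith [sq_nonneg s]
  have hsum : (2 * Real.exp 1) = Real.exp 1 + Real.exp 1 := by ring
  rw [hsum, ENNReal.ofReal_add (by positivity) (by positivity)]
  refine le_trans ?_ (add_le_add (key (1 / s) rfl) (key (-(1 / s)) (by ring)))
  rw [← lintegral_add_left (by fun_prop)]
  refine lintegral_mono fun u => ?_
  rw [← ENNReal.ofReal_add (by positivity) (by positivity)]
  refine ENNReal.ofReal_le_ofReal ?_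
  rcases abs_cases (u.toLin φ) with ⟨hx, -⟩ | ⟨hx, -⟩
  · rw [hx, div_eq_inv_mul, one_div]
    exact le_add_of_nonneg_right (Real.exp_pos _).le
  · rw [hx, neg_div, div_eq_inv_mul, one_div, ← neg_mul]
    exact le_add_of_nonneg_left (Real.exp_pos _).le

/-- The Gram matrix in `L²(M)`. -/
noncomputable def gram (ν : Measure M) {κ : Type*} (c : κ → TestFun d M) : Matrix κ κ ℝ :=
  Matrix.of fun p q => ∫ x, c p x * c q x ∂ν

open Matrix in
theorem dotProduct_gram_mulVec (ν : Measure M) [IsFiniteMeasure ν] {κ : Type*} [Fintype κ]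
    (c : κ → TestFun d M) (t : κ → ℝ) :
    t ⬝ᵥ gram ν c *ᵥ t = ∫ x, (∑ p, t p * c p x) ^ 2 ∂ν := by
  have h : ∀ x, (∑ p, t p * c p x) ^ 2 = ∑ p, ∑ q, (t p * t q) * (c p x * c q x) := by
    intro x
    rw [sq, Finset.sum_mul_sum]
    exact Finset.sum_congr rfl fun p _ => Finset.sum_congr rfl fun q _ => by ring
  have hi : ∀ p q, Integrable (fun x => (t p * t q) * (c p x * c q x)) ν := fun p q =>
    (integrable_of_continuous ν
      ((c p).contMDiff.continuous.mul (c q).contMDiff.continuous)).const_mul _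
  simp only [h]
  rw [integral_finsetSum _ fun p _ => integrable_finsetSum _ fun q _ => hi p q]
  simp only [dotProduct, mulVec, gram, of_apply, Finset.mul_sum]
  refine Finset.sum_congr rfl fun p _ => ?_
  rw [integral_finsetSum _ fun q _ => hi p q]
  refine Finset.sum_congr rfl fun q _ => ?_
  rw [integral_const_mul]
  ring

theorem posSemidef_gram (ν : Measure M) [IsFiniteMeasure ν] {κ : Type*} [Fintype κ]
    (c : κ → TestFun d M) : (gram ν c).PosSemidef := by
  refine Matrix.PosSemidef.of_dotProduct_mulVec_nonneg ?_ fun t => ?_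
  · ext p q
    simp only [gram, Matrix.conjTranspose_apply, Matrix.of_apply, star_trivial]
    simp_rw [mul_comm]
  · rw [star_trivial, dotProduct_gram_mulVec]
    exact integral_nonneg fun x => sq_nonneg _

/-- `X` is a functional of second order with kernel `k`: it is measurable, and exponentially
integrable around `∫ k(x, x) dx` at the scale of the `L²`-norm of `k`. -/
structure IsQuadraticFunctional (ν : Measure M) (μ : Measure (Distrib d M)) (X : Distrib d M → ℝ)
    (k : M → M → ℝ) : Prop where
  measurable : Measurable X
  measurable_kernel : Measurable (Function.uncurry k)
  lintegral_exp_le : ∀ s : ℝ, 0 < s → ∫ x, ∫ y, (k x y) ^ 2 ∂ν ∂ν < s ^ 2 →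
    ∫⁻ u, ENNReal.ofReal (Real.exp (|X u - ∫ x, k x x ∂ν| / (4 * s))) ∂μ ≤
      ENNReal.ofReal (2 * Real.exp (1 / 8))

/-- The pairings with the `c p` form a Gaussian vector whose covariance is their Gram matrix `C`.
With it, `tr (A C)` is the integral of the kernel over the diagonal and `tr (A C Aᵀ C)` is its
squared `L²`-norm. -/
theorem isQuadraticFunctional_sum [IsFiniteMeasure (vol g)] (hμ : IsWhiteNoiseLaw g μ)
    {κ : Type*} [Fintype κ] [DecidableEq κ] (c : κ → TestFun d M) (A : Matrix κ κ ℝ) :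
    IsQuadraticFunctional (vol g) μ
      (fun u => ∑ p, ∑ q, A p q * (u.toLin (c p) * u.toLin (c q)))
      (fun x y => ∑ p, ∑ q, A p q * (c p x * c q y)) where
  measurable := by
    have := fun p => measurable_toLin (c p)
    fun_prop
  measurable_kernel := by
    have h : ∀ p, Measurable (c p) := fun p => (c p).contMDiff.continuous.measurable
    have h1 : ∀ p, Measurable fun z : M × M => c p z.1 := fun p => (h p).comp measurable_fst
    have h2 : ∀ p, Measurable fun z : M × M => c p z.2 := fun p => (h p).comp measurable_snd
    simp only [Function.uncurry_def]
    fun_prop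
  lintegral_exp_le := by
    intro s hs hlt
    have := hμ.isProbabilityMeasure
    have hci : ∀ p q, Integrable (fun x => c p x * c q x) (vol g) := fun p q =>
      integrable_of_continuous _ ((c p).contMDiff.continuous.mul (c q).contMDiff.continuous)
    have htr : ∫ x, ∑ p, ∑ q, A p q * (c p x * c q x) ∂(vol g) = (A * gram (vol g) c).trace := by
      have h0 : ∀ p q, Integrable (fun x => A p q * (c p x * c q x)) (vol g) := fun p q =>
        (hci p q).const_mul _
      rw [integral_finsetSum _ fun p _ => integrable_finsetSum _ fun q _ => h0 p q]
      simp only [Matrix.trace, Matrix.diag, Matrix.mul_apply]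
      refine Finset.sum_congr rfl fun p _ => ?_
      rw [integral_finsetSum _ fun q _ => h0 p q]
      refine Finset.sum_congr rfl fun q _ => ?_
      rw [integral_const_mul, gram, Matrix.of_apply]
      simp_rw [mul_comm (c q _)]
    have hsq : ∫ x, ∫ y, (∑ p, ∑ q, A p q * (c p x * c q y)) ^ 2 ∂(vol g) ∂(vol g) =
        (A * gram (vol g) c * A.transpose * gram (vol g) c).trace := by
      have h1 : ∀ x y, (∑ p, ∑ q, A p q * (c p x * c q y)) ^ 2 =
          ∑ p, ∑ r, ∑ q, ∑ l, (A p q * A r l * (c p x * c r x)) * (c q y * c l y) := by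
        intro x y
        rw [sq, Finset.sum_mul_sum]
        refine Finset.sum_congr rfl fun p _ => Finset.sum_congr rfl fun r _ => ?_
        rw [Finset.sum_mul_sum]
        exact Finset.sum_congr rfl fun q _ => Finset.sum_congr rfl fun l _ => by ring
      have h2 : ∀ x, ∫ y, (∑ p, ∑ q, A p q * (c p x * c q y)) ^ 2 ∂(vol g) =
          ∑ p, ∑ r, ∑ q, ∑ l, (A p q * A r l * gram (vol g) c q l) * (c p x * c r x) := by
        intro x
        simp only [h1]
        rw [integral_finsetSum _ fun p _ => integrable_finsetSum _ fun r _ =>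
          integrable_finsetSum _ fun q _ => integrable_finsetSum _ fun l _ => (hci q l).const_mul _]
        refine Finset.sum_congr rfl fun p _ => ?_
        rw [integral_finsetSum _ fun r _ =>
          integrable_finsetSum _ fun q _ => integrable_finsetSum _ fun l _ => (hci q l).const_mul _]
        refine Finset.sum_congr rfl fun r _ => ?_
        rw [integral_finsetSum _ fun q _ =>
          integrable_finsetSum _ fun l _ => (hci q l).const_mul _]
        refine Finset.sum_congr rfl fun q _ => ?_
        rw [integral_finsetSum _ fun l _ => (hci q l).const_mul _]
        refine Finset.sum_congr rfl fun l _ => ?_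
        rw [integral_const_mul, gram, Matrix.of_apply]
        ring
      simp only [h2]
      rw [integral_finsetSum _ fun p _ => integrable_finsetSum _ fun r _ =>
          integrable_finsetSum _ fun q _ => integrable_finsetSum _ fun l _ => (hci p r).const_mul _]
      simp only [Matrix.trace, Matrix.diag, Matrix.mul_apply, Finset.sum_mul]
      refine Finset.sum_congr rfl fun p _ => ?_
      rw [integral_finsetSum _ fun r _ =>
          integrable_finsetSum _ fun q _ => integrable_finsetSum _ fun l _ => (hci p r).const_mul _]
      refine Finset.sum_congr rfl fun r _ => ?_
      rw [integral_finsetSum _ fun q _ =>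
          integrable_finsetSum _ fun l _ => (hci p r).const_mul _, Finset.sum_comm]
      refine Finset.sum_congr rfl fun q _ => ?_
      rw [integral_finsetSum _ fun l _ => (hci p r).const_mul _]
      refine Finset.sum_congr rfl fun l _ => ?_
      rw [integral_const_mul, Matrix.transpose_apply]
      have : ∫ x, c p x * c r x ∂(vol g) = gram (vol g) c r p := by
        rw [gram, Matrix.of_apply]; simp_rw [mul_comm]
      rw [this]
      ring
    rw [htr]
    refine lintegral_exp_abs_quadratic_le (μ := μ) (ξ := fun p u => u.toLin (c p))
      (fun p => measurable_toLin (c p)) (posSemidef_gram (vol g) c) (fun t => ?_) A hs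
      (hsq ▸ hlt.le)
    -- A linear combination is the pairing with a single test function, so its law is given by
    -- `map_eq`.
    have h1 : (fun u : Distrib d M => ∑ p, t p * u.toLin (c p)) =
        fun u => u.toLin (∑ p, t p • c p) := by
      ext u
      simp [map_sum]
    rw [h1, hμ.map_eq, dotProduct_gram_mulVec]
    congr 3
    ext x
    congr 1
    exact (map_sum (ContMDiffMap.evalRingHom x) (fun p => t p • c p) Finset.univ)

/-- Fatou's lemma for the exponential moment. The uniform bound on the kernels gives convergence of
their diagonal integrals and of their `L²`-norms by dominated convergence. -/
theorem IsQuadraticFunctional.of_tendsto {ν : Measure M} [IsFiniteMeasure ν]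
    {X : ℕ → Distrib d M → ℝ} {k : ℕ → M → M → ℝ}
    (h : ∀ m, IsQuadraticFunctional ν μ (X m) (k m)) {Y : Distrib d M → ℝ} {l : M → M → ℝ}
    (hX : ∀ u, Tendsto (fun m => X m u) atTop (𝓝 (Y u)))
    (hk : ∀ x y, Tendsto (fun m => k m x y) atTop (𝓝 (l x y))) {B : ℝ}
    (hB : ∀ m x y, |k m x y| ≤ B) : IsQuadraticFunctional ν μ Y l := by
  have hlm : Measurable (Function.uncurry l) :=
    measurable_of_tendsto_metrizable (fun m => (h m).measurable_kernel)
      (tendsto_pi_nhds.2 fun z => hk z.1 z.2)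
  refine ⟨measurable_of_tendsto_metrizable (fun m => (h m).measurable) (tendsto_pi_nhds.2 hX),
    hlm, fun s hs hlt => ?_⟩
  have hsec : ∀ m x, Measurable fun y => (k m x y) ^ 2 := fun m x =>
    ((h m).measurable_kernel.comp measurable_prodMk_left).pow_const 2
  have hsq : ∀ m x y, ‖(k m x y) ^ 2‖ ≤ B ^ 2 := fun m x y => by
    rw [norm_pow, Real.norm_eq_abs]
    exact pow_le_pow_left₀ (abs_nonneg _) (hB m x y) 2
  have h2 : Tendsto (fun m => ∫ x, ∫ y, (k m x y) ^ 2 ∂ν ∂ν) atTop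
      (𝓝 (∫ x, ∫ y, (l x y) ^ 2 ∂ν ∂ν)) := by
    refine tendsto_integral_of_dominated_convergence (fun _ => B ^ 2 * ν.real Set.univ) ?_
      (integrable_const _) ?_ ?_
    · intro m
      have : StronglyMeasurable (Function.uncurry fun x y => (k m x y) ^ 2) :=
        ((h m).measurable_kernel.pow_const 2).stronglyMeasurable
      exact this.integral_prod_right.aestronglyMeasurable
    · exact fun m => ae_of_all _ fun x =>
        norm_integral_le_of_norm_le_const (ae_of_all _ fun y => hsq m x y)
    · refine ae_of_all _ fun x => ?_
      exact tendsto_integral_of_dominated_convergence (fun _ => B ^ 2)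
        (fun m => (hsec m x).aestronglyMeasurable) (integrable_const _)
        (fun m => ae_of_all _ fun y => hsq m x y) (ae_of_all _ fun y => (hk x y).pow 2)
  have h1 : Tendsto (fun m => ∫ x, k m x x ∂ν) atTop (𝓝 (∫ x, l x x ∂ν)) :=
    tendsto_integral_of_dominated_convergence (fun _ => B)
      (fun m => ((h m).measurable_kernel.comp
        (measurable_id.prodMk measurable_id)).aestronglyMeasurable) (integrable_const _)
      (fun m => ae_of_all _ fun x => hB m x x) (ae_of_all _ fun x => hk x x)
  have hlim : ∀ u, Tendsto
      (fun m => ENNReal.ofReal (Real.exp (|X m u - ∫ x, k m x x ∂ν| / (4 * s)))) atTop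
      (𝓝 (ENNReal.ofReal (Real.exp (|Y u - ∫ x, l x x ∂ν| / (4 * s))))) := fun u =>
    ENNReal.tendsto_ofReal ((Real.continuous_exp.tendsto _).comp
      ((((hX u).sub h1).abs).div_const _))
  calc ∫⁻ u, ENNReal.ofReal (Real.exp (|Y u - ∫ x, l x x ∂ν| / (4 * s))) ∂μ
      = ∫⁻ u, liminf (fun m => ENNReal.ofReal
          (Real.exp (|X m u - ∫ x, k m x x ∂ν| / (4 * s)))) atTop ∂μ :=
        lintegral_congr fun u => (hlim u).liminf_eq.symm
    _ ≤ liminf (fun m => ∫⁻ u, ENNReal.ofReal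
          (Real.exp (|X m u - ∫ x, k m x x ∂ν| / (4 * s))) ∂μ) atTop := by
        refine lintegral_liminf_le fun m => ?_
        have := (h m).measurable
        fun_prop
    _ ≤ ENNReal.ofReal (2 * Real.exp (1 / 8)) := by
        refine liminf_le_of_frequently_le' (Eventually.frequently ?_)
        -- The strict inequality in `IsQuadraticFunctional` is what passes from the limit kernel to
        -- the approximating ones.
        filter_upwards [h2.eventually_lt_const hlt] with m hm
        exact (h m).lintegral_exp_le s hs hm

/-- `(u, S (x ↦ (u, K(x, ·))))`. -/
noncomputable def opPair (K : M → M → ℝ) (S : (M → ℝ) → M → ℝ) (u : Distrib d M) : ℝ :=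
  pair u (S fun x => pair u (K x))

theorem SmoothTwo.exists_bound {K : M → M → ℝ} (hK : SmoothTwo (d := d) K) :
    ∃ B : ℝ, ∀ x y, |K x y| ≤ B := by
  have hc : Continuous (Function.uncurry K) := by
    rw [continuous_iff_continuousAt]
    rintro ⟨x, y⟩
    have h1 := (hK _ (chart_mem_atlas (Eu d) x) _ (chart_mem_atlas (Eu d) y)).continuousOn
      |>.continuousAt (((chartAt (Eu d) x).open_target.prod (chartAt (Eu d) y).open_target).mem_nhds
        (x := (chartAt (Eu d) x x, chartAt (Eu d) y y)) ⟨mem_chart_target _ _, mem_chart_target _ _⟩)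
    have h2 : ContinuousAt (fun z : M × M => (chartAt (Eu d) x z.1, chartAt (Eu d) y z.2)) (x, y) :=
      (((chartAt (Eu d) x).continuousAt (mem_chart_source _ x)).comp continuousAt_fst).prodMk
        (((chartAt (Eu d) y).continuousAt (mem_chart_source _ y)).comp continuousAt_snd)
    refine (ContinuousAt.comp (x := (x, y)) h1 h2).congr ?_
    filter_upwards [((chartAt (Eu d) x).open_source.prod (chartAt (Eu d) y).open_source).mem_nhds
      (x := (x, y)) ⟨mem_chart_source _ x, mem_chart_source _ y⟩] with z hz
    simp only [Function.comp_apply, Function.uncurry]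
    rw [(chartAt (Eu d) x).left_inv hz.1, (chartAt (Eu d) y).left_inv hz.2]
  obtain ⟨B, hB⟩ := isCompact_univ.exists_bound_of_continuousOn hc.continuousOn
  exact ⟨B, fun x y => hB (x, y) (Set.mem_univ _)⟩

theorem SmoothTwo.contMDiff_left {k : M → M → ℝ} (hk : SmoothTwo (d := d) k) (y : M) :
    ContMDiff (𝓡 d) 𝓘(ℝ, ℝ) ∞ (fun x => k x y) := hk.swap.contMDiff_right y

theorem isQuadraticFunctional_finiteRank [IsFiniteMeasure (vol g)] (hμ : IsWhiteNoiseLaw g μ)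
    {K : M → M → ℝ} (hK : SmoothTwo (d := d) K) {S : (M → ℝ) → M → ℝ}
    (hS : IsFiniteRank (d := d) S) :
    IsQuadraticFunctional (vol g) μ (opPair (d := d) K S) (fun x y => S (fun z => K z y) x) := by
  classical
  obtain ⟨ι, _, z, a, ha, hT⟩ := hS
  have h := isQuadraticFunctional_sum hμ
    (Sum.elim (fun i => toTestFun (a i) (ha i)) fun i => toTestFun (K (z i)) (hK.contMDiff_right _))
    -- The functional is `∑ (u, a_i) (u, K(z_i, ·))`: an off-diagonal block pairing each `a_i` with
    -- its own `K(z_i, ·)`.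
    (Matrix.fromBlocks 0 (1 : Matrix ι ι ℝ) 0 0)
  have h1 : ∀ v w : ι ⊕ ι → ℝ, ∑ p, ∑ q, Matrix.fromBlocks 0 (1 : Matrix ι ι ℝ) 0 0 p q * (v p * w q)
      = ∑ i, v (Sum.inl i) * w (Sum.inr i) := by
    intro v w
    simp [Fintype.sum_sum_type, Matrix.one_apply]
  convert h using 1
  · ext u
    rw [h1 (fun p => u.toLin _) (fun q => u.toLin _), opPair]
    have : (S fun x => pair u (K x)) = fun y => ∑ i, pair u (K (z i)) * a i y :=
      funext fun y => hT _ y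
    rw [this, pair_sum u _ _ fun i _ => ha i]
    refine Finset.sum_congr rfl fun i _ => ?_
    simp only [Sum.elim_inl, Sum.elim_inr]
    rw [pair_of_contMDiff u (ha i), pair_of_contMDiff u (hK.contMDiff_right (z i)), mul_comm]
  · ext x y
    rw [h1 (fun p => (Sum.elim _ _ p : TestFun d M) x) (fun q => (Sum.elim _ _ q : TestFun d M) y),
      hT]
    refine Finset.sum_congr rfl fun i _ => ?_
    simp only [Sum.elim_inl, Sum.elim_inr, coe_toTestFun]
    rw [mul_comm]

/-- Strong convergence of the operators is used twice: on `x ↦ (u, K(x, ·))` for the functionals,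
and on `x ↦ K(x, y)` for the kernels. The class `𝒞` is arbitrary so that the step can be iterated.
-/
theorem isQuadraticFunctional_seqClosure [IsFiniteMeasure (vol g)] {K : M → M → ℝ}
    (hK : SmoothTwo (d := d) K) {𝒞 : ((M → ℝ) → M → ℝ) → Prop}
    (h𝒞 : ∀ T, 𝒞 T → IsQuadraticFunctional (vol g) μ (opPair (d := d) K T)
      (fun x y => T (fun z => K z y) x)) {S : (M → ℝ) → M → ℝ} (hS : SeqClosure d 𝒞 S) :
    IsQuadraticFunctional (vol g) μ (opPair (d := d) K S) (fun x y => S (fun z => K z y) x) := by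
  obtain ⟨T, hT, hTS⟩ := hS
  obtain ⟨C, hC⟩ := hTS.bounded
  obtain ⟨B, hB⟩ := hK.exists_bound
  refine IsQuadraticFunctional.of_tendsto (fun m => h𝒞 _ (hT m)) (fun u => ?_) (fun x y => ?_)
    (B := C * B) fun m x y => hC m _ B (fun z => hB z y) x
  · exact tendsto_pair u (Eventually.of_forall fun m => hTS.smooth m _ (hK.contMDiff_pair u))
      (hTS.smooth_lim _ (hK.contMDiff_pair u)) (hTS.tendsto _ (hK.contMDiff_pair u))
  · exact (hTS.tendsto _ (hK.contMDiff_left y)).tendsto_apply x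

theorem isQuadraticFunctional_pair [T2Space M] [IsFiniteMeasure (vol g)]
    (hμ : IsWhiteNoiseLaw g μ) {K : M → M → ℝ} (hK : SmoothTwo (d := d) K) :
    IsQuadraticFunctional (vol g) μ (fun u => pair u fun x => pair u (K x)) K :=
  isQuadraticFunctional_seqClosure hK
    (fun _ hT => isQuadraticFunctional_seqClosure hK
      (fun _ hT' => isQuadraticFunctional_finiteRank hμ hK hT') hT) seqClosure_id

end WhiteNoiseEstimates


/-! ### The divergence under a change of variables -/

section Jacobi

variable {d : ℕ}

/-- The trace of an endomorphism of `ℝ^d`. -/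
noncomputable def tr (L : Eu d →L[ℝ] Eu d) : ℝ := LinearMap.trace ℝ (Eu d) L

theorem toMatrix_eq (L : Eu d →L[ℝ] Eu d) :
    LinearMap.toMatrix (EuclideanSpace.basisFun (Fin d) ℝ).toBasis
      (EuclideanSpace.basisFun (Fin d) ℝ).toBasis (L : Eu d →ₗ[ℝ] Eu d) =
      Matrix.of fun i j => L (stdVec j) i := by
  ext i j
  simp [LinearMap.toMatrix_apply, stdVec]

theorem tr_eq_sum (L : Eu d →L[ℝ] Eu d) : tr L = ∑ i, L (stdVec i) i := by
  rw [tr, LinearMap.trace_eq_matrix_trace ℝ (EuclideanSpace.basisFun (Fin d) ℝ).toBasis,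
    toMatrix_eq]
  rfl

theorem det_eq_matrix_det (L : Eu d →L[ℝ] Eu d) :
    L.det = (Matrix.of fun i j => L (stdVec j) i : Matrix (Fin d) (Fin d) ℝ).det := by
  rw [← toMatrix_eq, LinearMap.det_toMatrix]

theorem tr_add (L L' : Eu d →L[ℝ] Eu d) : tr (L + L') = tr L + tr L' := by simp [tr]

theorem tr_smul (c : ℝ) (L : Eu d →L[ℝ] Eu d) : tr (c • L) = c * tr L := by simp [tr]

theorem tr_comp_comm (L L' : Eu d →L[ℝ] Eu d) : tr (L ∘L L') = tr (L' ∘L L) :=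
  LinearMap.trace_comp_comm' _ _

theorem eq_sum_stdVec (v : Eu d) : v = ∑ i, v i • stdVec i := by
  conv_lhs => rw [← (EuclideanSpace.basisFun (Fin d) ℝ).sum_repr v]
  simp [stdVec]

theorem tr_smulRight (l : Eu d →L[ℝ] ℝ) (v : Eu d) : tr (l.smulRight v) = l v := by
  rw [tr_eq_sum]
  conv_rhs => rw [eq_sum_stdVec v, map_sum]
  simp [mul_comm]

theorem contDiff_det {n : ℕ∞ω} : ContDiff ℝ n (fun A : Eu d →L[ℝ] Eu d => A.det) := by
  simp only [det_eq_matrix_det, Matrix.det_apply', Matrix.of_apply]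
  refine ContDiff.sum fun σ _ => contDiff_const.mul (contDiff_prod fun i _ => ?_)
  exact ((EuclideanSpace.proj (σ i)).comp
    (ContinuousLinearMap.apply ℝ (Eu d) (stdVec (d := d) i))).contDiff

theorem det_one_add_smul_eq (L : Eu d →L[ℝ] Eu d) : ∃ p : Polynomial ℝ, ∀ t : ℝ,
    (ContinuousLinearMap.id ℝ (Eu d) + t • L).det = 1 + tr L * t + p.eval t * t ^ 2 := by
  set N := LinearMap.toMatrix (EuclideanSpace.basisFun (Fin d) ℝ).toBasis
    (EuclideanSpace.basisFun (Fin d) ℝ).toBasis (L : Eu d →ₗ[ℝ] Eu d) with hN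
  -- Applying `divX` twice strips off the constant and the linear coefficient, leaving the
  -- remainder.
  refine ⟨(Matrix.det (1 + (Polynomial.X : Polynomial ℝ) • N.map Polynomial.C)).divX.divX,
    fun t => ?_⟩
  rw [tr, LinearMap.trace_eq_matrix_trace ℝ (EuclideanSpace.basisFun (Fin d) ℝ).toBasis,
    ← Matrix.det_one_add_smul t, ← hN, hN]
  rw [← LinearMap.toMatrix_one (EuclideanSpace.basisFun (Fin d) ℝ).toBasis, ← map_smul, ← map_add,
    LinearMap.det_toMatrix]
  rfl

/-- Jacobi's formula. -/
theorem fderiv_det_apply {A B : Eu d →L[ℝ] Eu d} (hAB : A ∘L B = ContinuousLinearMap.id ℝ (Eu d))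
    (H : Eu d →L[ℝ] Eu d) :
    fderiv ℝ (fun A : Eu d →L[ℝ] Eu d => A.det) A H = A.det * tr (B ∘L H) := by
  have h1 : HasFDerivAt (fun A : Eu d →L[ℝ] Eu d => A.det) _ A :=
    ((contDiff_det (n := 1)).differentiable (by simp) A).hasFDerivAt
  have h2 : HasDerivAt (fun t : ℝ => A + t • H) H 0 := by
    simpa using ((hasDerivAt_id (0 : ℝ)).smul_const H).const_add A
  have h3 := HasFDerivAt.comp_hasDerivAt_of_eq (0 : ℝ) h1 h2
    (by ext1 v; simp)
  obtain ⟨p, hp⟩ := det_one_add_smul_eq (B ∘L H)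
  have h4 : (fun A : Eu d →L[ℝ] Eu d => A.det) ∘ (fun t : ℝ => A + t • H) =
      fun t => A.det * (1 + tr (B ∘L H) * t + p.eval t * t ^ 2) := by
    funext t
    -- Factoring out `A` reduces the derivative at `A` to the expansion of the determinant near the
    -- identity.
    have : A + t • H = A ∘L (ContinuousLinearMap.id ℝ (Eu d) + t • (B ∘L H)) := by
      ext1 v
      have := DFunLike.congr_fun hAB (H v)
      simp only [ContinuousLinearMap.comp_apply, ContinuousLinearMap.id_apply] at this
      simp [this]
    simp only [Function.comp_apply, ← hp]
    rw [this]
    exact LinearMap.det_comp _ _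
  rw [h4] at h3
  have h5 : HasDerivAt (fun t : ℝ => A.det * (1 + tr (B ∘L H) * t + p.eval t * t ^ 2))
      (A.det * tr (B ∘L H)) 0 := by
    have h6 := (((hasDerivAt_id (0 : ℝ)).const_mul (tr (B ∘L H))).const_add 1).add
      ((p.hasDerivAt 0).mul ((hasDerivAt_id (0 : ℝ)).pow 2))
    have h7 := h6.const_mul A.det
    simpa using h7
  exact h3.unique h5

theorem div_smul_eq {ρ : Eu d → ℝ} {W : Eu d → Eu d} {y : Eu d} (hρ : DifferentiableAt ℝ ρ y)
    (hW : DifferentiableAt ℝ W y) (hne : ρ y ≠ 0) :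
    (ρ y)⁻¹ * tr (fderiv ℝ (fun z => ρ z • W z) y) =
      tr (fderiv ℝ W y) + (ρ y)⁻¹ * fderiv ℝ ρ y (W y) := by
  rw [fderiv_fun_smul hρ hW, tr_add, tr_smul, tr_smulRight]
  field_simp

/-- The sign of the determinant is constant near `y`, and Jacobi's formula is unaffected by it. -/
theorem fderiv_abs_det {J : Eu d → Eu d →L[ℝ] Eu d} {y : Eu d} {B : Eu d →L[ℝ] Eu d}
    (hJ : DifferentiableAt ℝ J y) (hB : J y ∘L B = ContinuousLinearMap.id ℝ (Eu d))
    (hdet : (J y).det ≠ 0) (v : Eu d) :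
    DifferentiableAt ℝ (fun z => |(J z).det|) y ∧
    fderiv ℝ (fun z => |(J z).det|) y v = |(J y).det| * tr (B ∘L fderiv ℝ J y v) := by
  have h1 : HasFDerivAt (fun z => (J z).det) _ y := HasFDerivAt.comp y
    (g := fun A : Eu d →L[ℝ] Eu d => A.det) (f := J)
    ((contDiff_det (n := 1)).differentiable (by simp) (J y)).hasFDerivAt hJ.hasFDerivAt
  have h2 : fderiv ℝ (fun z => (J z).det) y v = (J y).det * tr (B ∘L fderiv ℝ J y v) := by
    rw [h1.fderiv, ContinuousLinearMap.comp_apply, fderiv_det_apply hB]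
  rcases hdet.lt_or_gt with hneg | hpos
  · have hev : (fun z => |(J z).det|) =ᶠ[𝓝 y] fun z => -(J z).det :=
      (h1.continuousAt.eventually_lt_const hneg).mono fun z hz => abs_of_neg hz
    refine ⟨hev.differentiableAt_iff.2 h1.differentiableAt.neg, ?_⟩
    rw [hev.fderiv_eq, abs_of_neg hneg, fderiv_fun_neg]
    simp [h2]
  · have hev : (fun z => |(J z).det|) =ᶠ[𝓝 y] fun z => (J z).det :=
      (h1.continuousAt.eventually_const_lt hpos).mono fun z hz => abs_of_pos hz
    refine ⟨hev.differentiableAt_iff.2 h1.differentiableAt, ?_⟩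
    rw [hev.fderiv_eq, abs_of_pos hpos, h2]

/-- The weighted divergence does not depend on the coordinates. -/
theorem weighted_div_comp {τ W W' : Eu d → Eu d} {ρ ρ' : Eu d → ℝ} {y : Eu d}
    {B : Eu d →L[ℝ] Eu d} (hτ : ContDiffAt ℝ ∞ τ y)
    (hB : fderiv ℝ τ y ∘L B = ContinuousLinearMap.id ℝ (Eu d))
    (hW : DifferentiableAt ℝ W y) (hW' : DifferentiableAt ℝ W' (τ y))
    (hρ' : DifferentiableAt ℝ ρ' (τ y)) (hne : ρ' (τ y) ≠ 0)
    (hWW : ∀ᶠ z in 𝓝 y, W' (τ z) = fderiv ℝ τ z (W z))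
    (hρρ : ∀ᶠ z in 𝓝 y, ρ z = |(fderiv ℝ τ z).det| * ρ' (τ z)) :
    (ρ y)⁻¹ * tr (fderiv ℝ (fun z => ρ z • W z) y) =
      (ρ' (τ y))⁻¹ * tr (fderiv ℝ (fun z => ρ' z • W' z) (τ y)) := by
  have hdet : (fderiv ℝ τ y).det ≠ 0 := by
    intro h0
    have h1 : (fderiv ℝ τ y ∘L B).det = (fderiv ℝ τ y).det * B.det := LinearMap.det_comp _ _
    rw [hB, h0, zero_mul] at h1
    have : (ContinuousLinearMap.id ℝ (Eu d)).det = 1 := LinearMap.det_id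
    exact one_ne_zero (this.symm.trans h1)
  have hτ1 : DifferentiableAt ℝ τ y := hτ.differentiableAt (by simp)
  have hτ2 : DifferentiableAt ℝ (fderiv ℝ τ) y :=
    (hτ.fderiv_right (m := ∞) (by simp)).differentiableAt (by simp)
  obtain ⟨hδ, hδ'⟩ := fderiv_abs_det hτ2 hB hdet (W y)
  have hρτ : DifferentiableAt ℝ (fun z => ρ' (τ z)) y := hρ'.comp y hτ1
  have hρev : ρ =ᶠ[𝓝 y] fun z => |(fderiv ℝ τ z).det| * ρ' (τ z) := hρρ
  have hρ : DifferentiableAt ℝ ρ y := hρev.differentiableAt_iff.2 (hδ.mul hρτ)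
  have hy : ρ y = |(fderiv ℝ τ y).det| * ρ' (τ y) := hρρ.self_of_nhds
  have habs : |(fderiv ℝ τ y).det| ≠ 0 := abs_ne_zero.2 hdet
  have hWy := hWW.self_of_nhds
  rw [div_smul_eq hρ hW (by rw [hy]; positivity), div_smul_eq hρ' hW' hne]
  have hDρ : fderiv ℝ ρ y (W y) = |(fderiv ℝ τ y).det| * fderiv ℝ ρ' (τ y) (W' (τ y)) +
      ρ' (τ y) * (|(fderiv ℝ τ y).det| * tr (B ∘L fderiv ℝ (fderiv ℝ τ) y (W y))) := by
    rw [hρev.fderiv_eq, fderiv_fun_mul hδ hρτ]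
    have : fderiv ℝ (fun z => ρ' (τ z)) y = _ := fderiv_comp y hρ' hτ1
    simp [this, hδ', hWy]
  -- This comes from differentiating `W' ∘ τ = Dτ · W`, with symmetry of `D²τ`. Its trace against
  -- `B` yields the same term `tr (B ∘ D²τ(W))` that Jacobi's formula put into `hDρ`, so the two
  -- sides agree.
  have hDW : fderiv ℝ W' (τ y) ∘L fderiv ℝ τ y =
      fderiv ℝ (fderiv ℝ τ) y (W y) + fderiv ℝ τ y ∘L fderiv ℝ W y := by
    have h1 : fderiv ℝ (fun z => W' (τ z)) y = _ := fderiv_comp y hW' hτ1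
    rw [← h1, Filter.EventuallyEq.fderiv_eq hWW, fderiv_clm_apply hτ2 hW, add_comm]
    congr 1
    ext1 v
    exact (hτ.isSymmSndFDerivAt two_le_smooth) v (W y)
  have hBB : B ∘L fderiv ℝ τ y = ContinuousLinearMap.id ℝ (Eu d) := by
    -- In finite dimension a right inverse is a left inverse.
    have h1 : (B : Eu d →ₗ[ℝ] Eu d) * (fderiv ℝ τ y : Eu d →ₗ[ℝ] Eu d) = 1 := by
      rw [mul_eq_one_comm]
      ext1 v
      exact DFunLike.congr_fun hB v
    ext1 v
    exact DFunLike.congr_fun h1 v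
  have htr : tr (fderiv ℝ W' (τ y)) =
      tr (B ∘L fderiv ℝ (fderiv ℝ τ) y (W y)) + tr (fderiv ℝ W y) := by
    have h1 : fderiv ℝ W' (τ y) = (fderiv ℝ W' (τ y) ∘L fderiv ℝ τ y) ∘L B := by
      rw [ContinuousLinearMap.comp_assoc, hB, ContinuousLinearMap.comp_id]
    rw [h1, hDW, ContinuousLinearMap.add_comp, tr_add, tr_comp_comm, tr_comp_comm _ B,
      ← ContinuousLinearMap.comp_assoc, hBB, ContinuousLinearMap.id_comp]
  rw [htr, hDρ, hy]
  field_simp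
  ring

end Jacobi


/-! ### Tangent vectors in coordinates -/

section Coordinates

set_option linter.unusedSectionVars false

variable {d : ℕ} {M : Type*} [TopologicalSpace M] [ChartedSpace (Eu d) M] [IsManifold (𝓡 d) ∞ M]
  {e e' : OpenPartialHomeomorph M (Eu d)}

/-- The coordinates, in the chart `e`, of a tangent vector at `p`. -/
noncomputable def coords (e : OpenPartialHomeomorph M (Eu d)) (p : M) :
    TangentSpace (𝓡 d) p →L[ℝ] Eu d :=
  mfderiv (𝓡 d) 𝓘(ℝ, Eu d) e p

/-- The tangent vector at `e.symm y` with given coordinates. -/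
noncomputable def ofCoords (e : OpenPartialHomeomorph M (Eu d)) (y : Eu d) :
    Eu d →L[ℝ] TangentSpace (𝓡 d) (e.symm y) :=
  mfderiv 𝓘(ℝ, Eu d) (𝓡 d) e.symm y

theorem coord_eq (p : M) (v : TangentSpace (𝓡 d) p) (i : Fin d) : coord e p v i = coords e p v i :=
  rfl

theorem frame_eq (y : Eu d) (i : Fin d) : frame e y i = ofCoords e y (stdVec i) := rfl

theorem coords_ofCoords (he : e ∈ atlas (Eu d) M) {y : Eu d} (hy : y ∈ e.target) (v : Eu d) :
    coords e (e.symm y) (ofCoords e y v) = v :=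
  DFunLike.congr_fun ((mdifferentiable_of_mem_atlas (I := 𝓡 d) he).comp_symm_deriv hy) v

theorem ofCoords_injective (he : e ∈ atlas (Eu d) M) {y : Eu d} (hy : y ∈ e.target) :
    Function.Injective (ofCoords e y) :=
  Function.LeftInverse.injective (coords_ofCoords he hy)

theorem ofCoords_coords (he : e ∈ atlas (Eu d) M) {y : Eu d} (hy : y ∈ e.target)
    (w : TangentSpace (𝓡 d) (e.symm y)) : ofCoords e y (coords e (e.symm y) w) = w := by
  have hfd : FiniteDimensional ℝ (TangentSpace (𝓡 d) (e.symm y)) :=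
    inferInstanceAs (FiniteDimensional ℝ (Eu d))
  have hsurj : Function.Surjective (ofCoords e y) :=
    (LinearMap.injective_iff_surjective_of_finrank_eq_finrank
      (f := (ofCoords e y : Eu d →ₗ[ℝ] TangentSpace (𝓡 d) (e.symm y))) rfl).1
      (ofCoords_injective he hy)
  obtain ⟨v, rfl⟩ := hsurj w
  rw [coords_ofCoords he hy]

theorem ofCoords_eq_sum (y v : Eu d) : ofCoords e y v = ∑ i, v i • frame e y i := by
  conv_lhs => rw [eq_sum_stdVec v, map_sum]
  simp [frame_eq]

theorem eq_sum_frame (he : e ∈ atlas (Eu d) M) {y : Eu d} (hy : y ∈ e.target)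
    (w : TangentSpace (𝓡 d) (e.symm y)) : w = ∑ i, coord e (e.symm y) w i • frame e y i := by
  conv_lhs => rw [← ofCoords_coords he hy w, ofCoords_eq_sum]
  rfl

theorem hasMFDerivAt_symm (he : e ∈ atlas (Eu d) M) {y : Eu d} (hy : y ∈ e.target) :
    HasMFDerivAt 𝓘(ℝ, Eu d) (𝓡 d) e.symm y (ofCoords e y) :=
  ((mdifferentiable_of_mem_atlas (I := 𝓡 d) he).mdifferentiableAt_symm hy).hasMFDerivAt

theorem hasMFDerivAt_chart (he : e ∈ atlas (Eu d) M) {p : M} (hp : p ∈ e.source) :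
    HasMFDerivAt (𝓡 d) 𝓘(ℝ, Eu d) e p (coords e p) :=
  ((mdifferentiable_of_mem_atlas (I := 𝓡 d) he).mdifferentiableAt hp).hasMFDerivAt

theorem hasFDerivAt_transition (he : e ∈ atlas (Eu d) M) (he' : e' ∈ atlas (Eu d) M) {z : Eu d}
    (hz : z ∈ e.target) (hz' : e.symm z ∈ e'.source) :
    HasFDerivAt (fun z => e' (e.symm z)) (coords e' (e.symm z) ∘L ofCoords e z) z :=
  ((hasMFDerivAt_chart he' hz').comp z (hasMFDerivAt_symm he hz)).hasFDerivAt

theorem coords_transition (he : e ∈ atlas (Eu d) M) (he' : e' ∈ atlas (Eu d) M) {z : Eu d}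
    (hz : z ∈ e.target) (hz' : e.symm z ∈ e'.source) (w : TangentSpace (𝓡 d) (e.symm z)) :
    coords e' (e.symm z) w = fderiv ℝ (fun z => e' (e.symm z)) z (coords e (e.symm z) w) := by
  rw [(hasFDerivAt_transition he he' hz hz').fderiv, ContinuousLinearMap.comp_apply,
    ofCoords_coords he hz]

theorem fderiv_transition_comp (he : e ∈ atlas (Eu d) M) (he' : e' ∈ atlas (Eu d) M) {z : Eu d}
    (hz : z ∈ e.target) (hz' : e.symm z ∈ e'.source) :
    fderiv ℝ (fun z => e' (e.symm z)) z ∘L fderiv ℝ (fun z => e (e'.symm z)) (e' (e.symm z)) =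
      ContinuousLinearMap.id ℝ (Eu d) := by
  set w := e' (e.symm z) with hw
  have hwt : w ∈ e'.target := e'.map_source hz'
  have hsw : e'.symm w = e.symm z := e'.left_inv hz'
  have hws : e'.symm w ∈ e.source := hsw ▸ e.map_target hz
  have h1 := hasFDerivAt_transition he' he hwt hws
  have h2 := hasFDerivAt_transition he he' hz hz'
  have hτ : e (e'.symm w) = z := by rw [hsw, e.right_inv hz]
  have h3 := HasFDerivAt.comp w (g := fun z => e' (e.symm z)) (f := fun z => e (e'.symm z))
    (hτ.symm ▸ h2.differentiableAt.hasFDerivAt) h1.differentiableAt.hasFDerivAt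
  rw [hτ] at h3
  refine h3.unique ((hasFDerivAt_id w).congr_of_eventuallyEq ?_)
  filter_upwards [(isOpen_transition e e').mem_nhds ⟨hwt, hws⟩] with v hv
  simp [e.left_inv hv.2, e'.right_inv hv.1]

theorem diff_ofCoords {φ : M → ℝ} (hφ : ContMDiff (𝓡 d) 𝓘(ℝ, ℝ) ∞ φ) (he : e ∈ atlas (Eu d) M)
    {y : Eu d} (hy : y ∈ e.target) (v : Eu d) :
    diff φ (e.symm y) (ofCoords e y v) = fderiv ℝ (fun y => φ (e.symm y)) y v := by
  have h1 : HasMFDerivAt (𝓡 d) 𝓘(ℝ, ℝ) φ (e.symm y) (diff φ (e.symm y)) :=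
    ((hφ.mdifferentiable (by simp)) (e.symm y)).hasMFDerivAt
  have h2 : HasFDerivAt (fun y => φ (e.symm y)) (diff φ (e.symm y) ∘L ofCoords e y) y :=
    (h1.comp y (hasMFDerivAt_symm he hy)).hasFDerivAt
  rw [h2.fderiv]
  rfl

/-- The coordinate frame is the tangent map of `e.symm` applied to a constant vector field. -/
theorem contMDiffOn_frame (he : e ∈ atlas (Eu d) M) (i : Fin d) :
    ContMDiffOn 𝓘(ℝ, Eu d) (𝓡 d).tangent ∞
      (fun y => (⟨e.symm y, frame e y i⟩ : TangentBundle (𝓡 d) M)) e.target := by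
  have h1 := (contMDiffOn_symm_of_mem_maximalAtlas (I := 𝓡 d) (n := ∞)
    (IsManifold.subset_maximalAtlas he)).contMDiffOn_tangentMapWithin (m := ∞) (by simp)
    (e.open_target.uniqueMDiffOn)
  have h2 : ContMDiff 𝓘(ℝ, Eu d) 𝓘(ℝ, Eu d).tangent ∞
      (fun y => (⟨y, (stdVec i : Eu d)⟩ : TangentBundle 𝓘(ℝ, Eu d) (Eu d))) :=
    contMDiff_vectorSpace_iff_contDiff.2 contDiff_const
  refine (h1.comp h2.contMDiffOn fun y hy => hy).congr fun y hy => ?_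
  simp only [Function.comp_apply, tangentMapWithin, frame]
  rw [mfderivWithin_of_mem_nhds (e.open_target.mem_nhds hy)]

variable (g : Metric d M)

theorem contDiffOn_metricMatrix (he : e ∈ atlas (Eu d) M) (i j : Fin d) :
    ContDiffOn ℝ ∞ (fun y => metricMatrix g e y i j) e.target := by
  rw [← contMDiffOn_iff_contDiffOn]
  have h1 : ContMDiffOn 𝓘(ℝ, Eu d) (𝓘(ℝ, Eu d).prod 𝓘(ℝ)) ∞
      (fun y ↦ Bundle.TotalSpace.mk' ℝ (E := Bundle.Trivial M ℝ) (e.symm y)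
        (g.inner (e.symm y) (frame e y i) (frame e y j))) e.target :=
    ContMDiffOn.clm_bundle_apply₂ (F₁ := Eu d) (F₂ := Eu d)
      (g.contMDiff.comp_contMDiffOn (contMDiffOn_symm_of_mem_maximalAtlas
        (IsManifold.subset_maximalAtlas he))) (contMDiffOn_frame he i) (contMDiffOn_frame he j)
  intro y hy
  have h2 := h1 y hy
  simp only [Bundle.contMDiffWithinAt_totalSpace] at h2
  exact h2.2

theorem inner_ofCoords (y v w : Eu d) :
    g.inner (e.symm y) (ofCoords e y v) (ofCoords e y w) =
      ∑ i, ∑ j, v i * (w j * metricMatrix g e y i j) := by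
  rw [ofCoords_eq_sum, ofCoords_eq_sum]
  simp only [map_sum, map_smul, sum_apply, smul_apply, smul_eq_mul, Finset.mul_sum, metricMatrix, Matrix.of_apply]
  rw [Finset.sum_comm]
  exact Finset.sum_congr rfl fun i _ => Finset.sum_congr rfl fun j _ => by ring

theorem inner_eq_sum (he : e ∈ atlas (Eu d) M) {y : Eu d} (hy : y ∈ e.target)
    (v w : TangentSpace (𝓡 d) (e.symm y)) : g.inner (e.symm y) v w =
      ∑ i, ∑ j, coords e (e.symm y) v i * (coords e (e.symm y) w j * metricMatrix g e y i j) := by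
  rw [← inner_ofCoords, ofCoords_coords he hy, ofCoords_coords he hy]

theorem inner_eq_sum' (he : e ∈ atlas (Eu d) M) {p : M} (hp : p ∈ e.source)
    (v w : TangentSpace (𝓡 d) p) : g.inner p v w =
      ∑ i, ∑ j, coords e p v i * (coords e p w j * metricMatrix g e (e p) i j) := by
  obtain ⟨y, hy, rfl⟩ : ∃ y ∈ e.target, e.symm y = p := ⟨e p, e.map_source hp, e.left_inv hp⟩
  rw [e.right_inv hy]
  exact inner_eq_sum g he hy v w

theorem metricMatrix_posDef (he : e ∈ atlas (Eu d) M) {y : Eu d} (hy : y ∈ e.target) :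
    (metricMatrix g e y).PosDef := by
  refine Matrix.PosDef.of_dotProduct_mulVec_pos ?_ fun x hx => ?_
  · ext i j
    simp [metricMatrix, g.symm]
  · have h := g.pos (e.symm y) (ofCoords e y (WithLp.toLp 2 x)) (by
      rw [Ne, ← map_zero (ofCoords e y)]
      exact fun h => hx (by simpa using ofCoords_injective he hy h))
    rw [inner_ofCoords] at h
    refine h.trans_eq ?_
    simp [dotProduct, Matrix.mulVec, Finset.mul_sum, mul_comm]

theorem density_pos (he : e ∈ atlas (Eu d) M) {y : Eu d} (hy : y ∈ e.target) :
    0 < density g e y :=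
  Real.sqrt_pos.2 (metricMatrix_posDef g he hy).det_pos

theorem contDiffOn_det {n : ℕ} {U : Set (Eu d)} {A : Eu d → Matrix (Fin n) (Fin n) ℝ}
    (hA : ∀ i j, ContDiffOn ℝ ∞ (fun y => A y i j) U) : ContDiffOn ℝ ∞ (fun y => (A y).det) U := by
  simp only [Matrix.det_apply']
  exact ContDiffOn.sum fun σ _ => contDiffOn_const.mul (contDiffOn_prod fun i _ => hA _ _)

theorem contDiffOn_density (he : e ∈ atlas (Eu d) M) :
    ContDiffOn ℝ ∞ (density g e) e.target :=
  (contDiffOn_det (contDiffOn_metricMatrix g he)).sqrt fun _ hy =>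
    (metricMatrix_posDef g he hy).det_pos.ne'

theorem contDiffOn_inv_metricMatrix (he : e ∈ atlas (Eu d) M) (i j : Fin d) :
    ContDiffOn ℝ ∞ (fun y => (metricMatrix g e y)⁻¹ i j) e.target := by
  have hdet := contDiffOn_det (contDiffOn_metricMatrix g he)
  have hadj : ContDiffOn ℝ ∞ (fun y => (metricMatrix g e y).adjugate i j) e.target := by
    simp only [Matrix.adjugate_apply]
    refine contDiffOn_det fun k l => ?_
    by_cases hk : k = j
    · simp only [hk, Matrix.updateRow_self]
      exact contDiffOn_const
    · simp only [Matrix.updateRow_ne hk]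
      exact contDiffOn_metricMatrix g he k l
  refine ((hdet.inv fun y hy => (metricMatrix_posDef g he hy).det_pos.ne').mul hadj).congr
    fun y _ => ?_
  simp [Matrix.inv_def]

/-- The components of the gradient. -/
theorem coords_grad {φ : M → ℝ} (hφ : ContMDiff (𝓡 d) 𝓘(ℝ, ℝ) ∞ φ) (he : e ∈ atlas (Eu d) M)
    {y : Eu d} (hy : y ∈ e.target) (i : Fin d) :
    coords e (e.symm y) (grad g φ (e.symm y)) i =
      ∑ j, (metricMatrix g e y)⁻¹ i j * fderiv ℝ (fun y => φ (e.symm y)) y (stdVec j) := by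
  set G := metricMatrix g e y with hG
  have hinv : G⁻¹ * G = 1 := Matrix.nonsing_inv_mul _
    (metricMatrix_posDef g he hy).det_pos.ne'.isUnit
  have h1 : G.mulVec (coords e (e.symm y) (grad g φ (e.symm y))) =
      fun j => fderiv ℝ (fun y => φ (e.symm y)) y (stdVec j) := by
    funext j
    rw [← diff_ofCoords hφ he hy, ← inner_grad g, g.symm,
      ← ofCoords_coords he hy (grad g φ (e.symm y)), inner_ofCoords,
      coords_ofCoords he hy]
    simp [stdVec, Matrix.mulVec, dotProduct, mul_comm, hG]
  have h2 := congrFun (congrArg G⁻¹.mulVec h1) i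
  rw [Matrix.mulVec_mulVec, hinv, Matrix.one_mulVec] at h2
  exact h2

theorem contDiffOn_partial {f : Eu d → ℝ} {U : Set (Eu d)} (hU : IsOpen U)
    (hf : ContDiffOn ℝ ∞ f U) (v : Eu d) : ContDiffOn ℝ ∞ (fun y => fderiv ℝ f y v) U :=
  (hf.fderiv_of_isOpen hU (m := ∞) (by simp)).clm_apply contDiffOn_const

theorem contDiffOn_coords_grad {φ : M → ℝ} (hφ : ContMDiff (𝓡 d) 𝓘(ℝ, ℝ) ∞ φ)
    (he : e ∈ atlas (Eu d) M) (i : Fin d) :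
    ContDiffOn ℝ ∞ (fun y => coords e (e.symm y) (grad g φ (e.symm y)) i) e.target := by
  refine ContDiffOn.congr (ContDiffOn.sum (s := Finset.univ) fun j _ =>
    (contDiffOn_inv_metricMatrix g he i j).mul (contDiffOn_partial e.open_target
      (contMDiff_iff_contDiffOn_charts.1 hφ e he) (stdVec j))) fun y hy => ?_
  exact coords_grad g hφ he hy i

/-! ### The density and the divergence in different charts -/

/-- The metric matrices are congruent through the Jacobian of the transition map, so their
determinants differ by its square. -/
theorem density_transition (he : e ∈ atlas (Eu d) M) (he' : e' ∈ atlas (Eu d) M) {z : Eu d}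
    (hz : z ∈ e.target) (hz' : e.symm z ∈ e'.source) :
    density g e z = |(fderiv ℝ (fun z => e' (e.symm z)) z).det| *
      density g e' (e' (e.symm z)) := by
  set J := fderiv ℝ (fun z => e' (e.symm z)) z with hJ
  set N : Matrix (Fin d) (Fin d) ℝ := Matrix.of fun i j => J (stdVec j) i with hN
  have h1 : metricMatrix g e z = N.transpose * metricMatrix g e' (e' (e.symm z)) * N := by
    ext i j
    simp only [metricMatrix, Matrix.of_apply]
    rw [inner_eq_sum' g he' hz', frame_eq, frame_eq, coords_transition he he' hz hz',
      coords_transition he he' hz hz', coords_ofCoords he hz, coords_ofCoords he hz]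
    simp only [Matrix.mul_apply, Matrix.transpose_apply, Finset.sum_mul, hN, Matrix.of_apply]
    rw [Finset.sum_comm]
    exact Finset.sum_congr rfl fun k _ => Finset.sum_congr rfl fun l _ => by
      simp only [hJ, metricMatrix, Matrix.of_apply]; ring
  rw [density, h1, Matrix.det_mul, Matrix.det_mul, Matrix.det_transpose, det_eq_matrix_det,
    mul_assoc, mul_comm, mul_assoc, Real.sqrt_mul (metricMatrix_posDef g he'
    (e'.map_source hz')).det_pos.le, Real.sqrt_mul_self_eq_abs, mul_comm]
  rfl

/-- The divergence in the chart `e` of a vector field with components `W`. -/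
noncomputable def divChart (g : Metric d M) (e : OpenPartialHomeomorph M (Eu d))
    (W : Eu d → Eu d) (y : Eu d) : ℝ :=
  (density g e y)⁻¹ * ∑ i, fderiv ℝ (fun z => density g e z * W z i) y (stdVec i)

theorem divChart_eq_tr {W : Eu d → Eu d} {y : Eu d} (hρ : DifferentiableAt ℝ (density g e) y)
    (hW : DifferentiableAt ℝ W y) :
    divChart g e W y = (density g e y)⁻¹ * tr (fderiv ℝ (fun z => density g e z • W z) y) := by
  rw [divChart, tr_eq_sum]
  congr 1
  refine Finset.sum_congr rfl fun i _ => ?_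
  have h1 := (EuclideanSpace.proj (𝕜 := ℝ) i).hasFDerivAt.comp y (hρ.smul hW).hasFDerivAt
  have h2 : fderiv ℝ (fun z => density g e z * W z i) y = _ := h1.fderiv
  rw [h2]
  rfl

/-- The components of a vector field in a chart. -/
noncomputable def fieldCoords (e : OpenPartialHomeomorph M (Eu d))
    (X : ∀ x : M, TangentSpace (𝓡 d) x) (y : Eu d) : Eu d :=
  coords e (e.symm y) (X (e.symm y))

theorem differentiableAt_fieldCoords {X : ∀ x : M, TangentSpace (𝓡 d) x}
    (hX : ∀ i, ContDiffOn ℝ ∞ (fun y => coords e (e.symm y) (X (e.symm y)) i) e.target)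
    {y : Eu d} (hy : y ∈ e.target) : DifferentiableAt ℝ (fieldCoords e X) y := by
  rw [differentiableAt_euclidean]
  exact fun i => ((hX i).contDiffAt (e.open_target.mem_nhds hy)).differentiableAt (by simp)

/-- The definition of `divergence` changes chart from point to point and cannot be differentiated
directly; invariance under coordinate changes replaces it, near any point, by a formula in one fixed
chart. -/
theorem divergence_eq_divChart {X : ∀ x : M, TangentSpace (𝓡 d) x}
    (hX : ∀ e ∈ atlas (Eu d) M, ∀ i,
      ContDiffOn ℝ ∞ (fun y => coords e (e.symm y) (X (e.symm y)) i) e.target)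
    (he : e ∈ atlas (Eu d) M) {y : Eu d} (hy : y ∈ e.target) :
    divergence g X (e.symm y) = divChart g e (fieldCoords e X) y := by
  set e' := chartAt (Eu d) (e.symm y) with he'def
  have he' : e' ∈ atlas (Eu d) M := chart_mem_atlas _ _
  have hy' : e.symm y ∈ e'.source := mem_chart_source _ _
  have h1 : divergence g X (e.symm y) = divChart g e' (fieldCoords e' X) (e' (e.symm y)) := rfl
  have hτy : e' (e.symm y) ∈ e'.target := e'.map_source hy'
  have hρ : ∀ {e : OpenPartialHomeomorph M (Eu d)}, e ∈ atlas (Eu d) M → ∀ {y}, y ∈ e.target →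
      DifferentiableAt ℝ (density g e) y := fun he _ hy =>
    ((contDiffOn_density g he).contDiffAt ((OpenPartialHomeomorph.open_target _).mem_nhds
      hy)).differentiableAt (by simp)
  have hnear : ∀ᶠ z in 𝓝 y, z ∈ e.target ∧ e.symm z ∈ e'.source :=
    (isOpen_transition e' e).mem_nhds ⟨hy, hy'⟩
  rw [h1, divChart_eq_tr g (hρ he' hτy) (differentiableAt_fieldCoords (hX e' he') hτy),
    divChart_eq_tr g (hρ he hy) (differentiableAt_fieldCoords (hX e he) hy)]
  refine (weighted_div_comp (τ := fun z => e' (e.symm z))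
    ((contDiffOn_transition he' he).contDiffAt ((isOpen_transition e' e).mem_nhds ⟨hy, hy'⟩))
    (fderiv_transition_comp he he' hy hy') (differentiableAt_fieldCoords (hX e he) hy)
    (differentiableAt_fieldCoords (hX e' he') hτy) (hρ he' hτy) (density_pos g he' hτy).ne'
    ?_ ?_).symm
  · filter_upwards [hnear] with z hz
    rw [fieldCoords, e'.left_inv hz.2]
    exact coords_transition he he' hz.1 hz.2 _
  · filter_upwards [hnear] with z hz
    exact density_transition g he he' hz.1 hz.2

theorem contDiffOn_divChart (he : e ∈ atlas (Eu d) M) {W : Eu d → Eu d}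
    (hW : ∀ i, ContDiffOn ℝ ∞ (fun y => W y i) e.target) :
    ContDiffOn ℝ ∞ (divChart g e W) e.target :=
  ((contDiffOn_density g he).inv fun _ hy => (density_pos g he hy).ne').mul
    (ContDiffOn.sum fun i _ => contDiffOn_partial e.open_target
      ((contDiffOn_density g he).mul (hW i)) _)

theorem contMDiff_divergence {X : ∀ x : M, TangentSpace (𝓡 d) x}
    (hX : ∀ e ∈ atlas (Eu d) M, ∀ i,
      ContDiffOn ℝ ∞ (fun y => coords e (e.symm y) (X (e.symm y)) i) e.target) :
    ContMDiff (𝓡 d) 𝓘(ℝ, ℝ) ∞ (divergence g X) := by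
  rw [contMDiff_iff_contDiffOn_charts]
  exact fun e he => (contDiffOn_divChart g he (hX e he)).congr fun y hy =>
    divergence_eq_divChart g hX he hy

end Coordinates


/-! ### The Riemannian volume is finite -/

section Volume

set_option linter.unusedSectionVars false

variable {d : ℕ} {M : Type*} [TopologicalSpace M] [ChartedSpace (Eu d) M] [IsManifold (𝓡 d) ∞ M]
  [MeasurableSpace M] [BorelSpace M] {e e' : OpenPartialHomeomorph M (Eu d)} (g : Metric d M)

theorem measurableSet_target_inter_preimage (e : OpenPartialHomeomorph M (Eu d)) {S : Set M}
    (hS : MeasurableSet S) : MeasurableSet (e.target ∩ e.symm ⁻¹' S) := by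
  have h1 : Measurable (e.target.domRestrict e.symm) :=
    (continuousOn_iff_continuous_domRestrict.1 e.continuousOn_symm).measurable
  have h2 := e.open_target.measurableSet.subtype_image (h1 hS)
  convert h2 using 1
  ext y
  simp [Set.domRestrict_apply, and_comm]

theorem aemeasurable_symm (e : OpenPartialHomeomorph M (Eu d)) (ν : Measure (Eu d)) :
    AEMeasurable e.symm (ν.restrict e.target) :=
  e.continuousOn_symm.aemeasurable e.open_target.measurableSet

theorem chartVolume_apply (e : OpenPartialHomeomorph M (Eu d)) {S : Set M}
    (hS : MeasurableSet S) : chartVolume g e S =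
      ∫⁻ y in e.target ∩ e.symm ⁻¹' S, ENNReal.ofReal (density g e y) := by
  have h0 := (aemeasurable_symm e volume).mono_ac
    (withDensity_absolutelyContinuous _ (fun y => ENNReal.ofReal (density g e y)))
  have hT := measurableSet_target_inter_preimage e hS
  have h1 : ((volume.restrict e.target).withDensity fun y => ENNReal.ofReal (density g e y))
      (e.symm ⁻¹' S) = ((volume.restrict e.target).withDensity
        fun y => ENNReal.ofReal (density g e y)) (e.target ∩ e.symm ⁻¹' S) := by
    refine measure_congr ?_
    have : ∀ᵐ y ∂((volume.restrict e.target).withDensity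
        fun y => ENNReal.ofReal (density g e y)), y ∈ e.target :=
      (withDensity_absolutelyContinuous _ _).ae_le (ae_restrict_mem e.open_target.measurableSet)
    filter_upwards [this] with y hy
    exact propext ⟨fun h => ⟨hy, h⟩, fun h => h.2⟩
  rw [chartVolume, Measure.map_apply_of_aemeasurable h0 hS, h1, withDensity_apply _ hT,
    Measure.restrict_restrict hT, Set.inter_right_comm, Set.inter_self]

theorem chartVolume_compl_source (e : OpenPartialHomeomorph M (Eu d)) :
    chartVolume g e e.sourceᶜ = 0 := by
  rw [chartVolume_apply g e e.open_source.measurableSet.compl]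
  have : e.target ∩ e.symm ⁻¹' e.sourceᶜ = ∅ := by
    ext y
    simp only [Set.mem_inter_iff, Set.mem_preimage, Set.mem_compl_iff, Set.mem_empty_iff_false,
      iff_false, not_and, not_not]
    exact fun hy => e.map_target hy
  rw [this, Measure.restrict_empty, lintegral_zero_measure]

/-- Change of variables: the Jacobian of the transition map is the factor in `density_transition`.
-/
theorem chartVolume_eq_of_subset (he : e ∈ atlas (Eu d) M) (he' : e' ∈ atlas (Eu d) M) {S : Set M}
    (hS : MeasurableSet S) (hSe : S ⊆ e.source) (hSe' : S ⊆ e'.source) :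
    chartVolume g e S = chartVolume g e' S := by
  rw [chartVolume_apply g e hS, chartVolume_apply g e' hS]
  have himg : e'.target ∩ e'.symm ⁻¹' S =
      (fun z => e' (e.symm z)) '' (e.target ∩ e.symm ⁻¹' S) := by
    ext w
    constructor
    · rintro ⟨hw, hwS⟩
      have hws := hSe hwS
      exact ⟨e (e'.symm w), ⟨e.map_source hws, by simpa [e.left_inv hws] using hwS⟩,
        by simp [e.left_inv hws, e'.right_inv hw]⟩
    · rintro ⟨z, ⟨hz, hzS⟩, rfl⟩
      have hzs := hSe' hzS
      exact ⟨e'.map_source hzs, by simpa [e'.left_inv hzs] using hzS⟩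
  rw [himg, lintegral_image_eq_lintegral_abs_det_fderiv_mul volume
    (measurableSet_target_inter_preimage e hS)
    (f' := fun z => fderiv ℝ (fun z => e' (e.symm z)) z)
    (fun z hz => (hasFDerivAt_transition he he' hz.1 (hSe' hz.2)).differentiableAt.hasFDerivAt.hasFDerivWithinAt)
    (fun z hz w hw h => by
      have h1 := e'.injOn (hSe' hz.2) (hSe' hw.2) h
      exact e.symm.injOn hz.1 hw.1 h1)]
  refine setLIntegral_congr_fun (measurableSet_target_inter_preimage e hS) fun z hz => ?_
  rw [density_transition g he he' hz.1 (hSe' hz.2), ENNReal.ofReal_mul (abs_nonneg _)]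

theorem chartVolume_lt_top (he : e ∈ atlas (Eu d) M) {K : Set M} (hK : IsCompact K)
    (hKm : MeasurableSet K) (hKe : K ⊆ e.source) : chartVolume g e K < ⊤ := by
  have himg : e.target ∩ e.symm ⁻¹' K = e '' K := by
    rw [e.image_eq_target_inter_inv_preimage hKe]
  have hc : IsCompact (e '' K) := hK.image_of_continuousOn (e.continuousOn.mono hKe)
  rw [chartVolume_apply g e hKm, himg]
  have hcont : ContinuousOn (density g e) (e '' K) := (contDiffOn_density g he).continuousOn.mono
    (by rintro _ ⟨x, hx, rfl⟩; exact e.map_source (hKe hx))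
  obtain ⟨C, hC⟩ := hc.exists_bound_of_continuousOn hcont
  calc ∫⁻ y in e '' K, ENNReal.ofReal (density g e y)
      ≤ ∫⁻ y in e '' K, ENNReal.ofReal C := by
        refine setLIntegral_mono measurable_const fun y hy => ENNReal.ofReal_le_ofReal ?_
        exact (le_abs_self _).trans (hC y hy)
    _ < ⊤ := by
        rw [setLIntegral_const]
        exact ENNReal.mul_lt_top ENNReal.ofReal_lt_top hc.measure_lt_top

/-- A compact manifold is covered by finitely many compact subsets of chart domains. -/
theorem exists_finite_cover (d : ℕ) (M : Type*) [TopologicalSpace M] [ChartedSpace (Eu d) M]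
    [T2Space M] [CompactSpace M] : ∃ (t : Finset M) (K : M → Set M), (∀ x, IsCompact (K x)) ∧
      (∀ x, K x ⊆ (chartAt (Eu d) x).source) ∧ ∀ x, ∃ c ∈ t, x ∈ K c := by
  have h : ∀ x : M, ∃ K, IsCompact K ∧ x ∈ interior K ∧ K ⊆ (chartAt (Eu d) x).source := fun x =>
    exists_compact_subset (chartAt (Eu d) x).open_source (mem_chart_source (Eu d) x)
  choose K hK hxK hKs using h
  obtain ⟨t, ht⟩ := isCompact_univ.elim_finite_subcover (fun x => interior (K x))
    (fun x => isOpen_interior) (fun x _ => Set.mem_iUnion.2 ⟨x, hxK x⟩)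
  refine ⟨t, K, hK, hKs, fun x => ?_⟩
  obtain ⟨c, hc, hx⟩ := Set.mem_iUnion₂.1 (ht (Set.mem_univ x))
  exact ⟨c, hc, interior_subset hx⟩

/-- A supremum of measures lies below any common upper bound. Here finitely many chart volumes,
restricted to compact pieces covering `M`, add up to one, because chart volumes agree on overlaps.
-/
theorem isFiniteMeasure_vol [T2Space M] [CompactSpace M] : IsFiniteMeasure (vol g) := by
  obtain ⟨t, K, hK, hKs, hcov⟩ := exists_finite_cover d M
  have hKm : ∀ x, MeasurableSet (K x) := fun x => (hK x).isClosed.measurableSet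
  have hle : vol g ≤ ∑ x ∈ t, (chartVolume g (chartAt (Eu d) x)).restrict (K x) := by
    refine iSup_le fun e => Measure.le_iff.2 fun S hS => ?_
    rw [Measure.finsetSum_apply]
    have h1 : S ⊆ (e.1.source)ᶜ ∪ ⋃ x ∈ t, S ∩ K x ∩ e.1.source := by
      intro y hy
      by_cases hye : y ∈ e.1.source
      · obtain ⟨c, hc, hyc⟩ := hcov y
        exact Or.inr (Set.mem_iUnion₂.2 ⟨c, hc, ⟨hy, hyc⟩, hye⟩)
      · exact Or.inl hye
    refine (measure_mono h1).trans ((measure_union_le _ _).trans ?_)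
    rw [chartVolume_compl_source, zero_add]
    refine (measure_biUnion_finset_le _ _).trans (Finset.sum_le_sum fun x _ => ?_)
    rw [chartVolume_eq_of_subset g e.2 (chart_mem_atlas (Eu d) x)
      ((hS.inter (hKm x)).inter e.1.open_source.measurableSet) Set.inter_subset_right
      (Set.inter_subset_left.trans (Set.inter_subset_right.trans (hKs x))),
      Measure.restrict_apply hS]
    exact measure_mono Set.inter_subset_left
  refine ⟨(hle Set.univ).trans_lt ?_⟩
  rw [Measure.finsetSum_apply]
  refine ENNReal.sum_lt_top.2 fun x _ => ?_
  rw [Measure.restrict_apply_univ]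
  exact chartVolume_lt_top g (chart_mem_atlas (Eu d) x) (hK x) (hKm x) (hKs x)

end Volume

/-! ### Smoothness of the coefficients -/

section Coefficients

set_option linter.unusedSectionVars false

variable {d : ℕ} {M : Type*} [TopologicalSpace M] [ChartedSpace (Eu d) M] [IsManifold (𝓡 d) ∞ M]
  {e e' : OpenPartialHomeomorph M (Eu d)} (g : Metric d M)

theorem diff_eq_sum {φ : M → ℝ} (hφ : ContMDiff (𝓡 d) 𝓘(ℝ, ℝ) ∞ φ) (he : e ∈ atlas (Eu d) M)
    {y : Eu d} (hy : y ∈ e.target) (v : TangentSpace (𝓡 d) (e.symm y)) :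
    diff φ (e.symm y) v =
      ∑ i, fderiv ℝ (fun y => φ (e.symm y)) y (stdVec i) * coord e (e.symm y) v i := by
  conv_lhs => rw [eq_sum_frame he hy v, map_sum]
  refine Finset.sum_congr rfl fun i _ => ?_
  rw [map_smul, frame_eq, diff_ofCoords hφ he hy, smul_eq_mul, mul_comm]

theorem coord_apply_grad {x : M} (he : e ∈ atlas (Eu d) M) {y : Eu d} (hy : y ∈ e.target)
    (S : TangentSpace (𝓡 d) (e.symm y) →L[ℝ] TangentSpace (𝓡 d) x)
    (v : TangentSpace (𝓡 d) (e.symm y)) (i : Fin d) :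
    coord e' x (S v) i = ∑ j, coords e (e.symm y) v j * coord e' x (S (frame e y j)) i := by
  conv_lhs => rw [eq_sum_frame he hy v, map_sum, coord_eq, map_sum]
  simp [coord_eq]

/-- The kernel `∇φ(x) · Q(x, y) ∇ψ(y)`. -/
noncomputable def gradKernel (g : Metric d M) (Q : Kernel d M) (φ ψ : M → ℝ) (x y : M) : ℝ :=
  g.inner x (grad g φ x) (Q x y (grad g ψ y))

theorem gradKernel_chart (Q : Kernel d M) {φ ψ : M → ℝ} (hφ : ContMDiff (𝓡 d) 𝓘(ℝ, ℝ) ∞ φ)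
    (he : e ∈ atlas (Eu d) M) (he' : e' ∈ atlas (Eu d) M) {y z : Eu d} (hy : y ∈ e.target)
    (hz : z ∈ e'.target) : gradKernel g Q φ ψ (e.symm y) (e'.symm z) =
      ∑ i, ∑ j, fderiv ℝ (fun y => φ (e.symm y)) y (stdVec i) *
        coords e' (e'.symm z) (grad g ψ (e'.symm z)) j *
          coord e (e.symm y) (Q (e.symm y) (e'.symm z) (frame e' z j)) i := by
  rw [gradKernel, inner_grad, diff_eq_sum hφ he hy]
  refine Finset.sum_congr rfl fun i _ => ?_
  rw [coord_apply_grad he' hz, Finset.mul_sum]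
  exact Finset.sum_congr rfl fun j _ => by ring

theorem smoothTwo_gradKernel {Q : Kernel d M} (hQ : SmoothKernel Q) {φ ψ : M → ℝ}
    (hφ : ContMDiff (𝓡 d) 𝓘(ℝ, ℝ) ∞ φ) (hψ : ContMDiff (𝓡 d) 𝓘(ℝ, ℝ) ∞ ψ) :
    SmoothTwo (d := d) (gradKernel g Q φ ψ) := by
  intro e he e' he'
  refine ContDiffOn.congr (ContDiffOn.sum (s := Finset.univ) fun i _ =>
    ContDiffOn.sum (s := Finset.univ) fun j _ => ContDiffOn.mul (ContDiffOn.mul ?_ ?_)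
      (hQ e he e' he' i j)) fun z hz => gradKernel_chart g Q hφ he he' hz.1 hz.2
  · exact (contDiffOn_partial e.open_target (contMDiff_iff_contDiffOn_charts.1 hφ e he)
      (stdVec i)).comp contDiff_fst.contDiffOn fun z hz => hz.1
  · exact (contDiffOn_coords_grad g hψ he' j).comp contDiff_snd.contDiffOn fun z hz => hz.2

/-- Smoothness of a field of endomorphisms of the tangent spaces. -/
def SmoothEndField (A : ∀ x : M, TangentSpace (𝓡 d) x →L[ℝ] TangentSpace (𝓡 d) x) : Prop :=
  ∀ e ∈ atlas (Eu d) M, ∀ i j : Fin d,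
    ContDiffOn ℝ ∞ (fun y => coord e (e.symm y) (A (e.symm y) (frame e y j)) i) e.target

theorem SmoothKernel.smoothEndField {Q : Kernel d M} (hQ : SmoothKernel Q) :
    SmoothEndField (fun x => Q x x) := fun e he i j =>
  (hQ e he e he i j).comp (f := fun y : Eu d => (y, y)) (contDiff_id.prodMk contDiff_id).contDiffOn
    fun _ hy => ⟨hy, hy⟩

theorem smoothEndField_id : SmoothEndField
    (fun x : M => ContinuousLinearMap.id ℝ (TangentSpace (𝓡 d) x)) := fun e he i j =>
  (contDiffOn_const (c := (stdVec j : Eu d) i)).congr fun y hy => by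
    rw [coord_eq, frame_eq, ContinuousLinearMap.id_apply, coords_ofCoords he hy]

variable {A : ∀ x : M, TangentSpace (𝓡 d) x →L[ℝ] TangentSpace (𝓡 d) x}

theorem contDiffOn_coords_apply_grad (hA : SmoothEndField A) {φ : M → ℝ}
    (hφ : ContMDiff (𝓡 d) 𝓘(ℝ, ℝ) ∞ φ) (he : e ∈ atlas (Eu d) M) (i : Fin d) :
    ContDiffOn ℝ ∞ (fun y => coords e (e.symm y) (A (e.symm y) (grad g φ (e.symm y))) i)
      e.target := by
  have h : ContDiffOn ℝ ∞ (fun y => ∑ j, coords e (e.symm y) (grad g φ (e.symm y)) j *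
      coord e (e.symm y) (A (e.symm y) (frame e y j)) i) e.target :=
    ContDiffOn.sum (s := Finset.univ) fun j _ =>
      (contDiffOn_coords_grad g hφ he j).mul (hA e he i j)
  refine h.congr fun y hy => ?_
  rw [← coord_eq]
  exact coord_apply_grad he hy (A (e.symm y)) (grad g φ (e.symm y)) i

theorem contMDiff_divGrad (hA : SmoothEndField A) {φ : M → ℝ}
    (hφ : ContMDiff (𝓡 d) 𝓘(ℝ, ℝ) ∞ φ) : ContMDiff (𝓡 d) 𝓘(ℝ, ℝ) ∞ (divGrad g A φ) := by
  have h := contMDiff_divergence g (X := fun x => A x (grad g φ x))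
    (fun e he i => contDiffOn_coords_apply_grad g hA hφ he i)
  exact h

/-- The product rule exhibits the operator as linear in the components of `A` and their first
derivatives, with coefficients independent of `A`. -/
theorem divGrad_chart (hA : SmoothEndField A) {φ : M → ℝ} (hφ : ContMDiff (𝓡 d) 𝓘(ℝ, ℝ) ∞ φ)
    (he : e ∈ atlas (Eu d) M) {y : Eu d} (hy : y ∈ e.target) :
    divGrad g A φ (e.symm y) = (density g e y)⁻¹ * ∑ i, ∑ j,
      (density g e y * coords e (e.symm y) (grad g φ (e.symm y)) j *
        fderiv ℝ (fun y => coord e (e.symm y) (A (e.symm y) (frame e y j)) i) y (stdVec i) +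
      coord e (e.symm y) (A (e.symm y) (frame e y j)) i * fderiv ℝ (fun y => density g e y *
        coords e (e.symm y) (grad g φ (e.symm y)) j) y (stdVec i)) := by
  have h0 := divergence_eq_divChart g (X := fun x => A x (grad g φ x))
    (fun e he i => contDiffOn_coords_apply_grad g hA hφ he i) he hy
  rw [divGrad, h0, divChart]
  congr 1
  refine Finset.sum_congr rfl fun i _ => ?_
  have hdiff : ∀ {f : Eu d → ℝ}, ContDiffOn ℝ ∞ f e.target → DifferentiableAt ℝ f y := fun hf =>
    (hf.contDiffAt (e.open_target.mem_nhds hy)).differentiableAt (by simp)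
  have hH : ∀ j, DifferentiableAt ℝ (fun y => density g e y *
      coords e (e.symm y) (grad g φ (e.symm y)) j) y := fun j =>
    hdiff ((contDiffOn_density g he).mul (contDiffOn_coords_grad g hφ he j))
  have ha : ∀ j, DifferentiableAt ℝ
      (fun y => coord e (e.symm y) (A (e.symm y) (frame e y j)) i) y := fun j => hdiff (hA e he i j)
  have hev : (fun z => density g e z *
      fieldCoords e (fun x => A x (grad g φ x)) z i) =ᶠ[𝓝 y] fun z => ∑ j, (density g e z *
      coords e (e.symm z) (grad g φ (e.symm z)) j) *
        coord e (e.symm z) (A (e.symm z) (frame e z j)) i := by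
    filter_upwards [e.open_target.mem_nhds hy] with z hz
    have h1 : fieldCoords e (fun x => A x (grad g φ x)) z i = _ := coord_apply_grad he hz _ _ i
    rw [h1, Finset.mul_sum]
    exact Finset.sum_congr rfl fun j _ => by ring
  rw [hev.fderiv_eq, fderiv_fun_sum fun j _ => (hH j).fun_mul (ha j), sum_apply]
  refine Finset.sum_congr rfl fun j _ => ?_
  rw [fderiv_fun_mul (hH j) (ha j)]
  rfl

end Coefficients


/-! ### Uniform convergence of the coefficients -/

section Convergence

set_option linter.unusedSectionVars false

variable {d : ℕ} {M : Type*} [TopologicalSpace M] [ChartedSpace (Eu d) M] [IsManifold (𝓡 d) ∞ M]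
  {e : OpenPartialHomeomorph M (Eu d)} (g : Metric d M)

/-- Convergence along `atTop ×ˢ 𝓟 K` is uniform convergence on `K`, in a form to which the algebra
of limits applies. Only derivatives of order zero and one are extracted from the `C^∞` convergence.
-/
theorem TendstoSmoothOn.tendsto_sub {F : ℕ → Eu d → ℝ} {G : Eu d → ℝ} {U K : Set (Eu d)}
    (h : TendstoSmoothOn F G U) (hK : IsCompact K) (hKU : K ⊆ U) :
    Tendsto (fun q : ℕ × Eu d => F q.1 q.2 - G q.2) (atTop ×ˢ 𝓟 K) (𝓝 0) := by
  rw [Metric.tendsto_nhds]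
  intro ε hε
  rw [eventually_prod_principal_iff]
  filter_upwards [Metric.tendstoUniformlyOn_iff.1 (h K hK hKU 0) ε hε] with n hn y hy
  have h1 := hn y hy
  rw [dist_comm, dist_eq_norm] at h1
  refine lt_of_le_of_lt ?_ h1
  have h2 := ContinuousMultilinearMap.le_opNorm
    (iteratedFDeriv ℝ 0 (F n) y - iteratedFDeriv ℝ 0 G y) (fun i => i.elim0)
  simpa using h2

theorem TendstoSmoothOn.tendsto_fderiv_sub {F : ℕ → Eu d → ℝ} {G : Eu d → ℝ} {U K : Set (Eu d)}
    (h : TendstoSmoothOn F G U) (hK : IsCompact K) (hKU : K ⊆ U) (v : Eu d) :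
    Tendsto (fun q : ℕ × Eu d => fderiv ℝ (F q.1) q.2 v - fderiv ℝ G q.2 v)
      (atTop ×ˢ 𝓟 K) (𝓝 0) := by
  rw [Metric.tendsto_nhds]
  intro ε hε
  rw [eventually_prod_principal_iff]
  have hε' : 0 < ε / (‖v‖ + 1) := by positivity
  filter_upwards [Metric.tendstoUniformlyOn_iff.1 (h K hK hKU 1) _ hε'] with n hn y hy
  have h1 := hn y hy
  rw [dist_comm, dist_eq_norm] at h1
  have h2 := ContinuousMultilinearMap.le_opNorm
    (iteratedFDeriv ℝ 1 (F n) y - iteratedFDeriv ℝ 1 G y) (fun _ => v)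
  rw [sub_apply, iteratedFDeriv_one_apply, iteratedFDeriv_one_apply,
    Fin.prod_univ_one] at h2
  rw [dist_zero_right]
  refine h2.trans_lt ?_
  rw [lt_div_iff₀ (by positivity)] at h1
  nlinarith [norm_nonneg (iteratedFDeriv ℝ 1 (F n) y - iteratedFDeriv ℝ 1 G y)]

theorem tendsto_mul_of_continuousOn {F : ℕ × Eu d → ℝ} {c : Eu d → ℝ} {K : Set (Eu d)}
    (hK : IsCompact K) (hc : ContinuousOn c K) (hF : Tendsto F (atTop ×ˢ 𝓟 K) (𝓝 0)) :
    Tendsto (fun q => c q.2 * F q) (atTop ×ˢ 𝓟 K) (𝓝 0) := by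
  obtain ⟨C, hC⟩ := hK.exists_bound_of_continuousOn hc
  have hb : IsBoundedUnder (· ≤ ·) ((atTop : Filter ℕ) ×ˢ 𝓟 K)
      (fun q : ℕ × Eu d => ‖c q.2‖) := by
    refine isBoundedUnder_of_eventually_le (a := C) ?_
    rw [eventually_prod_principal_iff]
    exact Eventually.of_forall fun n y hy => hC y hy
  have := hF.zero_mul_isBoundedUnder_le hb
  simpa only [mul_comm] using this

theorem tendsto_prod_principal_univ [T2Space M] [CompactSpace M] {f : ℕ × M → ℝ}
    (h : ∀ e ∈ atlas (Eu d) M, ∀ K, IsCompact K → K ⊆ e.target →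
      Tendsto (fun q : ℕ × Eu d => f (q.1, e.symm q.2)) (atTop ×ˢ 𝓟 K) (𝓝 0)) :
    Tendsto f (atTop ×ˢ 𝓟 Set.univ) (𝓝 0) := by
  obtain ⟨t, K, hK, hKs, hcov⟩ := exists_finite_cover d M
  rw [Metric.tendsto_nhds]
  intro ε hε
  rw [eventually_prod_principal_iff]
  have h1 : ∀ c ∈ t, ∀ᶠ n in atTop, ∀ y ∈ chartAt (Eu d) c '' K c,
      dist (f (n, (chartAt (Eu d) c).symm y)) 0 < ε := fun c _ =>
    eventually_prod_principal_iff.1 (Metric.tendsto_nhds.1 (h _ (chart_mem_atlas (Eu d) c)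
      (chartAt (Eu d) c '' K c)
      ((hK c).image_of_continuousOn ((chartAt (Eu d) c).continuousOn.mono (hKs c)))
      (by rintro _ ⟨x, hx, rfl⟩; exact (chartAt (Eu d) c).map_source (hKs c hx))) ε hε)
  filter_upwards [(eventually_all_finset t).2 h1] with n hn x _
  obtain ⟨c, hc, hx⟩ := hcov x
  simpa [(chartAt (Eu d) c).left_inv (hKs c hx)] using hn c hc _ ⟨x, hx, rfl⟩

variable {A : ℕ → ∀ x : M, TangentSpace (𝓡 d) x →L[ℝ] TangentSpace (𝓡 d) x}
  {B : ∀ x : M, TangentSpace (𝓡 d) x →L[ℝ] TangentSpace (𝓡 d) x}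

theorem tendsto_divGrad_sub [T2Space M] [CompactSpace M] (hA : ∀ n, SmoothEndField (A n))
    (hB : SmoothEndField B) (h : TendstoEndField A B) {φ : M → ℝ}
    (hφ : ContMDiff (𝓡 d) 𝓘(ℝ, ℝ) ∞ φ) :
    Tendsto (fun q : ℕ × M => divGrad g (A q.1) φ q.2 - divGrad g B φ q.2)
      (atTop ×ˢ 𝓟 Set.univ) (𝓝 0) := by
  refine tendsto_prod_principal_univ (d := d) fun e he K hK hKt => ?_
  have hρ := contDiffOn_density g he
  have hH : ∀ j, ContDiffOn ℝ ∞ (fun y => density g e y *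
      coords e (e.symm y) (grad g φ (e.symm y)) j) e.target := fun j =>
    hρ.mul (contDiffOn_coords_grad g hφ he j)
  have h1 : Tendsto (fun q : ℕ × Eu d => (density g e q.2)⁻¹ * ∑ i, ∑ j,
      ((density g e q.2 * coords e (e.symm q.2) (grad g φ (e.symm q.2)) j) *
        (fderiv ℝ (fun y => coord e (e.symm y) (A q.1 (e.symm y) (frame e y j)) i) q.2 (stdVec i) -
        fderiv ℝ (fun y => coord e (e.symm y) (B (e.symm y) (frame e y j)) i) q.2 (stdVec i)) +
      fderiv ℝ (fun y => density g e y *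
        coords e (e.symm y) (grad g φ (e.symm y)) j) q.2 (stdVec i) *
        (coord e (e.symm q.2) (A q.1 (e.symm q.2) (frame e q.2 j)) i -
          coord e (e.symm q.2) (B (e.symm q.2) (frame e q.2 j)) i)))
      (atTop ×ˢ 𝓟 K) (𝓝 0) := by
    refine tendsto_mul_of_continuousOn hK
      ((hρ.inv fun _ hy => (density_pos g he hy).ne').continuousOn.mono hKt) ?_
    have : (0 : ℝ) = ∑ i : Fin d, ∑ j : Fin d, (0 + 0) := by simp
    rw [this]
    refine tendsto_finsetSum _ fun i _ => tendsto_finsetSum _ fun j _ => Tendsto.add ?_ ?_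
    · exact tendsto_mul_of_continuousOn hK ((hH j).continuousOn.mono hKt)
        ((h e he i j).tendsto_fderiv_sub hK hKt (stdVec i))
    · exact tendsto_mul_of_continuousOn hK ((contDiffOn_partial e.open_target (hH j)
        (stdVec i)).continuousOn.mono hKt) ((h e he i j).tendsto_sub hK hKt)
  refine h1.congr' ?_
  have hev : ∀ᶠ q : ℕ × Eu d in atTop ×ˢ 𝓟 K, q.2 ∈ K :=
    eventually_prod_principal_iff.2 (Eventually.of_forall fun _ _ hy => hy)
  filter_upwards [hev] with q hq
  rw [divGrad_chart g (hA q.1) hφ he (hKt hq), divGrad_chart g hB hφ he (hKt hq), ← mul_sub,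
    ← Finset.sum_sub_distrib]
  congr 1
  refine Finset.sum_congr rfl fun i _ => ?_
  rw [← Finset.sum_sub_distrib]
  exact Finset.sum_congr rfl fun j _ => by ring

theorem inner_grad_apply_grad_chart (S : ∀ x : M, TangentSpace (𝓡 d) x →L[ℝ] TangentSpace (𝓡 d) x)
    {φ ψ : M → ℝ} (hφ : ContMDiff (𝓡 d) 𝓘(ℝ, ℝ) ∞ φ) (he : e ∈ atlas (Eu d) M) {y : Eu d}
    (hy : y ∈ e.target) :
    g.inner (e.symm y) (grad g φ (e.symm y)) (S (e.symm y) (grad g ψ (e.symm y))) =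
      ∑ i, ∑ j, fderiv ℝ (fun y => φ (e.symm y)) y (stdVec i) *
        coords e (e.symm y) (grad g ψ (e.symm y)) j *
          coord e (e.symm y) (S (e.symm y) (frame e y j)) i := by
  rw [inner_grad, diff_eq_sum hφ he hy]
  refine Finset.sum_congr rfl fun i _ => ?_
  rw [coord_apply_grad he hy, Finset.mul_sum]
  exact Finset.sum_congr rfl fun j _ => by ring

theorem contMDiff_inner_grad_apply_grad (hB : SmoothEndField B) {φ ψ : M → ℝ}
    (hφ : ContMDiff (𝓡 d) 𝓘(ℝ, ℝ) ∞ φ) (hψ : ContMDiff (𝓡 d) 𝓘(ℝ, ℝ) ∞ ψ) :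
    ContMDiff (𝓡 d) 𝓘(ℝ, ℝ) ∞ (fun x => g.inner x (grad g φ x) (B x (grad g ψ x))) := by
  rw [contMDiff_iff_contDiffOn_charts]
  intro e he
  refine ContDiffOn.congr (ContDiffOn.sum (s := Finset.univ) fun i _ =>
    ContDiffOn.sum (s := Finset.univ) fun j _ => ContDiffOn.mul (ContDiffOn.mul ?_ ?_)
      (hB e he i j)) fun y hy => inner_grad_apply_grad_chart g B hφ he hy
  · exact contDiffOn_partial e.open_target (contMDiff_iff_contDiffOn_charts.1 hφ e he) (stdVec i)
  · exact contDiffOn_coords_grad g hψ he j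

theorem tendsto_inner_grad_apply_grad_sub [T2Space M] [CompactSpace M] (h : TendstoEndField A B)
    {φ ψ : M → ℝ} (hφ : ContMDiff (𝓡 d) 𝓘(ℝ, ℝ) ∞ φ) (hψ : ContMDiff (𝓡 d) 𝓘(ℝ, ℝ) ∞ ψ) :
    Tendsto (fun q : ℕ × M => g.inner q.2 (grad g φ q.2) (A q.1 q.2 (grad g ψ q.2)) -
      g.inner q.2 (grad g φ q.2) (B q.2 (grad g ψ q.2))) (atTop ×ˢ 𝓟 Set.univ) (𝓝 0) := by
  refine tendsto_prod_principal_univ (d := d) fun e he K hK hKt => ?_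
  have h1 : Tendsto (fun q : ℕ × Eu d => ∑ i, ∑ j,
      (fderiv ℝ (fun y => φ (e.symm y)) q.2 (stdVec i) *
        coords e (e.symm q.2) (grad g ψ (e.symm q.2)) j) *
        (coord e (e.symm q.2) (A q.1 (e.symm q.2) (frame e q.2 j)) i -
          coord e (e.symm q.2) (B (e.symm q.2) (frame e q.2 j)) i))
      (atTop ×ˢ 𝓟 K) (𝓝 0) := by
    have : (0 : ℝ) = ∑ i : Fin d, ∑ j : Fin d, 0 := by simp
    rw [this]
    refine tendsto_finsetSum _ fun i _ => tendsto_finsetSum _ fun j _ => ?_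
    exact tendsto_mul_of_continuousOn hK (((contDiffOn_partial e.open_target
      (contMDiff_iff_contDiffOn_charts.1 hφ e he) (stdVec i)).mul
      (contDiffOn_coords_grad g hψ he j)).continuousOn.mono hKt) ((h e he i j).tendsto_sub hK hKt)
  refine h1.congr' ?_
  have hev : ∀ᶠ q : ℕ × Eu d in atTop ×ˢ 𝓟 K, q.2 ∈ K :=
    eventually_prod_principal_iff.2 (Eventually.of_forall fun _ _ hy => hy)
  filter_upwards [hev] with q hq
  rw [inner_grad_apply_grad_chart g (A q.1) hφ he (hKt hq),
    inner_grad_apply_grad_chart g B hφ he (hKt hq), ← Finset.sum_sub_distrib]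
  refine Finset.sum_congr rfl fun i _ => ?_
  rw [← Finset.sum_sub_distrib]
  exact Finset.sum_congr rfl fun j _ => by ring

theorem tendsto_integral_zero {α : Type*} [MeasurableSpace α] (ν : Measure α) [IsFiniteMeasure ν]
    {f : ℕ × α → ℝ} (h : Tendsto f (atTop ×ˢ 𝓟 Set.univ) (𝓝 0)) :
    Tendsto (fun n => ∫ x, f (n, x) ∂ν) atTop (𝓝 0) := by
  rw [Metric.tendsto_nhds]
  intro ε hε
  have hε' : 0 < ε / (ν.real Set.univ + 1) := by positivity
  filter_upwards [eventually_prod_principal_iff.1 (Metric.tendsto_nhds.1 h _ hε')] with n hn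
  rw [dist_zero_right]
  refine (norm_integral_le_of_norm_le_const (C := ε / (ν.real Set.univ + 1))
    (Eventually.of_forall fun x => ?_)).trans_lt ?_
  · simpa using (hn x (Set.mem_univ x)).le
  · rw [div_mul_eq_mul_div, div_lt_iff₀ (by positivity)]
    nlinarith [measureReal_nonneg (μ := ν) (s := Set.univ)]

end Convergence

/-! ### The Hilbert–Schmidt norm -/

section HilbertSchmidt

set_option linter.unusedSectionVars false

variable {d : ℕ} {M : Type*} [TopologicalSpace M] [ChartedSpace (Eu d) M] [IsManifold (𝓡 d) ∞ M]
  (g : Metric d M)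

theorem inner_self_nonneg (x : M) (v : TangentSpace (𝓡 d) x) : 0 ≤ g.inner x v v := by
  rcases eq_or_ne v 0 with rfl | hv
  · simp
  · exact (g.pos x v hv).le

/-- Cauchy–Schwarz by the discriminant, since the metric enters only as a bilinear form. -/
theorem inner_sq_le (x : M) (v w : TangentSpace (𝓡 d) x) :
    (g.inner x v w) ^ 2 ≤ g.inner x v v * g.inner x w w := by
  have h : ∀ t : ℝ, 0 ≤ g.inner x w w * (t * t) + 2 * g.inner x v w * t + g.inner x v v := by
    intro t
    have h1 := inner_self_nonneg g x (v + t • w)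
    simp only [map_add, map_smul, add_apply, smul_apply, smul_eq_mul, g.symm x w v] at h1
    linarith
  have h2 := discrim_le_zero h
  rw [discrim] at h2
  nlinarith

/-- The vectors of the standard basis in the preferred trivialization of the tangent bundle. -/
noncomputable def tangentVec (y : M) (j : Fin d) : TangentSpace (𝓡 d) y := (stdVec j : Eu d)

theorem exists_eq_sum_tangentVec (y : M) (b : TangentSpace (𝓡 d) y) :
    ∃ c : Fin d → ℝ, b = ∑ j, c j • tangentVec y j :=
  ⟨fun j => (show Eu d from b) j, eq_sum_stdVec (d := d) b⟩

theorem inner_sum_smul (x : M) {ι : Type*} [Fintype ι] (c c' : ι → ℝ)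
    (w w' : ι → TangentSpace (𝓡 d) x) :
    g.inner x (∑ j, c j • w j) (∑ l, c' l • w' l) =
      ∑ j, ∑ l, c j * c' l * g.inner x (w j) (w' l) := by
  simp only [map_sum, map_smul, sum_apply, smul_apply, smul_eq_mul, Finset.mul_sum]
  rw [Finset.sum_comm]
  exact Finset.sum_congr rfl fun i _ => Finset.sum_congr rfl fun j _ => by ring

/-- The Gram matrix of the standard basis. -/
noncomputable def tangentGram (g : Metric d M) (y : M) : Matrix (Fin d) (Fin d) ℝ :=
  Matrix.of fun j l => g.inner y (tangentVec y j) (tangentVec y l)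

theorem tangentGram_posDef (y : M) : (tangentGram g y).PosDef := by
  refine Matrix.PosDef.of_dotProduct_mulVec_pos ?_ fun c hc => ?_
  · ext i j
    simp [tangentGram, g.symm]
  · have hne : ∑ j, c j • tangentVec y j ≠ 0 := by
      intro h
      have h1 : (WithLp.toLp 2 c : Eu d) = 0 := (eq_sum_stdVec _).trans h
      exact hc (by simpa using h1)
    refine (g.pos y _ hne).trans_eq ?_
    rw [inner_sum_smul]
    simp [dotProduct, Matrix.mulVec, Finset.mul_sum, tangentGram, mul_assoc, mul_comm]

-- Factor the inverse Gram matrix as `Bᵀ B`, which amounts to choosing an orthonormal basis of `T_y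
-- M`. The pairing becomes `p · q`, where `p` holds the components of `b`, so `|p|² = |b|²`, and
-- each entry of `q` pairs `a` with the image of a basis vector. Two applications of Cauchy–Schwarz
-- finish.
open MatrixOrder in
theorem inner_apply_sq_le (x y : M) (S : TangentSpace (𝓡 d) y →L[ℝ] TangentSpace (𝓡 d) x)
    (a : TangentSpace (𝓡 d) x) (b : TangentSpace (𝓡 d) y) :
    (g.inner x a (S b)) ^ 2 ≤ g.inner x a a * g.inner y b b * hsNormSq g x y S := by
  obtain ⟨c, rfl⟩ := exists_eq_sum_tangentVec y b
  set G := tangentGram g y with hG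
  set w : Fin d → TangentSpace (𝓡 d) x := fun j => S (tangentVec y j) with hw
  have hhs : hsNormSq g x y S = ∑ j, ∑ l, G⁻¹ j l * g.inner x (w j) (w l) := rfl
  have hGpd := tangentGram_posDef g y
  obtain ⟨B, hB⟩ : ∃ B : Matrix (Fin d) (Fin d) ℝ, G⁻¹ = B.transpose * B := by
    refine ⟨CFC.sqrt G⁻¹, ?_⟩
    have h1 : (CFC.sqrt G⁻¹).conjTranspose = CFC.sqrt G⁻¹ :=
      (CFC.sqrt_nonneg G⁻¹).isSelfAdjoint
    rw [Matrix.conjTranspose_eq_transpose_of_trivial] at h1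
    rw [h1, CFC.sqrt_mul_sqrt_self _ hGpd.inv.posSemidef.nonneg]
  have hinv : G⁻¹ * G = 1 := Matrix.nonsing_inv_mul _ hGpd.det_pos.ne'.isUnit
  have hsymm : G.transpose = G := by
    ext i j
    simp [hG, tangentGram, g.symm]
  set t : Fin d → ℝ := fun j => g.inner x a (w j) with ht
  set p : Fin d → ℝ := B.mulVec (G.mulVec c) with hp
  set q : Fin d → ℝ := B.mulVec t with hq
  have h1 : g.inner x a (S (∑ j, c j • tangentVec y j)) = ∑ m, p m * q m := by
    have h2 : dotProduct p q = dotProduct c t := by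
      rw [hp, hq, Matrix.dotProduct_mulVec, Matrix.vecMul_mulVec, ← hB, ← Matrix.mulVec_transpose,
        Matrix.mulVec_mulVec, Matrix.transpose_nonsing_inv, hsymm, hinv, Matrix.one_mulVec]
    refine Eq.trans ?_ h2.symm
    simp [dotProduct, ht, hw]
  have h2 : ∑ m, p m ^ 2 = g.inner y (∑ j, c j • tangentVec y j) (∑ j, c j • tangentVec y j) := by
    have h3 : dotProduct p p = dotProduct c (G.mulVec c) := by
      rw [hp, Matrix.dotProduct_mulVec, Matrix.vecMul_mulVec, ← hB, ← Matrix.mulVec_transpose,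
        Matrix.mulVec_mulVec, Matrix.transpose_nonsing_inv, hsymm, hinv, Matrix.one_mulVec]
    rw [inner_sum_smul]
    refine Eq.trans (by simp [dotProduct, sq]) (h3.trans ?_)
    simp [dotProduct, Matrix.mulVec, Finset.mul_sum, hG, tangentGram, mul_assoc, mul_comm]
  have h3 : ∑ m, q m ^ 2 ≤ g.inner x a a * hsNormSq g x y S := by
    have h4 : ∀ m, q m = g.inner x a (∑ j, B m j • w j) := fun m => by
      simp [hq, Matrix.mulVec, dotProduct, ht]
    have h5 : hsNormSq g x y S =
        ∑ m, g.inner x (∑ j, B m j • w j) (∑ j, B m j • w j) := by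
      simp only [inner_sum_smul, hhs]
      refine Eq.trans ?_ Finset.sum_comm
      refine Finset.sum_congr rfl fun j _ => Eq.trans ?_ Finset.sum_comm
      refine Finset.sum_congr rfl fun l _ => ?_
      rw [hB, Matrix.mul_apply, Finset.sum_mul]
      rfl
    rw [h5, Finset.mul_sum]
    exact Finset.sum_le_sum fun m _ => by rw [h4]; exact inner_sq_le g x _ _
  rw [h1]
  calc (∑ m, p m * q m) ^ 2 ≤ (∑ m, p m ^ 2) * ∑ m, q m ^ 2 :=
        Finset.sum_mul_sq_le_sq_mul_sq _ _ _
    _ ≤ (∑ m, p m ^ 2) * (g.inner x a a * hsNormSq g x y S) :=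
        mul_le_mul_of_nonneg_left h3 (Finset.sum_nonneg fun m _ => sq_nonneg _)
    _ = _ := by rw [h2]; ring

end HilbertSchmidt


/-! ### Convergence to zero in `L^p` -/

section LpConvergence

variable {Ω : Type*} [MeasurableSpace Ω]

/-- Convergence to zero in `L^p`. -/
structure TendstoZeroLp (p : ℝ≥0∞) (μ : Measure Ω) (X : ℕ → Ω → ℝ) : Prop where
  memLp : ∀ n, MemLp (X n) p μ
  tendsto : Tendsto (fun n => eLpNorm (X n) p μ) atTop (𝓝 0)

variable {p : ℝ≥0∞} {μ : Measure Ω} {X Y : ℕ → Ω → ℝ}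

theorem TendstoZeroLp.add (hp : 1 ≤ p) (hX : TendstoZeroLp p μ X) (hY : TendstoZeroLp p μ Y) :
    TendstoZeroLp p μ (fun n u => X n u + Y n u) where
  memLp n := (hX.memLp n).add (hY.memLp n)
  tendsto := by
    have h := hX.tendsto.add hY.tendsto
    rw [add_zero] at h
    exact tendsto_of_tendsto_of_tendsto_of_le_of_le tendsto_const_nhds h (fun n => zero_le)
      fun n => eLpNorm_add_le (hX.memLp n).1 (hY.memLp n).1 hp

theorem tendstoZeroLp_sum (hp : 1 ≤ p) {ι : Type*} (s : Finset ι) {X : ι → ℕ → Ω → ℝ}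
    (hX : ∀ i ∈ s, TendstoZeroLp p μ (X i)) :
    TendstoZeroLp p μ (fun n u => ∑ i ∈ s, X i n u) := by
  classical
  induction s using Finset.induction_on with
  | empty =>
    simp only [Finset.sum_empty]
    exact ⟨fun _ => MemLp.zero, by simp⟩
  | insert i s hi ih =>
    simp only [Finset.sum_insert hi]
    exact (hX i (by simp)).add hp (ih fun j hj => hX j (by simp [hj]))

theorem TendstoZeroLp.bdd_mul (hX : TendstoZeroLp p μ X) {b : Ω → ℝ} (hb : Measurable b) {C : ℝ}
    (hC : ∀ u, |b u| ≤ C) : TendstoZeroLp p μ (fun n u => b u * X n u) := by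
  have hle : ∀ n u, ‖b u * X n u‖ ≤ C * ‖X n u‖ := fun n u => by
    rw [norm_mul]
    exact mul_le_mul_of_nonneg_right (hC u) (norm_nonneg _)
  refine ⟨fun n => (hX.memLp n).of_le_mul (hb.aestronglyMeasurable.mul (hX.memLp n).1)
    (Eventually.of_forall (hle n)), ?_⟩
  have h := ENNReal.Tendsto.const_mul (a := ENNReal.ofReal C) hX.tendsto
    (Or.inr ENNReal.ofReal_ne_top)
  rw [mul_zero] at h
  exact tendsto_of_tendsto_of_tendsto_of_le_of_le tendsto_const_nhds h (fun n => zero_le)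
    fun n => eLpNorm_le_mul_eLpNorm_of_ae_le_mul (Eventually.of_forall (hle n)) p

theorem tendstoZeroLp_const [IsProbabilityMeasure μ] (hp : 1 ≤ p) {c : ℕ → ℝ}
    (hc : Tendsto c atTop (𝓝 0)) : TendstoZeroLp p μ (fun n _ => c n) := by
  refine ⟨fun n => memLp_const _, ?_⟩
  have h : ∀ n, eLpNorm (fun _ : Ω => c n) p μ = ‖c n‖ₑ := fun n => by
    rw [eLpNorm_const _ (by positivity) (IsProbabilityMeasure.ne_zero μ)]
    simp
  simp only [h]
  simpa using hc.enorm

theorem tendsto_zero_of_le_mul_ofReal {x : ℕ → ℝ≥0∞} {D : ℝ≥0∞} (hD : D ≠ ⊤)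
    (h : ∀ s : ℝ, 0 < s → ∀ᶠ n in atTop, x n ≤ D * ENNReal.ofReal s) : Tendsto x atTop (𝓝 0) := by
  rw [ENNReal.tendsto_nhds_zero]
  intro ε hε
  have h1 : Tendsto (fun s : ℝ => D * ENNReal.ofReal s) (𝓝[>] 0) (𝓝 0) := by
    have h2 : Tendsto (fun s : ℝ => ENNReal.ofReal s) (𝓝[>] 0) (𝓝 0) := by
      simpa using (ENNReal.tendsto_ofReal (tendsto_id (α := ℝ) (x := 𝓝 0))).mono_left
        nhdsWithin_le_nhds
    simpa using ENNReal.Tendsto.const_mul h2 (Or.inr hD)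
  obtain ⟨s, hs, hs0⟩ := ((h1.eventually (gt_mem_nhds hε)).and self_mem_nhdsWithin).exists
  exact (h s hs0).mono fun n hn => hn.trans hs.le

/-- Here `a n` is a squared scale. Every `s` with `s² > a n` bounds the norm by a multiple of `s`
with constant independent of `n`; quantifying over `s` also covers `a n = 0`. -/
theorem tendstoZeroLp_of_lintegral_exp (hp : 1 ≤ p) (hp' : p ≠ ⊤) {a : ℕ → ℝ} {B : ℝ≥0∞}
    (hB : B ≠ ⊤) (ha : Tendsto a atTop (𝓝 0)) (hX : ∀ n, Measurable (X n))
    (h : ∀ n s, 0 < s → a n < s ^ 2 →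
      ∫⁻ u, ENNReal.ofReal (Real.exp (|X n u| / (4 * s))) ∂μ ≤ B) : TendstoZeroLp p μ X := by
  obtain ⟨D, hD, hDX⟩ := eLpNorm_le_of_lintegral_exp hp hp' B hB
  have h1 : ∀ n s, 0 < s → a n < s ^ 2 → eLpNorm (X n) p μ ≤ D * ENNReal.ofReal (4 * s) :=
    fun n s hs han => hDX μ (X n) (4 * s) (by positivity) (h n s hs han)
  refine ⟨fun n => ⟨(hX n).aestronglyMeasurable, ?_⟩, ?_⟩
  · refine (h1 n (|a n| + 1) (by positivity) ?_).trans_lt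
      (ENNReal.mul_lt_top hD.lt_top ENNReal.ofReal_lt_top)
    nlinarith [le_abs_self (a n), abs_nonneg (a n)]
  · refine tendsto_zero_of_le_mul_ofReal hD fun s hs => ?_
    filter_upwards [ha.eventually (gt_mem_nhds (show 0 < (s / 4) ^ 2 by positivity))] with n hn
    have := h1 n (s / 4) (by positivity) hn
    rwa [mul_div_cancel₀ s (by norm_num : (4 : ℝ) ≠ 0)] at this

end LpConvergence

/-! ### Cylindrical functions -/

section Cylindrical

variable {d : ℕ} {M : Type*} [TopologicalSpace M] [ChartedSpace (Eu d) M]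

theorem CylFun.measurable_eval (F : CylFun d M) : Measurable F.eval :=
  measurable_pi_lambda _ fun j => measurable_toLin (F.φ j)

theorem CylFun.measurable_d1 (F : CylFun d M) (k : Fin F.n) : Measurable (F.d1 k) :=
  (((F.contDiff.continuous_fderiv (by simp)).clm_apply continuous_const).measurable).comp
    F.measurable_eval

theorem CylFun.exists_bound_d1 (F : CylFun d M) (k : Fin F.n) : ∃ C, ∀ u, |F.d1 k u| ≤ C := by
  obtain ⟨C, hC⟩ := F.bounded 1 (by norm_num)
  refine ⟨C * ∏ _i : Fin 1, ‖(Pi.single k 1 : Fin F.n → ℝ)‖, fun u => ?_⟩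
  have h := (iteratedFDeriv ℝ 1 F.f (F.eval u)).le_opNorm fun _ => Pi.single k 1
  rw [iteratedFDeriv_one_apply] at h
  exact h.trans (mul_le_mul_of_nonneg_right (hC _) (by positivity))

theorem CylFun.contDiff_fderiv_apply (F : CylFun d M) (v : Fin F.n → ℝ) :
    ContDiff ℝ 1 (fun z => fderiv ℝ F.f z v) :=
  (F.contDiff.fderiv_right (m := 1) (by norm_num)).clm_apply contDiff_const

theorem CylFun.measurable_d2 (F : CylFun d M) (k l : Fin F.n) : Measurable (F.d2 k l) :=
  ((((F.contDiff_fderiv_apply (Pi.single l 1)).continuous_fderiv (by simp)).clm_apply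
    continuous_const).measurable).comp F.measurable_eval

theorem CylFun.exists_bound_d2 (F : CylFun d M) (k l : Fin F.n) :
    ∃ C, ∀ u, |F.d2 k l u| ≤ C := by
  obtain ⟨C, hC⟩ := F.bounded 2 le_rfl
  set m : Fin 2 → Fin F.n → ℝ := ![Pi.single k 1, Pi.single l 1] with hm
  refine ⟨C * ∏ i : Fin 2, ‖m i‖, fun u => ?_⟩
  have h := (iteratedFDeriv ℝ 2 F.f (F.eval u)).le_opNorm m
  rw [iteratedFDeriv_two_apply] at h
  have h1 : DifferentiableAt ℝ (fderiv ℝ F.f) (F.eval u) :=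
    (F.contDiff.fderiv_right (m := 1) (by norm_num)).differentiable (by simp) _
  have h2 : F.d2 k l u = fderiv ℝ (fderiv ℝ F.f) (F.eval u) (m 0) (m 1) := by
    rw [CylFun.d2, fderiv_clm_apply h1 (differentiableAt_const _)]
    simp [hm]
  rw [h2]
  exact h.trans (mul_le_mul_of_nonneg_right (hC _) (by positivity))

end Cylindrical

/-! ### Convergence of the coefficients under the white noise -/

section Main

set_option linter.unusedSectionVars false

variable {d : ℕ} {M : Type*} [TopologicalSpace M] [T2Space M] [CompactSpace M]
  [ChartedSpace (Eu d) M] [IsManifold (𝓡 d) ∞ M] [MeasurableSpace M] [BorelSpace M]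
  {g : Metric d M} {Q : ℕ → Kernel d M} {μ : Measure (Distrib d M)} {p : ℝ≥0∞}

theorem exists_bound_inner_grad (g : Metric d M) (φ : TestFun d M) :
    ∃ C, 0 ≤ C ∧ ∀ x, g.inner x (grad g φ x) (grad g φ x) ≤ C := by
  obtain ⟨C, hC0, hC⟩ := exists_bound_of_contMDiff
    (contMDiff_inner_grad_apply_grad g smoothEndField_id φ.contMDiff φ.contMDiff)
  exact ⟨C, hC0, fun x => (le_abs_self _).trans (hC x)⟩

/-- Gradients of test functions are bounded, so the kernel is dominated pointwise by the
Hilbert–Schmidt norm of `Q`. Passing to lower integrals avoids any measurability of `hsNormSq`. -/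
theorem ProperScaling.tendsto_integral_gradKernel_sq (hQ : ProperScaling g Q) (φ ψ : TestFun d M) :
    Tendsto (fun N => ∫ x, ∫ y, (gradKernel g (Q N) φ ψ x y) ^ 2 ∂(vol g) ∂(vol g)) atTop
      (𝓝 0) := by
  obtain ⟨C, hC0, hC⟩ := exists_bound_inner_grad g φ
  obtain ⟨C', hC0', hC'⟩ := exists_bound_inner_grad g ψ
  have h1 : ∀ N, ‖∫ x, ∫ y, (gradKernel g (Q N) φ ψ x y) ^ 2 ∂(vol g) ∂(vol g)‖ₑ ≤
      ENNReal.ofReal (C * C') *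
        ∫⁻ x, ∫⁻ y, ENNReal.ofReal (hsNormSq g x y (Q N x y)) ∂(vol g) ∂(vol g) := by
    intro N
    rw [← lintegral_const_mul' _ _ ENNReal.ofReal_ne_top]
    refine (enorm_integral_le_lintegral_enorm _).trans (lintegral_mono fun x => ?_)
    simp only []
    rw [← lintegral_const_mul' _ _ ENNReal.ofReal_ne_top]
    refine (enorm_integral_le_lintegral_enorm _).trans (lintegral_mono fun y => ?_)
    simp only []
    rw [Real.enorm_eq_ofReal (sq_nonneg _), ← ENNReal.ofReal_mul (by positivity)]
    -- Nonnegativity of `hsNormSq` need not be established: where it were negative,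
    -- `inner_apply_sq_le` would force the squared kernel to be at most zero.
    by_cases hneg : hsNormSq g x y (Q N x y) < 0
    · have h2 := inner_apply_sq_le g x y (Q N x y) (grad g φ x) (grad g ψ y)
      have h3 : (gradKernel g (Q N) φ ψ x y) ^ 2 ≤ 0 := h2.trans
        (mul_nonpos_of_nonneg_of_nonpos (mul_nonneg (inner_self_nonneg g x _)
          (inner_self_nonneg g y _)) hneg.le)
      rw [ENNReal.ofReal_of_nonpos h3]
      exact zero_le
    · refine ENNReal.ofReal_le_ofReal
        ((inner_apply_sq_le g x y (Q N x y) (grad g φ x) (grad g ψ y)).trans ?_)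
      exact mul_le_mul_of_nonneg_right (mul_le_mul (hC x) (hC' y) (inner_self_nonneg g y _) hC0)
        (not_lt.1 hneg)
  have h2 := ENNReal.Tendsto.const_mul (a := ENNReal.ofReal (C * C')) hQ.hilbertSchmidt
    (Or.inr ENNReal.ofReal_ne_top)
  rw [mul_zero] at h2
  rw [tendsto_zero_iff_enorm_tendsto_zero]
  exact tendsto_of_tendsto_of_tendsto_of_le_of_le tendsto_const_nhds h2 (fun n => zero_le) h1

theorem ProperScaling.tendsto_integral_gradKernel_diag (hQ : ProperScaling g Q)
    (φ ψ : TestFun d M) : Tendsto (fun N => ∫ x, gradKernel g (Q N) φ ψ x x ∂(vol g) -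
      ∫ x, g.inner x (grad g φ x) (grad g ψ x) ∂(vol g)) atTop (𝓝 0) := by
  have := isFiniteMeasure_vol g
  refine (tendsto_integral_zero (vol g) (tendsto_inner_grad_apply_grad_sub g hQ.diagonal
    φ.contMDiff ψ.contMDiff)).congr fun N => ?_
  exact integral_sub
    (integrable_of_continuous _ (contMDiff_inner_grad_apply_grad g
      (hQ.covariance N).smooth.smoothEndField φ.contMDiff ψ.contMDiff).continuous)
    (integrable_of_continuous _ (contMDiff_inner_grad_apply_grad g
      smoothEndField_id φ.contMDiff ψ.contMDiff).continuous)

theorem contMDiff_half_divGrad {A : ∀ x : M, TangentSpace (𝓡 d) x →L[ℝ] TangentSpace (𝓡 d) x}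
    (hA : SmoothEndField A) (φ : TestFun d M) :
    ContMDiff (𝓡 d) 𝓘(ℝ, ℝ) ∞ (fun x => (1 / 2 : ℝ) * divGrad g A φ x) :=
  contMDiff_const.mul (contMDiff_divGrad g hA φ.contMDiff)

theorem ProperScaling.tendsto_integral_divGrad_sub_sq (hQ : ProperScaling g Q)
    (φ : TestFun d M) : Tendsto (fun N => ∫ x, ((1 / 2 : ℝ) * divGrad g (fun z => Q N z z) φ x -
      (1 / 2 : ℝ) * laplacian g φ x) ^ 2 ∂(vol g)) atTop (𝓝 0) := by
  have := isFiniteMeasure_vol g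
  have h1 := tendsto_divGrad_sub g (fun N => (hQ.covariance N).smooth.smoothEndField)
    smoothEndField_id hQ.diagonal φ.contMDiff
  have h2 := (h1.const_mul (1 / 2 : ℝ)).pow 2
  rw [mul_zero, zero_pow two_ne_zero] at h2
  refine (tendsto_integral_zero (vol g) h2).congr fun N => ?_
  refine integral_congr_ae (Eventually.of_forall fun x => ?_)
  simp only [mul_sub]
  -- The Laplacian is by definition `divGrad` of the identity field.
  rfl

theorem IsWhiteNoiseLaw.lintegral_exp_pair_le (hμ : IsWhiteNoiseLaw g μ) {f : M → ℝ}
    (hf : ContMDiff (𝓡 d) 𝓘(ℝ, ℝ) ∞ f) {s : ℝ} (hs : 0 < s) (h : ∫ x, f x ^ 2 ∂(vol g) < s ^ 2) :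
    ∫⁻ u, ENNReal.ofReal (Real.exp (|pair u f| / (4 * s))) ∂μ ≤
      ENNReal.ofReal (2 * Real.exp 1) := by
  simp only [pair_of_contMDiff _ hf]
  refine hμ.lintegral_exp_le (toTestFun f hf) (by positivity) ?_
  simp only [coe_toTestFun]
  nlinarith [sq_nonneg s]

theorem ProperScaling.tendstoZeroLp_linear (hQ : ProperScaling g Q) (hμ : IsWhiteNoiseLaw g μ)
    (hp : 1 ≤ p) (hp' : p ≠ ⊤) (φ : TestFun d M) : TendstoZeroLp p μ fun N u =>
      pair u (fun x => (1 / 2 : ℝ) * divGrad g (fun z => Q N z z) φ x) -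
        pair u (fun x => (1 / 2 : ℝ) * laplacian g φ x) := by
  have := isFiniteMeasure_vol g
  have hs : ∀ N, ContMDiff (𝓡 d) 𝓘(ℝ, ℝ) ∞
      (fun x => (1 / 2 : ℝ) * divGrad g (fun z => Q N z z) φ x) := fun N =>
    contMDiff_half_divGrad (hQ.covariance N).smooth.smoothEndField φ
  have hs' : ContMDiff (𝓡 d) 𝓘(ℝ, ℝ) ∞ (fun x => (1 / 2 : ℝ) * laplacian g φ x) :=
    contMDiff_half_divGrad smoothEndField_id φ
  simp only [← pair_sub _ (hs _) hs']
  refine tendstoZeroLp_of_lintegral_exp hp hp' ENNReal.ofReal_ne_top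
    (hQ.tendsto_integral_divGrad_sub_sq φ) (fun N => ?_)
    (fun N s hs0 h => hμ.lintegral_exp_pair_le ((hs N).sub hs') hs0 h)
  simp only [pair_of_contMDiff _ ((hs N).sub hs')]
  exact measurable_toLin _

theorem IsWhiteNoiseLaw.memLp_pair (hμ : IsWhiteNoiseLaw g μ) (hp : 1 ≤ p) (hp' : p ≠ ⊤)
    {f : M → ℝ} (hf : ContMDiff (𝓡 d) 𝓘(ℝ, ℝ) ∞ f) : MemLp (fun u => pair u f) p μ := by
  have := isFiniteMeasure_vol g
  obtain ⟨D, hD, hDX⟩ := eLpNorm_le_of_lintegral_exp hp hp' (ENNReal.ofReal (2 * Real.exp 1))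
    ENNReal.ofReal_ne_top
  have hI : 0 ≤ ∫ x, f x ^ 2 ∂(vol g) := integral_nonneg fun x => sq_nonneg _
  refine ⟨?_, (hDX μ _ (4 * (∫ x, f x ^ 2 ∂(vol g) + 1)) (by positivity)
    (hμ.lintegral_exp_pair_le hf (by positivity) (by nlinarith))).trans_lt
    (ENNReal.mul_lt_top hD.lt_top ENNReal.ofReal_lt_top)⟩
  simp only [pair_of_contMDiff _ hf]
  exact (measurable_toLin _).aestronglyMeasurable

/-- The functional concentrates at the diagonal integral of its kernel because the kernel vanishes
in `L²`; the deterministic difference to the limit vanishes because `Q(x, x)` tends to the identity.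
-/
theorem ProperScaling.tendstoZeroLp_quadratic (hQ : ProperScaling g Q) (hμ : IsWhiteNoiseLaw g μ)
    (hp : 1 ≤ p) (hp' : p ≠ ⊤) (φ ψ : TestFun d M) : TendstoZeroLp p μ fun N u =>
      quadPair g (Q N) u φ ψ - ∫ x, g.inner x (grad g φ x) (grad g ψ x) ∂(vol g) := by
  have := isFiniteMeasure_vol g
  have := hμ.isProbabilityMeasure
  have hX : ∀ N, IsQuadraticFunctional (vol g) μ (fun u => quadPair g (Q N) u φ ψ)
      (gradKernel g (Q N) φ ψ) := fun N => isQuadraticFunctional_pair hμ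
    (smoothTwo_gradKernel g (hQ.covariance N).smooth φ.contMDiff ψ.contMDiff)
  have h1 : TendstoZeroLp p μ fun N u =>
      quadPair g (Q N) u φ ψ - ∫ x, gradKernel g (Q N) φ ψ x x ∂(vol g) :=
    tendstoZeroLp_of_lintegral_exp hp hp' ENNReal.ofReal_ne_top
      (hQ.tendsto_integral_gradKernel_sq φ ψ) (fun N => (hX N).measurable.sub_const _)
      (fun N s hs h => (hX N).lintegral_exp_le s hs h)
  have h2 := h1.add hp (tendstoZeroLp_const (μ := μ) hp (hQ.tendsto_integral_gradKernel_diag φ ψ))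
  simpa only [sub_add_sub_cancel] using h2

theorem ProperScaling.tendstoZeroLp_generator (hQ : ProperScaling g Q) (hμ : IsWhiteNoiseLaw g μ)
    (F : CylFun d M) (hp : 1 ≤ p) (hp' : p ≠ ⊤) :
    TendstoZeroLp p μ fun N u => generator g (Q N) F u - limitGenerator g F u := by
  have h1 : TendstoZeroLp p μ fun N u => ∑ k, F.d1 k u *
      (pair u (fun x => (1 / 2 : ℝ) * divGrad g (fun z => Q N z z) (F.φ k) x) -
        pair u (fun x => (1 / 2 : ℝ) * laplacian g (F.φ k) x)) :=
    tendstoZeroLp_sum hp _ fun k _ => (hQ.tendstoZeroLp_linear hμ hp hp' (F.φ k)).bdd_mul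
      (F.measurable_d1 k) (F.exists_bound_d1 k).choose_spec
  have h2 : TendstoZeroLp p μ fun N u => ∑ k, ∑ l, F.d2 k l u *
      (quadPair g (Q N) u (F.φ k) (F.φ l) -
        ∫ x, g.inner x (grad g (F.φ k) x) (grad g (F.φ l) x) ∂(vol g)) :=
    tendstoZeroLp_sum hp _ fun k _ => tendstoZeroLp_sum hp _ fun l _ =>
      (hQ.tendstoZeroLp_quadratic hμ hp hp' (F.φ k) (F.φ l)).bdd_mul
        (F.measurable_d2 k l) (F.exists_bound_d2 k l).choose_spec
  have h3 := h1.add hp (h2.bdd_mul (b := fun _ => (1 / 2 : ℝ)) measurable_const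
    (fun _ => le_rfl))
  refine cast (congrArg _ (funext fun N => funext fun u => ?_)) h3
  simp only [generator, limitGenerator, mul_sub, Finset.sum_sub_distrib]
  ring

theorem memLp_bdd_mul {Ω : Type*} [MeasurableSpace Ω] {μ : Measure Ω} {b X : Ω → ℝ}
    (hX : MemLp X p μ) (hb : Measurable b) {C : ℝ} (hC : ∀ u, |b u| ≤ C) :
    MemLp (fun u => b u * X u) p μ :=
  hX.of_le_mul (c := C) (hb.aestronglyMeasurable.mul hX.1) (Eventually.of_forall fun u => by
    rw [norm_mul]
    exact mul_le_mul_of_nonneg_right (hC u) (norm_nonneg _))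

theorem IsWhiteNoiseLaw.memLp_limitGenerator (hμ : IsWhiteNoiseLaw g μ) (F : CylFun d M)
    (hp : 1 ≤ p) (hp' : p ≠ ⊤) : MemLp (limitGenerator g F) p μ := by
  have := hμ.isProbabilityMeasure
  have h1 : MemLp (fun u => ∑ k, F.d1 k u * pair u (fun x => (1 / 2 : ℝ) *
      laplacian g (F.φ k) x)) p μ :=
    memLp_finsetSum _ fun k _ => memLp_bdd_mul
      (hμ.memLp_pair hp hp' (contMDiff_half_divGrad smoothEndField_id (F.φ k)))
      (F.measurable_d1 k) (F.exists_bound_d1 k).choose_spec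
  have h2 : MemLp (fun u => ∑ k, ∑ l, F.d2 k l u *
      ∫ x, g.inner x (grad g (F.φ k) x) (grad g (F.φ l) x) ∂(vol g)) p μ :=
    memLp_finsetSum _ fun k _ => memLp_finsetSum _ fun l _ => memLp_bdd_mul
      (memLp_const _) (F.measurable_d2 k l) (F.exists_bound_d2 k l).choose_spec
  exact h1.add (h2.const_mul (1 / 2 : ℝ))

end Main


end TransportNoise

theorem mainTheorem7 {d : ℕ} (hd : 2 ≤ d) {M : Type*} [TopologicalSpace M] [T2Space M]
    [CompactSpace M] [ChartedSpace (EuclideanSpace ℝ (Fin d)) M] [IsManifold (𝓡 d) ∞ M]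
    [MeasurableSpace M] [BorelSpace M]
    (g : TransportNoise.Metric d M)
    (Q : ℕ → TransportNoise.Kernel d M) (hQ : TransportNoise.ProperScaling g Q)
    (μ : Measure (TransportNoise.Distrib d M)) (hμ : TransportNoise.IsWhiteNoiseLaw g μ)
    (F : TransportNoise.CylFun d M) (p : ℝ≥0∞) (hp : 1 ≤ p) (hp' : p ≠ ⊤) :
    (∀ N, MemLp (TransportNoise.generator g (Q N) F) p μ) ∧
      MemLp (TransportNoise.limitGenerator g F) p μ ∧
      Tendsto (fun N => eLpNorm (fun u => TransportNoise.generator g (Q N) F u -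
        TransportNoise.limitGenerator g F u) p μ) atTop (𝓝 0) := by
  have h1 := hμ.memLp_limitGenerator F hp hp'
  have h2 := hQ.tendstoZeroLp_generator hμ F hp hp'
  refine ⟨fun N => ?_, h1, h2.tendsto⟩
  -- Membership of each generator in `L^p` follows from that of the difference and of the limit.
  simpa only [Pi.add_def, sub_add_cancel] using (h2.memLp N).add h1
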